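/- Let $L=a_4(x)D^4+a_3(x)D^3+a_2(x)D^2+a_1(x)D$ be a differential operator with real polynomial coefficients, $\deg a_k\le k$ and $a_4\neq 0$. Let $I\subseteq\mathbb R$ be a non-empty open interval (bounded or not), and let $p=\frac{1}{|a_4|}\exp\left(\frac12\int\frac{a_3}{a_4}\,dx\right)$ on each subinterval of $I$ free of zeros of $a_4$ (with an arbitrary constant of integration on each of them). The weight $p$ is called admissible if $\int_I p\,u\,dx$ converges absolutely for every polynomial $u$. Let $\mathcal D$ be any set of $C^\infty$ functions on $\mathbb R$ all of whose derivatives have at most polynomial growth, containing all polynomials; $L$ is called self-adjoint on $I$ with weight $p$ if $\int_I p\,(Lu)\,v\,dx=\int_I p\,u\,(Lv)\,dx$ for all $u,v\in\mathcal D$. Writing $L$ in a new variable $y$, $x=ry+s$ ($r\ne0$), means replacing $a_k(x)$ by $r^{-k}a_k(ry+s)$, $I$ by $\{y: ry+s\in I\}$ and $p$ by $p(ry+s)$. **Classification.** The triples $(L,I,p)$ such that $p$ is admissible and $L$ is self-adjoint on $I$ with weight $p$ are exactly the following (in particular they do not depend on the choice of $\mathcal D$). 1. If $a_4$ has no real root: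 $(L,I,p)$ is such a triple if and only if $I=\mathbb R$ and, for some real $m_0,m_1,m_2,A$ with $m_2\neq0$, some non-zero constant multiple of $L$ has $$a_4=1,\quad a_3=2(m_1-2m_2^2x),\quad a_2=4m_2^4x^2-4m_1m_2^2x+A,\quad a_1=(-m_1^2+2m_2^2+A)(m_1-2m_2^2x),$$ and $p(x)=e^{-m_2^2x^2+m_1x+m_0}$. 2. If $a_4$ has exactly one real root: $(L,I,p)$ is such a triple if and only if, after an affine change of variable and multiplication of $L$ by a non-zero constant and of $p$ by a positive constant, $I=(0,\infty)$ and, for some real $a>2$, $b<0$ and $A$, $$a_4=x^2,\quad a_3=x(a+bx),\quad a_2=\tfrac14\left[-2a+a^2+x(4A+b^2x)\right],\quad a_1=\tfrac14(2A-ab)(-2+a+bx),$$ and $p(x)=|x|^{\frac a2-2}e^{\frac b2x}$. 3. If $a_4$ has more than one real root: $(L,I,p)$ is such a triple if and only if, after an affine change of variable and multiplication of $L$ by a non-zero constant and of $p$ by a positive constant, $I=(-1,1)$, $a_4=(1-x^2)^2$ and one of the following holds. (a) For some real $a<0$ and $A$: $a_3=-2(-2+a)x(-1+x^2)$, $a_2=-2a+a^2+A(-1+x^2)$,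 $a_1=a(2-3a+a^2-A)x$, and $p(x)=(1-x^2)^{-1-\frac a2}$. (b) For some real $a,b,B$ with $b\ne0$, $b-a>0$, $b+a<0$: $a_3=-2(b+(-2+a)x)(-1+x^2)$, $$a_2=\frac{b^3+B+2(-1+a)b^2x-Bx^2+b(-2+a+2x^2-3ax^2+a^2x^2)}{b},\quad a_1=B+\frac{aBx}{b},$$ and $p(x)=(1-x)^{\frac12(-2-a-b)}(1+x)^{\frac12(-2-a+b)}$. **Eigenvalues.** Each of the operators displayed above has, for every $n\ge0$, a polynomial eigenfunction of degree $n$, and every polynomial eigenfunction of degree $n$ has eigenvalue $\lambda_n$, where - in case 1, $\lambda_n=2m_2^2\left(m_1^2-A+2m_2^2(n-2)\right)n$; - in case 2, $\lambda_n=\frac b4\,n\,(2A-ab-b+bn)$; - in case 3(a), $\lambda_n=n(-a+n-1)(-a^2-na+4a+n^2+A-n-2)$; - in case 3(b), $\lambda_n=\dfrac{(a-n+1)\,n\,(-bn^2+abn+bn-ab+B)}{b}$. -/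

import Mathlib

open Polynomial MeasureTheory Set

noncomputable section

/-- The linear differential operator `a₄ D⁴ + a₃ D³ + a₂ D² + a₁ D`, given by its real polynomial
coefficients. -/
@[ext]
structure DiffOp4 where
  a₁ : ℝ[X]
  a₂ : ℝ[X]
  a₃ : ℝ[X]
  a₄ : ℝ[X]

namespace DiffOp4

/-- The function `L u = a₄ u'''' + a₃ u''' + a₂ u'' + a₁ u'`. -/
def act (L : DiffOp4) (u : ℝ → ℝ) (x : ℝ) : ℝ :=
  L.a₄.eval x * iteratedDeriv 4 u x + L.a₃.eval x * iteratedDeriv 3 u x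
    + L.a₂.eval x * iteratedDeriv 2 u x + L.a₁.eval x * deriv u x

/-- `L` has order exactly four, and `deg a_k ≤ k` for every `k`. -/
def IsOrderFour (L : DiffOp4) : Prop :=
  L.a₄ ≠ 0 ∧ L.a₁.natDegree ≤ 1 ∧ L.a₂.natDegree ≤ 2 ∧ L.a₃.natDegree ≤ 3 ∧ L.a₄.natDegree ≤ 4

/-- The operator `κ L`. -/
def scale (κ : ℝ) (L : DiffOp4) : DiffOp4 where
  a₁ := C κ * L.a₁
  a₂ := C κ * L.a₂
  a₃ := C κ * L.a₃
  a₄ := C κ * L.a₄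

/-- The operator `L` written in the new variable `y`, where `x = r y + s` (and `r ≠ 0`):
`d/dx = r⁻¹ d/dy`, so the coefficient `a_k (x)` becomes `r⁻ᵏ a_k (r y + s)`. -/
def affine (r s : ℝ) (L : DiffOp4) : DiffOp4 where
  a₁ := C (r⁻¹) * L.a₁.comp (C r * X + C s)
  a₂ := C (r⁻¹ ^ 2) * L.a₂.comp (C r * X + C s)
  a₃ := C (r⁻¹ ^ 3) * L.a₃.comp (C r * X + C s)
  a₄ := C (r⁻¹ ^ 4) * L.a₄.comp (C r * X + C s)

/-- `p = exp (½ ∫ a₃ / a₄) / |a₄|` on every subinterval of `I` that has no zero of `a₄`; the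
indefinite integral `F` may be chosen independently on these subintervals. -/
def IsWeight (L : DiffOp4) (I : Set ℝ) (p : ℝ → ℝ) : Prop :=
  ∃ F : ℝ → ℝ, ∀ x ∈ I, L.a₄.eval x ≠ 0 →
    HasDerivAt F (L.a₃.eval x / L.a₄.eval x) x ∧
      p x = Real.exp (F x / 2) / |L.a₄.eval x|

end DiffOp4

/-- The weight `p` is admissible on `I`: all polynomials are integrable against it. -/
def AdmissibleWeight (I : Set ℝ) (p : ℝ → ℝ) : Prop :=
  ∀ q : ℝ[X], IntegrableOn (fun x => p x * q.eval x) I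

namespace DiffOp4

/-- `⟨L u, v⟩ = ⟨u, L v⟩` for all `u, v ∈ 𝒟`, where `⟨f, g⟩ = ∫_I p f g`. -/
def SymmetricOn (𝒟 : Set (ℝ → ℝ)) (L : DiffOp4) (I : Set ℝ) (p : ℝ → ℝ) : Prop :=
  ∀ u ∈ 𝒟, ∀ v ∈ 𝒟,
    ∫ x in I, p x * L.act u x * v x = ∫ x in I, p x * u x * L.act v x

/-- `L` is a fourth-order operator with `deg a_k ≤ k` that is self-adjoint on the open interval `I`
(bounded or not) with the admissible weight `p = exp (½ ∫ a₃ / a₄) / |a₄|`, where `𝒟` is the space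
of functions on which self-adjointness is tested. -/
structure SelfAdjointWith (𝒟 : Set (ℝ → ℝ)) (L : DiffOp4) (I : Set ℝ) (p : ℝ → ℝ) : Prop where
  order_four : L.IsOrderFour
  isOpen : IsOpen I
  ordConnected : I.OrdConnected
  nonempty : I.Nonempty
  weight : L.IsWeight I p
  admissible : AdmissibleWeight I p
  symmetric : L.SymmetricOn 𝒟 I p

/-- The eigenvalues of `L` on polynomials are the numbers `lam n`: there is an eigenpolynomial of
every degree `n`, and every eigenpolynomial of degree `n` belongs to the eigenvalue `lam n`. -/
def HasEigenvalues (L : DiffOp4) (lam : ℕ → ℝ) : Prop :=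
  (∀ n : ℕ, ∃ y : ℝ[X], y ≠ 0 ∧ y.natDegree = n ∧
    ∀ x, L.act (fun t => y.eval t) x = lam n * y.eval x) ∧
  ∀ (y : ℝ[X]) (μ : ℝ), y ≠ 0 →
    (∀ x, L.act (fun t => y.eval t) x = μ * y.eval x) → μ = lam y.natDegree

end DiffOp4

/-- The family with `a₄ = 1`. -/
def hermiteOp (m₁ m₂ A : ℝ) : DiffOp4 where
  a₄ := 1
  a₃ := C 2 * (C m₁ - C (2 * m₂ ^ 2) * X)
  a₂ := C (4 * m₂ ^ 4) * X ^ 2 - C (4 * m₁ * m₂ ^ 2) * X + C A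
  a₁ := C (-m₁ ^ 2 + 2 * m₂ ^ 2 + A) * (C m₁ - C (2 * m₂ ^ 2) * X)

/-- The family with `a₄ = x²`. -/
def laguerreOp (a b A : ℝ) : DiffOp4 where
  a₄ := X ^ 2
  a₃ := X * (C a + C b * X)
  a₂ := C (1 / 4) * (C (-2 * a + a ^ 2) + X * (C (4 * A) + C (b ^ 2) * X))
  a₁ := C ((2 * A - a * b) / 4) * (C (-2 + a) + C b * X)

/-- The family with `a₄ = (1 - x²)²` and `a₃` odd. -/
def gegenbauerOp (a A : ℝ) : DiffOp4 where
  a₄ := (1 - X ^ 2) ^ 2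
  a₃ := C (-2 * (-2 + a)) * X * (-1 + X ^ 2)
  a₂ := C (-2 * a + a ^ 2) + C A * (-1 + X ^ 2)
  a₁ := C (a * (2 - 3 * a + a ^ 2 - A)) * X

/-- The family with `a₄ = (1 - x²)²` and `a₃` not odd; here `b ≠ 0`. -/
def jacobiOp (a b B : ℝ) : DiffOp4 where
  a₄ := (1 - X ^ 2) ^ 2
  a₃ := C (-2) * (C b + C (-2 + a) * X) * (-1 + X ^ 2)
  a₂ := C (1 / b) * (C (b ^ 3 + B) + C (2 * (-1 + a) * b ^ 2) * X - C B * X ^ 2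
    + C b * (C (-2 + a) + C (2 - 3 * a + a ^ 2) * X ^ 2))
  a₁ := C B + C (a * B / b) * X

end

noncomputable section

open Filter Topology

namespace DiffOp4

variable {L : DiffOp4} {I : Set ℝ} {p : ℝ → ℝ} {𝒟 : Set (ℝ → ℝ)}

/-! ### Changes of variable and rescalings -/

/-! Necessity uses polynomial test functions only. Let ℓ(q) = ∫ p q. Since p > 0 off the zeros of
`a₄`, the form ℓ(uv) is positive definite on polynomials, and `L` is symmetric for it. The threefold
commutator of `L` with multiplication by x turns symmetry into the Pearson identity ℓ(2a₄q' + a₃q) =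
0 (`moment_pearson`). Together with ℓ(Lv) = 0 this yields a second identity for `a₃`, `a₂`, `a₁`
(`moment_symmetry`). Eliminating derivatives of the test polynomial between the two gives a
polynomial equation, p a₁ = (p g)' with 4 a₄ g = `secondNum` (`formal_symmetry`). Then L u = p⁻¹((p
a₄ u'')'' + (p g u')').

The ends of `I` restrict `a₄`. Both moment identities are integrals of exact derivatives, so their
boundary terms vanish at a finite end once a polynomial factor has removed the other finite end and
the zeros of `a₄` inside `I` (`tendsto_left_end`). If `a₄` did not vanish at the end, or vanished
simply, some boundary term would stay away from zero; hence a finite end is at least a double zero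
of `a₄` (`eval_derivative_a₄_left_end`). At an infinite end, integrability of p against all powers
of x forces deg a₃ ≥ deg a₄ and fixes the sign of the leading coefficients (`degree_of_Ioi_subset`),
whereas formal symmetry bounds the degrees from above (`natDegree_le_of_formal_symmetry`). So, up to
affine maps and constants, `a₄` is 1 on the line, x² on a half-line and (1 - x²)² on a bounded
interval. Comparing coefficients in the formal symmetry equation gives the families. Where p has a
positive limit at an end, that equation leaves g undetermined there, and the boundary term supplies
g = 0 (`eval_a₂_left_end`). Integrability of p at the finite ends gives the inequalities on a and b.

For sufficiency, p(Lu·v - u·Lv) is the derivative of p times a bilinear concomitant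
(`hasDerivAt_concomitant`), which tends to zero at every end. This works for all smooth functions of
temperate growth, the largest possible test space, while necessity used the smallest; so the choice
of `𝒟` is immaterial.

For the eigenvalues, `L` does not raise degrees and is symmetric for a positive definite form, so
the orthogonal polynomials are eigenfunctions, and the eigenvalue is the coefficient of xⁿ in L xⁿ.
-/

theorem scale_inv_scale {κ : ℝ} (hκ : κ ≠ 0) (L : DiffOp4) : (L.scale κ).scale κ⁻¹ = L := by
  ext1 <;> simp [scale, ← mul_assoc, ← C_mul, hκ]

theorem affine_inv_affine {r : ℝ} (hr : r ≠ 0) (s : ℝ) (L : DiffOp4) :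
    (L.affine r s).affine r⁻¹ (-s / r) = L := by
  have h : (C r * X + C s).comp (C r⁻¹ * X + C (-s / r)) = (X : ℝ[X]) := by
    have h1 : r * (-s / r) + s = 0 := by field_simp; ring
    simp only [add_comp, mul_comp, C_comp, X_comp, mul_add, ← mul_assoc, ← C_mul,
      mul_inv_cancel₀ hr, add_assoc, ← C_add, h1]
    simp
  have key : ∀ (k : ℕ) (q : ℝ[X]),
      C (r⁻¹⁻¹ ^ k) * (C (r⁻¹ ^ k) * q.comp (C r * X + C s)).comp (C r⁻¹ * X + C (-s / r)) = q := by
    intro k q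
    rw [mul_comp, C_comp, comp_assoc, h, comp_X, ← mul_assoc, ← C_mul, inv_inv, inv_pow,
      mul_inv_cancel₀ (pow_ne_zero _ hr), C_1, one_mul]
  ext1
  · simpa [affine] using key 1 L.a₁
  · exact key 2 L.a₂
  · exact key 3 L.a₃
  · exact key 4 L.a₄

theorem scale_affine (κ r s : ℝ) (L : DiffOp4) :
    (L.scale κ).affine r s = (L.affine r s).scale κ := by
  ext1 <;> simp [scale, affine] <;> ring

theorem affine_one_zero (L : DiffOp4) : L.affine 1 0 = L := by
  ext1 <;> simp [affine]

theorem scale_one (L : DiffOp4) : L.scale 1 = L := by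
  ext1 <;> simp [scale]

theorem act_scale (κ : ℝ) (L : DiffOp4) (u : ℝ → ℝ) (x : ℝ) :
    (L.scale κ).act u x = κ * L.act u x := by
  simp [act, scale]; ring

theorem iteratedDeriv_comp_affine {n : ℕ} {u : ℝ → ℝ} (hu : ContDiff ℝ n u) (r s y : ℝ) :
    iteratedDeriv n (fun y => u (r * y + s)) y = r ^ n * iteratedDeriv n u (r * y + s) := by
  have h1 := iteratedDeriv_comp_const_mul (n := n) (f := fun z => u (z + s))
    (hu.comp (contDiff_id.add contDiff_const)) r
  have h2 := iteratedDeriv_comp_add_const (n := n) (f := u) (s := s)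
  rw [h2] at h1
  exact congrFun h1 y

theorem act_affine {r : ℝ} (hr : r ≠ 0) (s : ℝ) (L : DiffOp4) {u : ℝ → ℝ} (hu : ContDiff ℝ 4 u)
    (y : ℝ) : (L.affine r s).act (fun y => u (r * y + s)) y = L.act u (r * y + s) := by
  have h1 : deriv (fun y => u (r * y + s)) y = r * deriv u (r * y + s) := by
    simpa [iteratedDeriv_one] using
      iteratedDeriv_comp_affine (n := 1) (hu.of_le (by norm_num)) r s y
  simp only [act, affine]
  rw [iteratedDeriv_comp_affine (n := 4) hu, iteratedDeriv_comp_affine (n := 3)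
    (hu.of_le (by norm_num)), iteratedDeriv_comp_affine (n := 2) (hu.of_le (by norm_num)), h1]
  simp only [eval_mul, eval_C, eval_comp, eval_add, eval_X]
  field_simp

theorem IsOrderFour.affine_scale (h : L.IsOrderFour) {r κ : ℝ} (hr : r ≠ 0) (hκ : κ ≠ 0) (s : ℝ) :
    ((L.affine r s).scale κ).IsOrderFour := by
  have hd : (C r * X + C s : ℝ[X]).natDegree = 1 := natDegree_linear hr
  have key : ∀ (k : ℕ) (c : ℝ) (q : ℝ[X]), q.natDegree ≤ k →
      (C κ * (C c * q.comp (C r * X + C s))).natDegree ≤ k := by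
    intro k c q hq
    refine (natDegree_C_mul_le _ _).trans ((natDegree_C_mul_le _ _).trans ?_)
    rw [natDegree_comp, hd, mul_one]
    exact hq
  refine ⟨?_, key _ _ _ h.2.1, key _ _ _ h.2.2.1, key _ _ _ h.2.2.2.1, key _ _ _ h.2.2.2.2⟩
  refine mul_ne_zero (C_ne_zero.2 hκ) (mul_ne_zero (C_ne_zero.2 (by positivity)) ?_)
  intro h0
  rcases comp_eq_zero_iff.1 h0 with h1 | h1
  · exact h.1 h1
  · rw [h1.2, natDegree_C] at hd
    exact zero_ne_one hd

theorem IsWeight.affine_scale (h : L.IsWeight I p) {r κ c : ℝ} (hr : r ≠ 0) (hκ : κ ≠ 0)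
    (hc : 0 < c) (s : ℝ) :
    ((L.affine r s).scale κ).IsWeight {y | r * y + s ∈ I} (fun y => c * p (r * y + s)) := by
  obtain ⟨F, hF⟩ := h
  have hpos : 0 < c * |κ| * |r⁻¹ ^ 4| := by positivity
  -- The constant added to the primitive absorbs both the factor `c` of the weight and the factor |κ
  -- r⁻⁴| gained by |a₄|; the 2 compensates the halving in the exponent.
  refine ⟨fun y => F (r * y + s) + 2 * Real.log (c * |κ| * |r⁻¹ ^ 4|), fun y hy h4 => ?_⟩
  have h4' : L.a₄.eval (r * y + s) ≠ 0 := by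
    intro h0
    apply h4
    simp [scale, affine, eval_comp, h0]
  obtain ⟨h1, h2⟩ := hF _ hy h4'
  constructor
  · have hlin : HasDerivAt (fun y : ℝ => r * y + s) r y := by
      simpa using ((hasDerivAt_id y).const_mul r).add_const s
    have h3 := (h1.comp y hlin).add_const (2 * Real.log (c * |κ| * |r⁻¹ ^ 4|))
    refine h3.congr_deriv ?_
    simp only [scale, affine, eval_mul, eval_C, eval_comp, eval_add, eval_X]
    field_simp
  · simp only [scale, affine, eval_mul, eval_C, eval_comp, eval_add, eval_X, h2, abs_mul]
    rw [add_div, mul_div_cancel_left₀ _ (two_ne_zero' ℝ), Real.exp_add, Real.exp_log hpos]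
    have : |L.a₄.eval (r * y + s)| ≠ 0 := abs_ne_zero.2 h4'
    have h5 : |r⁻¹ ^ 4| ≠ 0 := by positivity
    field_simp

theorem image_affine_preimage {r : ℝ} (hr : r ≠ 0) (s : ℝ) (I : Set ℝ) :
    (fun y => r * y + s) '' {y | r * y + s ∈ I} = I := by
  ext x
  constructor
  · rintro ⟨y, hy, rfl⟩; exact hy
  · intro hx
    have : r * ((x - s) / r) + s = x := by field_simp; ring
    exact ⟨(x - s) / r, by simpa [this] using hx, this⟩

theorem hasDerivWithinAt_affine (r s : ℝ) (J : Set ℝ) :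
    ∀ y ∈ J, HasDerivWithinAt (fun y : ℝ => r * y + s) r J y := fun y _ => by
  simpa using (((hasDerivAt_id y).const_mul r).add_const s).hasDerivWithinAt

theorem injOn_affine {r : ℝ} (hr : r ≠ 0) (s : ℝ) (J : Set ℝ) :
    InjOn (fun y : ℝ => r * y + s) J := fun x _ y _ h => by
  simpa [hr] using h

theorem isOpen_affine_preimage (hI : IsOpen I) (r s : ℝ) : IsOpen {y | r * y + s ∈ I} :=
  hI.preimage (by fun_prop : Continuous fun y : ℝ => r * y + s)

theorem ordConnected_affine_preimage (hI : I.OrdConnected) (r s : ℝ) :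
    {y | r * y + s ∈ I}.OrdConnected := by
  refine ⟨fun x hx y hy z hz => ?_⟩
  rcases le_total 0 r with hr | hr
  · exact hI.out hx hy ⟨by nlinarith [hz.1], by nlinarith [hz.2]⟩
  · exact hI.out hy hx ⟨by nlinarith [hz.2], by nlinarith [hz.1]⟩

theorem integral_affine (hI : IsOpen I) {r : ℝ} (hr : r ≠ 0) (s : ℝ) (f : ℝ → ℝ) :
    ∫ x in I, f x = |r| * ∫ y in {y | r * y + s ∈ I}, f (r * y + s) := by
  conv_lhs => rw [← image_affine_preimage hr s I]
  rw [integral_image_eq_integral_abs_deriv_smul (isOpen_affine_preimage hI r s).measurableSet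
    (hasDerivWithinAt_affine r s _) (injOn_affine hr s _), ← integral_const_mul]
  simp [smul_eq_mul]

theorem integrableOn_affine (hI : IsOpen I) {r : ℝ} (hr : r ≠ 0) (s : ℝ) {f : ℝ → ℝ}
    (hf : IntegrableOn f I) : IntegrableOn (fun y => f (r * y + s)) {y | r * y + s ∈ I} := by
  rw [← image_affine_preimage hr s I,
    integrableOn_image_iff_integrableOn_abs_deriv_smul
    (isOpen_affine_preimage hI r s).measurableSet
    (hasDerivWithinAt_affine r s _) (injOn_affine hr s _)] at hf
  have := hf.const_mul |r|⁻¹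
  simpa [IntegrableOn, smul_eq_mul, ← mul_assoc, hr] using this

theorem SelfAdjointWith.affine_scale (H : L.SelfAdjointWith 𝒟 I p)
    (hsm : ∀ f ∈ 𝒟, ContDiff ℝ 4 f) (hinv : ∀ f ∈ 𝒟, ∀ r s : ℝ, (fun y => f (r * y + s)) ∈ 𝒟)
    {r κ c : ℝ} (hr : r ≠ 0) (hκ : κ ≠ 0) (hc : 0 < c) (s : ℝ) :
    ((L.affine r s).scale κ).SelfAdjointWith 𝒟 {y | r * y + s ∈ I}
      (fun y => c * p (r * y + s)) where
  order_four := H.order_four.affine_scale hr hκ s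
  isOpen := isOpen_affine_preimage H.isOpen r s
  ordConnected := ordConnected_affine_preimage H.ordConnected r s
  nonempty := by
    obtain ⟨x, hx⟩ := H.nonempty
    rw [← image_affine_preimage hr s I] at hx
    obtain ⟨y, hy, -⟩ := hx
    exact ⟨y, hy⟩
  weight := H.weight.affine_scale hr hκ hc s
  admissible := fun q => by
    have := (integrableOn_affine H.isOpen hr s
      (H.admissible (q.comp (C r⁻¹ * X + C (-s / r))))).const_mul c
    refine IntegrableOn.congr_fun this (fun y _ => ?_)
      (isOpen_affine_preimage H.isOpen r s).measurableSet
    have h : r⁻¹ * (r * y + s) + -s / r = y := by field_simp; ring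
    simp only [eval_comp, eval_add, eval_mul, eval_C, eval_X, h]
    ring
  symmetric := fun u hu v hv => by
    set u' : ℝ → ℝ := fun x => u (r⁻¹ * x + -s / r) with hu'
    set v' : ℝ → ℝ := fun x => v (r⁻¹ * x + -s / r) with hv'
    have h : ∀ y, r⁻¹ * (r * y + s) + -s / r = y := fun y => by field_simp; ring
    have eu : u = fun y => u' (r * y + s) := by ext y; simp only [hu', h]
    have ev : v = fun y => v' (r * y + s) := by ext y; simp only [hv', h]
    have mu : u' ∈ 𝒟 := hinv u hu _ _
    have mv : v' ∈ 𝒟 := hinv v hv _ _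
    have key := H.symmetric u' mu v' mv
    rw [integral_affine H.isOpen hr s, integral_affine H.isOpen hr s] at key
    have key' := mul_left_cancel₀ (abs_ne_zero.2 hr) key
    rw [eu, ev]
    simp only [act_scale, act_affine hr s L (hsm _ mu), act_affine hr s L (hsm _ mv)]
    have e1 : ∀ y, c * p (r * y + s) * (κ * L.act u' (r * y + s)) * v' (r * y + s)
        = (c * κ) * (p (r * y + s) * L.act u' (r * y + s) * v' (r * y + s)) := fun y => by ring
    have e2 : ∀ y, c * p (r * y + s) * u' (r * y + s) * (κ * L.act v' (r * y + s))
        = (c * κ) * (p (r * y + s) * u' (r * y + s) * L.act v' (r * y + s)) := fun y => by ring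
    simp only [e1, e2, integral_const_mul, key']

theorem SelfAdjointWith.mono {𝒟' : Set (ℝ → ℝ)} (H : L.SelfAdjointWith 𝒟 I p) (h : 𝒟' ⊆ 𝒟) :
    L.SelfAdjointWith 𝒟' I p :=
  { H with symmetric := fun u hu v hv => H.symmetric u (h hu) v (h hv) }

theorem SelfAdjointWith.congr {q : ℝ → ℝ} (H : L.SelfAdjointWith 𝒟 I p) (h : ∀ x ∈ I, q x = p x) :
    L.SelfAdjointWith 𝒟 I q :=
  { H with
    weight := by
      obtain ⟨F, hF⟩ := H.weight
      exact ⟨F, fun x hx h4 => ⟨(hF x hx h4).1, (h x hx).trans (hF x hx h4).2⟩⟩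
    admissible := fun g => (H.admissible g).congr_fun (fun x hx => by simp only [h x hx])
      H.isOpen.measurableSet
    symmetric := fun u hu v hv => by
      have e1 := setIntegral_congr_fun (μ := volume) (s := I) H.isOpen.measurableSet
        (f := fun x => q x * L.act u x * v x) (g := fun x => p x * L.act u x * v x)
        (fun x hx => by simp only [h x hx])
      have e2 := setIntegral_congr_fun (μ := volume) (s := I) H.isOpen.measurableSet
        (f := fun x => q x * u x * L.act v x) (g := fun x => p x * u x * L.act v x)
        (fun x hx => by simp only [h x hx])
      rw [e1, e2]
      exact H.symmetric u hu v hv }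

/-- If the operator is self-adjoint after a change of variable and a rescaling, then it was
self-adjoint before. -/
theorem SelfAdjointWith.of_affine_scale {r κ c s : ℝ} {J : Set ℝ} {q : ℝ → ℝ} {M : DiffOp4}
    (H : M.SelfAdjointWith 𝒟 J q)
    (hsm : ∀ f ∈ 𝒟, ContDiff ℝ 4 f) (hinv : ∀ f ∈ 𝒟, ∀ r s : ℝ, (fun y => f (r * y + s)) ∈ 𝒟)
    (hr : r ≠ 0) (hκ : κ ≠ 0) (hc : 0 < c)
    (hM : (L.affine r s).scale κ = M) (hJ : {y | r * y + s ∈ I} = J)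
    (hp : ∀ y ∈ J, p (r * y + s) = c * q y) :
    L.SelfAdjointWith 𝒟 I p := by
  have h := H.affine_scale hsm hinv (inv_ne_zero hr) (inv_ne_zero hκ) hc (-s / r)
  have hx : ∀ x, r * (r⁻¹ * x + -s / r) + s = x := fun x => by field_simp; ring
  rw [← hM, ← scale_affine, scale_affine, scale_affine, scale_inv_scale hκ,
    affine_inv_affine hr] at h
  have hI : {x | r⁻¹ * x + -s / r ∈ J} = I := by
    ext x
    simp only [← hJ, mem_ofPred_eq, hx]
  rw [hI] at h
  refine h.congr fun x hxI => ?_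
  rw [← hI] at hxI
  rw [← hp _ hxI, hx]

/-- The polynomial functions. -/
def polyFunctions : Set (ℝ → ℝ) := range fun (q : ℝ[X]) (x : ℝ) => q.eval x

theorem polyFunctions_contDiff : ∀ f ∈ polyFunctions, ContDiff ℝ 4 f := by
  rintro _ ⟨q, rfl⟩
  exact q.contDiff_aeval 4

theorem polyFunctions_affine :
    ∀ f ∈ polyFunctions, ∀ r s : ℝ, (fun y => f (r * y + s)) ∈ polyFunctions := by
  rintro _ ⟨q, rfl⟩ r s
  exact ⟨q.comp (C r * X + C s), by ext y; simp [eval_comp]⟩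

theorem temperate_contDiff :
    ∀ f ∈ {f : ℝ → ℝ | Function.HasTemperateGrowth f}, ContDiff ℝ 4 f := fun f hf =>
  hf.1.of_le (by exact WithTop.coe_le_coe.2 le_top)

theorem temperate_affine : ∀ f ∈ {f : ℝ → ℝ | Function.HasTemperateGrowth f}, ∀ r s : ℝ,
    (fun y => f (r * y + s)) ∈ {f : ℝ → ℝ | Function.HasTemperateGrowth f} := by
  intro f hf r s
  have h : Function.HasTemperateGrowth fun y : ℝ => r * y + s :=
    ((Function.HasTemperateGrowth.const r).mul .id').add (.const s)
  exact Function.HasTemperateGrowth.comp hf h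

end DiffOp4

/-! ### Moment identities and formal symmetry -/

/-- The moment functional `q ↦ ∫_I p q` on polynomials of an admissible weight. -/
def AdmissibleWeight.moment {I : Set ℝ} {p : ℝ → ℝ} (h : AdmissibleWeight I p) :
    ℝ[X] →ₗ[ℝ] ℝ where
  toFun q := ∫ x in I, p x * q.eval x
  map_add' q r := by
    rw [← integral_add (h q) (h r)]
    simp only [eval_add, mul_add]
  map_smul' c q := by
    rw [RingHom.id_apply, smul_eq_mul, ← integral_const_mul]
    simp only [eval_smul, smul_eq_mul, mul_left_comm]

theorem AdmissibleWeight.moment_apply {I : Set ℝ} {p : ℝ → ℝ} (h : AdmissibleWeight I p)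
    (q : ℝ[X]) : h.moment q = ∫ x in I, p x * q.eval x := rfl

theorem AdmissibleWeight.moment_C_mul {I : Set ℝ} {p : ℝ → ℝ} (h : AdmissibleWeight I p) (c : ℝ)
    (q : ℝ[X]) : h.moment (C c * q) = c * h.moment q := by
  rw [← smul_eq_C_mul, map_smul, smul_eq_mul]

theorem Polynomial.exists_derivative_eq (w : ℝ[X]) : ∃ v : ℝ[X], derivative v = w := by
  induction w using Polynomial.induction_on' with
  | add p q hp hq =>
    obtain ⟨v, rfl⟩ := hp
    obtain ⟨w, rfl⟩ := hq
    exact ⟨v + w, derivative_add⟩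
  | monomial n a =>
    refine ⟨monomial (n + 1) (a / (n + 1)), ?_⟩
    have : (n : ℝ) + 1 ≠ 0 := by positivity
    rw [derivative_monomial, Nat.add_sub_cancel]
    congr 1
    push_cast
    field_simp

theorem Polynomial.ae_eval_ne_zero {q : ℝ[X]} (hq : q ≠ 0) : ∀ᵐ x : ℝ, q.eval x ≠ 0 :=
  measure_eq_zero_iff_ae_notMem.1 ((q.finite_setOfPred_isRoot hq).measure_zero volume)

namespace DiffOp4

variable {L : DiffOp4} {I : Set ℝ} {p : ℝ → ℝ}

/-- The action of the operator on polynomials. -/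
def polyAct (L : DiffOp4) (u : ℝ[X]) : ℝ[X] :=
  L.a₄ * derivative^[4] u + L.a₃ * derivative^[3] u + L.a₂ * derivative^[2] u
    + L.a₁ * derivative^[1] u

theorem iteratedDeriv_eval (k : ℕ) (u : ℝ[X]) :
    iteratedDeriv k (fun x => u.eval x) = fun x => (derivative^[k] u).eval x := by
  induction k generalizing u with
  | zero => simp
  | succ k ih =>
    rw [iteratedDeriv_succ']
    have : deriv (fun x => u.eval x) = fun x => (derivative u).eval x := by
      ext x; exact u.deriv
    rw [this, ih, Function.iterate_succ_apply]

theorem act_eval (L : DiffOp4) (u : ℝ[X]) (x : ℝ) :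
    L.act (fun x => u.eval x) x = (L.polyAct u).eval x := by
  simp only [act, polyAct, iteratedDeriv_eval, eval_add, eval_mul, Polynomial.deriv,
    Function.iterate_one]

theorem IsWeight.pos (h : L.IsWeight I p) {x : ℝ} (hx : x ∈ I) (h4 : L.a₄.eval x ≠ 0) :
    0 < p x := by
  obtain ⟨F, hF⟩ := h
  rw [(hF x hx h4).2]
  positivity

namespace SelfAdjointWith

variable (H : L.SelfAdjointWith polyFunctions I p)
include H

/-- The integrand p q² is nonnegative, and positive off the finitely many zeros of `a₄` and q, while
a nonempty open interval has positive measure. -/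
theorem eq_zero_of_moment_mul_self {q : ℝ[X]} (h : H.admissible.moment (q * q) = 0) : q = 0 := by
  by_contra hq
  have h4 := ae_restrict_of_ae (s := I) (ae_eval_ne_zero H.order_four.1)
  have hI := ae_restrict_mem (μ := volume) H.isOpen.measurableSet
  have hq' := ae_restrict_of_ae (s := I) (ae_eval_ne_zero hq)
  have hnn : 0 ≤ᵐ[volume.restrict I] fun x => p x * (q * q).eval x := by
    filter_upwards [h4, hI] with x h4 hx
    rw [eval_mul]
    exact mul_nonneg (H.weight.pos hx h4).le (mul_self_nonneg _)
  rw [AdmissibleWeight.moment_apply, integral_eq_zero_iff_of_nonneg_ae hnn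
    (H.admissible _)] at h
  have hF : ∀ᵐ x ∂volume.restrict I, False := by
    filter_upwards [h4, hI, hq', h] with x h4 hx hq' h
    rw [eval_mul] at h
    exact (mul_pos (H.weight.pos hx h4) (mul_self_pos.2 hq')).ne' h
  rw [ae_iff] at hF
  simp only [not_false_eq_true, ofPred_true, Measure.restrict_apply_univ] at hF
  exact (H.isOpen.measure_pos volume H.nonempty).ne' hF

theorem eq_zero_of_moment_mul {q : ℝ[X]} (h : ∀ v, H.admissible.moment (q * v) = 0) : q = 0 :=
  H.eq_zero_of_moment_mul_self (h q)

theorem moment_polyAct_mul (u v : ℝ[X]) :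
    H.admissible.moment (L.polyAct u * v) = H.admissible.moment (u * L.polyAct v) := by
  have := H.symmetric _ ⟨u, rfl⟩ _ ⟨v, rfl⟩
  simp only [act_eval] at this
  simpa only [AdmissibleWeight.moment_apply, eval_mul, mul_assoc] using this

/-- The threefold commutator of `L` with multiplication by x is 24 a₄ D + 6 a₃. Pairing it with 1
and moving each copy of `L` across by symmetry gives 12 times this identity. It is the weak form of
(p a₄)' = p a₃ / 2 with no boundary terms. -/
theorem moment_pearson (q : ℝ[X]) :
    H.admissible.moment (2 * L.a₄ * derivative q + L.a₃ * q) = 0 := by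
  have e : C 12 * (2 * L.a₄ * derivative q + L.a₃ * q) =
      (L.polyAct (X ^ 3 * q) * 1 - X ^ 3 * q * L.polyAct 1)
      - C 3 * (L.polyAct (X ^ 2 * q) * X - X ^ 2 * q * L.polyAct X)
      + C 3 * (L.polyAct (X * q) * X ^ 2 - X * q * L.polyAct (X ^ 2))
      - (L.polyAct q * X ^ 3 - q * L.polyAct (X ^ 3)) := by
    simp only [polyAct, Function.iterate_succ, Function.iterate_zero, Function.comp, id,
      derivative_mul, derivative_X, derivative_X_pow, derivative_one, derivative_add,
      map_ofNat, derivative_C, derivative_zero, Nat.cast_ofNat, derivative_ofNat]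
    norm_num
    rw [show (C 2 : ℝ[X]) = 2 from map_ofNat C 2]
    ring
  have h := congrArg H.admissible.moment e
  simp only [map_add, map_sub, AdmissibleWeight.moment_C_mul, H.moment_polyAct_mul, sub_self,
    mul_zero, add_zero] at h
  rw [map_add]
  linarith

/-- Symmetry against 1 gives ℓ(Lv) = 0 because L 1 = 0. Pearson's identity with q = v''' removes the
fourth-order term, and w = v' is arbitrary since every polynomial has a primitive. -/
theorem moment_symmetry (w : ℝ[X]) :
    H.admissible.moment (L.a₃ * derivative (derivative w) + 2 * L.a₂ * derivative w
      + 2 * L.a₁ * w) = 0 := by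
  obtain ⟨v, rfl⟩ := exists_derivative_eq w
  have h1 := H.moment_polyAct_mul v 1
  have h2 := H.moment_pearson (derivative (derivative (derivative v)))
  have h3 : L.polyAct 1 = 0 := by
    simp [polyAct]
  rw [h3, mul_zero, map_zero, mul_one] at h1
  have e : L.a₃ * derivative (derivative (derivative v)) + 2 * L.a₂ * derivative (derivative v)
      + 2 * L.a₁ * derivative v = C 2 * L.polyAct v
        - (2 * L.a₄ * derivative (derivative (derivative (derivative v)))
          + L.a₃ * derivative (derivative (derivative v))) := by
    simp only [polyAct, Function.iterate_succ, Function.iterate_zero, Function.comp, id,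
      map_ofNat]
    ring
  rw [e, map_sub, AdmissibleWeight.moment_C_mul, h1, h2]
  simp

end SelfAdjointWith

/-- Twice the numerator of the logarithmic derivative `p' / p` of the weight over `a₄`. -/
def logDerivNum (L : DiffOp4) : ℝ[X] := L.a₃ - 2 * derivative L.a₄

/-- Four times the numerator over `a₄` of `g`, where `p g` is the coefficient of the term of
order two of the operator in the symmetric form `(p a₄ u'')'' + (p g u')'`. -/
def secondNum (L : DiffOp4) : ℝ[X] :=
  4 * L.a₄ * L.a₂ - 2 * L.a₄ * derivative L.a₃ - L.logDerivNum * L.a₃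

/-- Formal symmetry of `L`: `p a₁ = (p g)'`. -/
theorem SelfAdjointWith.formal_symmetry (H : L.SelfAdjointWith polyFunctions I p) :
    8 * L.a₄ ^ 2 * L.a₁ = (L.logDerivNum - 2 * derivative L.a₄) * L.secondNum
      + 2 * derivative L.secondNum * L.a₄ := by
  rw [← sub_eq_zero]
  refine H.eq_zero_of_moment_mul fun v => ?_
  have h1 := H.moment_symmetry (L.a₄ ^ 2 * v)
  -- With the factor a₄² in the previous line, this choice of q makes the terms in v'' and v'
  -- cancel, leaving a fixed polynomial times v.
  have h2 := H.moment_pearson (2 * L.a₃ * (L.a₄ * derivative v + 2 * derivative L.a₄ * v)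
    + L.secondNum * v)
  have e : (8 * L.a₄ ^ 2 * L.a₁ - ((L.logDerivNum - 2 * derivative L.a₄) * L.secondNum
      + 2 * derivative L.secondNum * L.a₄)) * v =
      C 4 * (L.a₃ * derivative (derivative (L.a₄ ^ 2 * v)) + 2 * L.a₂ * derivative (L.a₄ ^ 2 * v)
      + 2 * L.a₁ * (L.a₄ ^ 2 * v)) - (2 * L.a₄ * derivative (2 * L.a₃ * (L.a₄ * derivative v
      + 2 * derivative L.a₄ * v) + L.secondNum * v) + L.a₃ * (2 * L.a₃ * (L.a₄ * derivative v
      + 2 * derivative L.a₄ * v) + L.secondNum * v)) := by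
    simp only [secondNum, logDerivNum, derivative_mul, derivative_add, derivative_sub,
      derivative_ofNat, map_ofNat, pow_two]
    ring
  rw [e, map_sub, AdmissibleWeight.moment_C_mul, h1, h2]
  simp

/-- The polynomial identity of formal symmetry bounds the degrees of `a₃` and `a₄`. -/
theorem natDegree_le_of_formal_symmetry
    (h : 8 * L.a₄ ^ 2 * L.a₁ = (L.logDerivNum - 2 * derivative L.a₄) * L.secondNum
      + 2 * derivative L.secondNum * L.a₄) (hL : L.IsOrderFour) (h3 : L.a₃ ≠ 0)
    (hd : L.a₄.natDegree ≤ L.a₃.natDegree) :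
    3 * L.a₃.natDegree ≤ 2 * L.a₄.natDegree + 1 ∨ 2 * L.a₃.natDegree ≤ L.a₄.natDegree + 2 := by
  obtain ⟨h4, hd1, hd2, -, -⟩ := hL
  set d := L.a₄.natDegree with hdd
  set k := L.a₃.natDegree with hk
  -- If both bounds fail, the coefficient of x^(3k) in the identity is minus the cube of the leading
  -- coefficient of `a₃`: the terms with `a₁` or `a₂` have too small a degree by `hcon`, and those
  -- with a derivative because d ≤ k.
  by_contra! hcon
  have hlc : L.a₃.coeff k ≠ 0 := by simpa [hk] using h3
  have hder : (derivative L.a₄).coeff k = 0 := by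
    rw [coeff_derivative, coeff_eq_zero_of_natDegree_lt (by omega), zero_mul]
  have hderd : (derivative L.a₄).natDegree ≤ d - 1 := natDegree_derivative_le _
  have hder3 : (derivative L.a₃).natDegree ≤ k - 1 := natDegree_derivative_le _
  have hc2 : ∀ q : ℝ[X], ∀ i, (2 * q).coeff i = 2 * q.coeff i := fun q i => by
    rw [← map_ofNat C, coeff_C_mul]
  have hn : L.logDerivNum.natDegree ≤ k := by
    refine (natDegree_sub_le_of_le (m := k) (n := k) le_rfl ?_).trans (max_self k).le
    exact (natDegree_mul_le_of_le (natDegree_ofNat 2).le le_rfl).trans (by omega)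
  have hn' : (L.logDerivNum - 2 * derivative L.a₄).natDegree ≤ k := by
    refine (natDegree_sub_le_of_le (n := k) hn ?_).trans (max_self k).le
    exact (natDegree_mul_le_of_le (natDegree_ofNat 2).le le_rfl).trans (by omega)
  have hnc : L.logDerivNum.coeff k = L.a₃.coeff k := by
    rw [logDerivNum, coeff_sub, hc2, hder]; ring
  have hnc' : (L.logDerivNum - 2 * derivative L.a₄).coeff k = L.a₃.coeff k := by
    rw [coeff_sub, hc2, hder, hnc]; ring
  have hs1 : (4 * L.a₄ * L.a₂ - 2 * L.a₄ * derivative L.a₃).natDegree ≤ max (d + 2) (d + (k - 1)) := by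
    refine natDegree_sub_le_of_le ?_ ?_
    · have := natDegree_mul_le_of_le (natDegree_mul_le_of_le (natDegree_ofNat (R := ℝ) 4).le hdd.ge) hd2
      exact this.trans (by omega)
    · have := natDegree_mul_le_of_le (natDegree_mul_le_of_le (natDegree_ofNat (R := ℝ) 2).le hdd.ge) hder3
      exact this.trans (by omega)
  have hk0 : 1 ≤ k := by omega
  have hs : L.secondNum.natDegree ≤ 2 * k := by
    refine (natDegree_sub_le_of_le (m := 2 * k) (n := 2 * k) (hs1.trans (by omega)) ?_).trans
      (max_self _).le
    exact (natDegree_mul_le_of_le hn hk.ge).trans (by omega)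
  have hsc : L.secondNum.coeff (k + k) = - (L.a₃.coeff k * L.a₃.coeff k) := by
    rw [secondNum, coeff_sub, coeff_eq_zero_of_natDegree_lt (by omega),
      coeff_mul_add_eq_of_natDegree_le hn hk.ge, hnc]
    ring
  have hL : (8 * L.a₄ ^ 2 * L.a₁).coeff (k + (k + k)) = 0 := by
    refine coeff_eq_zero_of_natDegree_lt ?_
    have := natDegree_mul_le_of_le (natDegree_mul_le_of_le (natDegree_ofNat (R := ℝ) 8).le
      (natDegree_pow_le_of_le 2 hdd.ge)) hd1
    exact this.trans_lt (by omega)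
  have hR : (2 * derivative L.secondNum * L.a₄).coeff (k + (k + k)) = 0 := by
    refine coeff_eq_zero_of_natDegree_lt ?_
    have := natDegree_mul_le_of_le (natDegree_mul_le_of_le (natDegree_ofNat (R := ℝ) 2).le
      (natDegree_derivative_le L.secondNum)) hdd.ge
    exact this.trans_lt (by omega)
  have := congrArg (fun q => coeff q (k + (k + k))) h
  simp only [coeff_add] at this
  rw [hL, hR, coeff_mul_add_eq_of_natDegree_le hn' (hs.trans (by omega)), hnc', hsc] at this
  have h5 : L.a₃.coeff k ^ 3 = 0 := by linarith
  exact hlc (pow_eq_zero_iff (by norm_num) |>.1 h5)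

/-! ### Eigenvalues on polynomials -/

theorem natDegree_mul_iterate_derivative_le {a u : ℝ[X]} {k n : ℕ} (ha : a.natDegree ≤ k)
    (hu : u.natDegree ≤ n) : (a * derivative^[k] u).natDegree ≤ n ∧
      (a * derivative^[k] u).coeff n = a.coeff k * n.descFactorial k * u.coeff n := by
  rcases lt_or_ge n k with h | h
  · rw [iterate_derivative_eq_zero (by omega), Nat.descFactorial_eq_zero_iff_lt.2 h]
    simp
  · obtain ⟨m, rfl⟩ := Nat.exists_eq_add_of_le h
    have hd : (derivative^[k] u).natDegree ≤ m :=
      (natDegree_iterate_derivative u k).trans (by omega)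
    refine ⟨natDegree_mul_le_of_le ha hd, ?_⟩
    rw [coeff_mul_add_eq_of_natDegree_le ha hd, coeff_iterate_derivative, add_comm m k, nsmul_eq_mul,
      mul_assoc]

/-- The coefficient of `xⁿ` in `L xⁿ`. -/
def diagonal (L : DiffOp4) (n : ℕ) : ℝ :=
  L.a₄.coeff 4 * n.descFactorial 4 + L.a₃.coeff 3 * n.descFactorial 3
    + L.a₂.coeff 2 * n.descFactorial 2 + L.a₁.coeff 1 * n.descFactorial 1

theorem diagonal_eq (L : DiffOp4) (n : ℕ) :
    L.diagonal n = L.a₄.coeff 4 * (n * (n - 1) * (n - 2) * (n - 3))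
      + L.a₃.coeff 3 * (n * (n - 1) * (n - 2)) + L.a₂.coeff 2 * (n * (n - 1))
      + L.a₁.coeff 1 * n := by
  have h : ∀ k : ℕ, (n.descFactorial (k + 1) : ℝ) = (n - k) * n.descFactorial k := fun k => by
    rcases le_or_gt k n with hk | hk
    · rw [Nat.descFactorial_succ]; push_cast [hk]; ring
    · rw [Nat.descFactorial_eq_zero_iff_lt.2 hk, Nat.descFactorial_eq_zero_iff_lt.2 (by omega)]
      simp
  simp only [diagonal, h 3, h 2, h 1, h 0, Nat.descFactorial_zero]
  push_cast
  ring

theorem polyAct_coeff (hL : L.IsOrderFour) {u : ℝ[X]} {n : ℕ} (hu : u.natDegree ≤ n) :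
    (L.polyAct u).natDegree ≤ n ∧ (L.polyAct u).coeff n = L.diagonal n * u.coeff n := by
  obtain ⟨-, h1, h2, h3, h4⟩ := hL
  have e1 := natDegree_mul_iterate_derivative_le h1 hu
  have e2 := natDegree_mul_iterate_derivative_le h2 hu
  have e3 := natDegree_mul_iterate_derivative_le h3 hu
  have e4 := natDegree_mul_iterate_derivative_le h4 hu
  constructor
  · exact natDegree_add_le_of_degree_le (natDegree_add_le_of_degree_le
      (natDegree_add_le_of_degree_le e4.1 e3.1) e2.1) e1.1
  · simp only [polyAct, coeff_add, e1.2, e2.2, e3.2, e4.2, diagonal]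
    ring

namespace SelfAdjointWith

variable (H : L.SelfAdjointWith polyFunctions I p)
include H

theorem exists_orthogonal_polynomial (n : ℕ) : ∃ y : ℝ[X], y ≠ 0 ∧ y.natDegree = n ∧
    ∀ v : ℝ[X], v.degree < n → H.admissible.moment (y * v) = 0 := by
  let Φ : degreeLT ℝ (n + 1) →ₗ[ℝ] (Fin n → ℝ) := LinearMap.pi fun i =>
    H.admissible.moment ∘ₗ (LinearMap.mulRight ℝ (X ^ (i : ℕ))) ∘ₗ (degreeLT ℝ (n + 1)).subtype
  have : FiniteDimensional ℝ (degreeLT ℝ (n + 1)) :=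
    Module.Finite.equiv (degreeLTEquiv ℝ (n + 1)).symm
  -- There are n + 1 unknown coefficients and only n orthogonality conditions.
  have hker : LinearMap.ker Φ ≠ ⊥ := by
    apply LinearMap.ker_ne_bot_of_finrank_lt
    rw [(degreeLTEquiv ℝ (n + 1)).finrank_eq]
    simp
  obtain ⟨⟨y, hy⟩, hy1, hy2⟩ := (Submodule.ne_bot_iff _).1 hker
  have hy0 : y ≠ 0 := fun h => hy2 (Subtype.ext h)
  have horth : ∀ v : ℝ[X], v.degree < n → H.admissible.moment (y * v) = 0 := by
    intro v hv
    have hX : ∀ i : Fin n, H.admissible.moment (y * X ^ (i : ℕ)) = 0 := fun i =>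
      congrFun (LinearMap.mem_ker.1 hy1) i
    rcases eq_or_ne v 0 with rfl | hv0
    · simp
    rw [v.as_sum_range' n ((natDegree_lt_iff_degree_lt hv0).2 hv), Finset.mul_sum, map_sum]
    refine Finset.sum_eq_zero fun i hi => ?_
    rw [← C_mul_X_pow_eq_monomial, mul_left_comm, AdmissibleWeight.moment_C_mul,
      hX ⟨i, Finset.mem_range.1 hi⟩, mul_zero]
  refine ⟨y, hy0, ?_, horth⟩
  rw [mem_degreeLT] at hy
  apply natDegree_eq_of_degree_eq_some
  apply le_antisymm
  · exact Order.le_of_lt_succ hy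
  -- A solution of degree below n would be orthogonal to itself.
  · by_contra! hlt
    exact hy0 (H.eq_zero_of_moment_mul_self (horth y hlt))

/-- For the orthogonal polynomial y of degree n, the remainder z = Ly - λₙy has degree below n, and
so has Lz. Hence ℓ(z²) = ℓ(y·Lz) - λₙ ℓ(yz) = 0 and z = 0. The numbers λₙ need not be distinct. -/
theorem hasEigenvalues : L.HasEigenvalues L.diagonal := by
  constructor
  · intro n
    obtain ⟨y, hy0, hyn, horth⟩ := H.exists_orthogonal_polynomial n
    refine ⟨y, hy0, hyn, ?_⟩
    have hc := polyAct_coeff H.order_four hyn.le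
    set z := L.polyAct y - C (L.diagonal n) * y with hz
    have hzdeg : z.degree < n := by
      rw [degree_lt_iff_coeff_zero]
      intro m hm
      rcases hm.eq_or_lt with rfl | hm
      · rw [hz, coeff_sub, coeff_C_mul, hc.2, sub_self]
      · rw [hz, coeff_sub, coeff_C_mul, coeff_eq_zero_of_natDegree_lt (hc.1.trans_lt hm),
          coeff_eq_zero_of_natDegree_lt (hyn.le.trans_lt hm)]
        simp
    have hLz : (L.polyAct z).degree < n := by
      rcases Nat.eq_zero_or_pos n with rfl | hn
      · have : z = 0 := by simpa using hzdeg
        simp [this, polyAct]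
      · have h1 : z.natDegree ≤ n - 1 :=
          natDegree_le_iff_degree_le.2 (Order.le_of_lt_succ (by
            rw [← Nat.sub_add_cancel hn] at hzdeg; exact hzdeg))
        refine (degree_le_of_natDegree_le (polyAct_coeff H.order_four h1).1).trans_lt ?_
        exact_mod_cast Nat.sub_lt hn one_pos
    have hz0 : z = 0 := by
      apply H.eq_zero_of_moment_mul_self
      conv_lhs => rw [hz]
      rw [sub_mul, map_sub, H.moment_polyAct_mul, horth _ hLz, mul_assoc,
        AdmissibleWeight.moment_C_mul, horth _ hzdeg]
      simp
    intro x
    rw [act_eval, sub_eq_zero.1 hz0, eval_mul, eval_C]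
  · intro y μ hy h
    have e : L.polyAct y = C μ * y := by
      apply Polynomial.funext
      intro x
      rw [← act_eval, h, eval_mul, eval_C]
    have h1 := (polyAct_coeff H.order_four (le_refl y.natDegree)).2
    rw [e, coeff_C_mul] at h1
    exact mul_right_cancel₀ (by simpa using hy) h1

end SelfAdjointWith

end DiffOp4

/-! ### Boundary terms at a finite end -/

theorem Polynomial.eventually_eval_ne_zero {q : ℝ[X]} (hq : q ≠ 0) (t : ℝ) :
    ∀ᶠ x in 𝓝[≠] t, q.eval x ≠ 0 := by
  have h := (q.finite_setOfPred_isRoot hq).isClosed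
  have h2 : ((({x | q.IsRoot x} : Set ℝ) \ {t})ᶜ) ∈ 𝓝 t :=
    ((q.finite_setOfPred_isRoot hq).sdiff).isClosed.isOpen_compl.mem_nhds (by simp)
  filter_upwards [nhdsWithin_le_nhds h2, self_mem_nhdsWithin] with x hx hxt h0
  exact hx ⟨h0, hxt⟩

theorem Polynomial.tendsto_eval {q : ℝ[X]} {t : ℝ} {l : Filter ℝ} (h : l ≤ 𝓝 t) :
    Tendsto (fun x => q.eval x) l (𝓝 (q.eval t)) :=
  (q.continuous.tendsto t).mono_left h

/-- A positive function with bounded logarithmic derivative on a bounded interval is bounded below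
by a positive constant. -/
theorem exists_pos_le_of_logDeriv_bounded {f φ : ℝ → ℝ} {δ K : ℝ} (hδ : 0 < δ)
    (hpos : ∀ x ∈ Ioo 0 δ, 0 < f x) (hd : ∀ x ∈ Ioo 0 δ, HasDerivAt f (f x * φ x) x)
    (hb : ∀ x ∈ Ioo 0 δ, |φ x| ≤ K) : ∃ c > 0, ∀ x ∈ Ioo 0 δ, c ≤ f x := by
  have h2 : δ / 2 ∈ Ioo 0 δ := ⟨by linarith, by linarith⟩
  have hK : 0 ≤ K := (abs_nonneg _).trans (hb _ h2)
  refine ⟨Real.exp (Real.log (f (δ / 2)) - K * δ), Real.exp_pos _, fun x hx => ?_⟩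
  rw [← Real.le_log_iff_exp_le (hpos x hx)]
  have h := (convex_Ioo 0 δ).norm_image_sub_le_of_norm_hasDerivWithin_le
    (f := fun x => Real.log (f x)) (f' := φ) (C := K) (x := x) (y := δ / 2)
    (fun y hy => by
      have := ((hd y hy).log (hpos y hy).ne').hasDerivWithinAt (s := Ioo 0 δ)
      rwa [mul_div_cancel_left₀ _ (hpos y hy).ne'] at this) hb hx h2
  rw [Real.norm_eq_abs, Real.norm_eq_abs] at h
  have h3 : |δ / 2 - x| ≤ δ := by
    rw [abs_le]; constructor <;> linarith [hx.1, hx.2]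
  have h4 := (le_abs_self _).trans (h.trans (mul_le_mul_of_nonneg_left h3 hK))
  linarith

theorem exists_pos_le_of_logDeriv_rational {f : ℝ → ℝ} {u w : ℝ[X]} (hw : w.eval 0 ≠ 0)
    (h : ∀ᶠ x in 𝓝[>] (0 : ℝ), 0 < f x ∧ HasDerivAt f (f x * (u.eval x / w.eval x)) x) :
    ∃ c > 0, ∀ᶠ x in 𝓝[>] (0 : ℝ), c ≤ f x := by
  have hlim : Tendsto (fun x => |u.eval x / w.eval x|) (𝓝[>] 0) (𝓝 |u.eval 0 / w.eval 0|) :=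
    ((tendsto_eval nhdsWithin_le_nhds).div (tendsto_eval nhdsWithin_le_nhds) hw).abs
  have hb := hlim.eventually_le_const (lt_add_one _)
  obtain ⟨δ, hδ, hδ'⟩ := mem_nhdsGT_iff_exists_Ioo_subset.1 (h.and hb)
  obtain ⟨c, hc, hcf⟩ := exists_pos_le_of_logDeriv_bounded (f := f)
    (φ := fun x => u.eval x / w.eval x) (K := |u.eval 0 / w.eval 0| + 1) hδ
    (fun x hx => (hδ' hx).1.1) (fun x hx => (hδ' hx).1.2) (fun x hx => (hδ' hx).2)
  exact ⟨c, hc, mem_of_superset (Ioo_mem_nhdsGT hδ) hcf⟩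

/-- If `f = g A / B` tends to `0` at `0⁺` and `g` is bounded below, then `A 0 = 0`. -/
theorem eval_eq_zero_of_tendsto {f g : ℝ → ℝ} {A B : ℝ[X]} (hB : B.eval 0 ≠ 0) {c : ℝ} (hc : 0 < c)
    (hg : ∀ᶠ x in 𝓝[>] (0 : ℝ), c ≤ g x) (hf : Tendsto f (𝓝[>] 0) (𝓝 0))
    (hfg : ∀ᶠ x in 𝓝[>] (0 : ℝ), f x = g x * (A.eval x / B.eval x)) : A.eval 0 = 0 := by
  have h1 : Tendsto (fun x => A.eval x / B.eval x) (𝓝[>] 0) (𝓝 (A.eval 0 / B.eval 0)) :=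
    (tendsto_eval nhdsWithin_le_nhds).div (tendsto_eval nhdsWithin_le_nhds) hB
  have h2 : Tendsto (fun x => A.eval x / B.eval x) (𝓝[>] 0) (𝓝 0) := by
    have h3 : Tendsto (fun x => c⁻¹ * |f x|) (𝓝[>] 0) (𝓝 0) := by
      simpa using hf.abs.const_mul c⁻¹
    refine squeeze_zero_norm' ?_ h3
    filter_upwards [hg, hfg] with x h4 h5
    rw [h5, abs_mul, Real.norm_eq_abs, abs_of_pos (hc.trans_le h4), ← mul_assoc]
    refine le_mul_of_one_le_left (abs_nonneg _) ?_
    rw [inv_mul_eq_div, one_le_div hc]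
    exact h4
  have h6 := tendsto_nhds_unique h1 h2
  rcases div_eq_zero_iff.1 h6 with h | h
  · exact h
  · exact absurd h hB

namespace DiffOp4

variable {L : DiffOp4} {I : Set ℝ} {p : ℝ → ℝ}

theorem IsWeight.hasDerivAt (hw : L.IsWeight I p) (hI : IsOpen I) {x : ℝ} (hx : x ∈ I)
    (h4 : L.a₄.eval x ≠ 0) :
    HasDerivAt p (p x * (L.logDerivNum.eval x / (2 * L.a₄.eval x))) x := by
  obtain ⟨F, hF⟩ := hw
  have hne : ∀ᶠ y in 𝓝 x, L.a₄.eval y ≠ 0 := L.a₄.continuous.continuousAt.eventually_ne h4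
  -- Near x the absolute value of `a₄` is σ a₄ with a constant sign σ, which drops out of the
  -- logarithmic derivative.
  have key : ∀ σ : ℝ, σ ≠ 0 → (∀ᶠ y in 𝓝 x, |L.a₄.eval y| = σ * L.a₄.eval y) →
      HasDerivAt p (p x * (L.logDerivNum.eval x / (2 * L.a₄.eval x))) x := by
    intro σ hσ hs
    have h1 := ((hF x hx h4).1.div_const 2).exp
    have h2 := h1.div ((L.a₄.hasDerivAt x).const_mul σ) (mul_ne_zero hσ h4)
    have h3 : p =ᶠ[𝓝 x] fun y => Real.exp (F y / 2) / (σ * L.a₄.eval y) := by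
      filter_upwards [hs, hne, hI.mem_nhds hx] with y hy hy4 hyI
      rw [(hF y hyI hy4).2, hy]
    refine (h2.congr_of_eventuallyEq h3).congr_deriv ?_
    rw [h3.self_of_nhds]
    simp only [logDerivNum, eval_sub, eval_mul, eval_ofNat]
    field_simp
  rcases lt_or_gt_of_ne h4 with h | h
  · refine key (-1) (by norm_num) ?_
    filter_upwards [L.a₄.continuous.continuousAt.eventually_lt_const h] with y hy
    rw [abs_of_neg hy]; ring
  · refine key 1 one_ne_zero ?_
    filter_upwards [L.a₄.continuous.continuousAt.eventually_const_lt h] with y hy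
    rw [abs_of_pos hy]; ring

theorem IsWeight.hasDerivAt_mul (hw : L.IsWeight I p) (hI : IsOpen I) {x : ℝ} (hx : x ∈ I)
    (h4 : L.a₄.eval x ≠ 0) :
    HasDerivAt (fun x => p x * L.a₄.eval x) (p x * L.a₃.eval x / 2) x := by
  refine ((hw.hasDerivAt hI hx h4).mul (L.a₄.hasDerivAt x)).congr_deriv ?_
  simp only [logDerivNum, eval_sub, eval_mul, eval_ofNat]
  field_simp
  ring

namespace SelfAdjointWith

variable (H : L.SelfAdjointWith polyFunctions I p)
include H

/-- The derivative p a₃ / 2 of p a₄ is integrable over `I`, so the variation of p a₄ between zeros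
of `a₄` is bounded by one constant valid on all components. -/
theorem mul_bounded_on_component : ∃ K, ∀ x ∈ I, ∀ y ∈ I, (∀ z ∈ uIcc x y, L.a₄.eval z ≠ 0) →
    |p y * L.a₄.eval y| ≤ |p x * L.a₄.eval x| + K := by
  refine ⟨∫ z in I, |p z * L.a₃.eval z / 2|, fun x hx y hy h => ?_⟩
  have hsub : uIcc x y ⊆ I := H.ordConnected.uIcc_subset hx hy
  have hint : IntegrableOn (fun z => p z * L.a₃.eval z / 2) I := (H.admissible L.a₃).div_const 2
  have h1 := intervalIntegral.integral_eq_sub_of_hasDerivAt (a := x) (b := y)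
    (f := fun x => p x * L.a₄.eval x) (f' := fun z => p z * L.a₃.eval z / 2)
    (fun z hz => H.weight.hasDerivAt_mul H.isOpen (hsub hz) (h z hz))
    (hint.mono_set hsub).intervalIntegrable
  have h2 : |∫ z in x..y, p z * L.a₃.eval z / 2| ≤ ∫ z in I, |p z * L.a₃.eval z / 2| := by
    have h3 := intervalIntegral.norm_integral_le_integral_norm_uIoc
      (f := fun z => p z * L.a₃.eval z / 2) (a := x) (b := y) (μ := volume)
    simp only [Real.norm_eq_abs] at h3
    refine h3.trans (setIntegral_mono_set hint.abs ?_ ?_)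
    · exact ae_of_all _ fun z => abs_nonneg _
    · exact (uIoc_subset_uIcc.trans hsub).eventuallyLE
  have h5 := abs_sub_abs_le_abs_sub (p y * L.a₄.eval y) (p x * L.a₄.eval x)
  rw [h1] at h2
  linarith

theorem eventually_mul_bounded (t : ℝ) :
    ∃ C, ∀ᶠ x in 𝓝[≠] t, x ∈ I → |p x * L.a₄.eval x| ≤ C := by
  obtain ⟨K, hK⟩ := H.mul_bounded_on_component
  have hne := eventually_eval_ne_zero H.order_four.1 t
  rw [← nhdsLT_sup_nhdsGT, eventually_sup] at hne
  obtain ⟨δ, hδ, hr⟩ := mem_nhdsGT_iff_exists_Ioo_subset.1 hne.2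
  obtain ⟨γ, hγ, hl⟩ := mem_nhdsLT_iff_exists_Ioo_subset.1 hne.1
  have key : ∀ a b : ℝ, Ioo a b ⊆ {x | L.a₄.eval x ≠ 0} →
      ∃ C, ∀ x ∈ Ioo a b, x ∈ I → |p x * L.a₄.eval x| ≤ C := by
    intro a b hab
    by_cases hne : ∃ c ∈ Ioo a b, c ∈ I
    · obtain ⟨c, hc, hcI⟩ := hne
      exact ⟨_, fun x hx hxI => hK c hcI x hxI fun z hz =>
        hab (ordConnected_Ioo.uIcc_subset hc hx hz)⟩
    · exact ⟨0, fun x hx hxI => (hne ⟨x, hx, hxI⟩).elim⟩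
  obtain ⟨C₁, h1⟩ := key γ t hl
  obtain ⟨C₂, h2⟩ := key t δ hr
  refine ⟨max C₁ C₂, ?_⟩
  rw [← nhdsLT_sup_nhdsGT, eventually_sup]
  constructor
  · filter_upwards [Ioo_mem_nhdsLT hγ] with x hx hxI
    exact (h1 x hx hxI).trans (le_max_left _ _)
  · filter_upwards [Ioo_mem_nhdsGT hδ] with x hx hxI
    exact (h2 x hx hxI).trans (le_max_right _ _)

/-- Near a point where the polynomial `S` vanishes, `p a₄ S / xᵏ` is small. -/
theorem tendsto_mul_eval {t : ℝ} (ht : t ≠ 0) {S : ℝ[X]} (hS : S.eval t = 0) (k : ℕ) :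
    Tendsto (fun x => p x * L.a₄.eval x * (S.eval x / x ^ k)) (𝓝[≠] t ⊓ 𝓟 I) (𝓝 0) := by
  obtain ⟨C, hC⟩ := H.eventually_mul_bounded t
  have hlim : Tendsto (fun x => C * |S.eval x / x ^ k|) (𝓝[≠] t ⊓ 𝓟 I) (𝓝 0) := by
    have hle : 𝓝[≠] t ⊓ 𝓟 I ≤ 𝓝 t := inf_le_left.trans nhdsWithin_le_nhds
    have h1 : Tendsto (fun x => S.eval x / x ^ k) (𝓝[≠] t ⊓ 𝓟 I) (𝓝 (S.eval t / t ^ k)) :=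
      (tendsto_eval hle).div ((continuous_pow k).continuousAt.tendsto.mono_left hle)
        (pow_ne_zero _ ht)
    simpa [hS] using h1.abs.const_mul C
  refine squeeze_zero_norm' ?_ hlim
  rw [eventually_inf_principal]
  filter_upwards [hC] with x hx hxI
  rw [Real.norm_eq_abs, abs_mul]
  exact mul_le_mul_of_nonneg_right (hx hxI) (abs_nonneg _)

/-- Integration by parts on an interval with left end `0`: the boundary term at `0` vanishes when
those at the other end and at the zeros of `a₄` do. -/
theorem tendsto_left_end (hI : I = Ioi 0 ∨ ∃ e > 0, I = Ioo 0 e) {S R : ℝ[X]} {k : ℕ}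
    (hS : ∀ t ∈ I, L.a₄.eval t = 0 → S.eval t = 0) (hSe : ∀ e, I = Ioo 0 e → S.eval e = 0)
    (hG : ∀ x ∈ I, L.a₄.eval x ≠ 0 →
      HasDerivAt (fun x => p x * L.a₄.eval x * (S.eval x / x ^ k)) (p x * R.eval x) x)
    (hR : H.admissible.moment R = 0) :
    Tendsto (fun x => p x * L.a₄.eval x * (S.eval x / x ^ k)) (𝓝[>] 0) (𝓝 0) := by
  set G := fun x => p x * L.a₄.eval x * (S.eval x / x ^ k) with hGdef
  have hpos : ∀ x ∈ I, 0 < x := by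
    rcases hI with rfl | ⟨e, -, rfl⟩
    · exact fun x hx => hx
    · exact fun x hx => hx.1
  have hint := H.admissible R
  have hsub : ∀ x ∈ I, Ioc 0 x ⊆ I := by
    rcases hI with rfl | ⟨e, -, rfl⟩
    · exact fun x _ y hy => hy.1
    · exact fun x hx y hy => ⟨hy.1, hy.2.trans_lt hx.2⟩
  have hint0 : ∀ x ∈ I, IntervalIntegrable (fun z => p z * R.eval z) volume 0 x := fun x hx => by
    rw [intervalIntegrable_iff_integrableOn_Ioc_of_le (hpos x hx).le]
    exact hint.mono_set (hsub x hx)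
  -- The weight is unconstrained at a zero of `a₄`, but the factor a₄ makes `G` vanish there, and
  -- `S` makes its limit zero. So `G` is continuous across such points.
  have hcont : ContinuousOn G I := by
    intro t ht
    by_cases h4 : L.a₄.eval t = 0
    · have hGt : G t = 0 := by simp [hGdef, h4]
      rw [← continuousWithinAt_sdiff_self, ContinuousWithinAt, hGt]
      have := H.tendsto_mul_eval (hpos t ht).ne' (hS t ht h4) k
      refine this.mono_left ?_
      rw [show I \ {t} = {t}ᶜ ∩ I from by ext; simp [and_comm], nhdsWithin_inter']
    · exact (hG t ht h4).continuousAt.continuousWithinAt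
  set P := fun x => ∫ z in (0 : ℝ)..x, p z * R.eval z with hP
  have hFTC : ∀ x ∈ I, ∀ y ∈ I, G y - P y = G x - P x := by
    intro x hx y hy
    have hxy : uIcc x y ⊆ I := H.ordConnected.uIcc_subset hx hy
    have h1 := integral_eq_of_hasDerivAt_off_countable G (fun z => p z * R.eval z)
      (a := x) (b := y) (s := {z | L.a₄.IsRoot z})
      (L.a₄.finite_setOfPred_isRoot H.order_four.1).countable (hcont.mono hxy)
      (fun z hz => hG z (hxy (Ioo_subset_Icc_self hz.1)) hz.2)
      (hint.mono_set hxy).intervalIntegrable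
    have h2 := intervalIntegral.integral_interval_sub_left (hint0 y hy) (hint0 x hx)
    simp only [hP]
    linarith
  -- The filter `l` describes the other end of `I`: there `G` tends to 0, and the primitive `P`
  -- tends to the full integral, which is zero by `hR`.
  obtain ⟨l, hl, hlI, hGl, hPl⟩ : ∃ l : Filter ℝ, l.NeBot ∧ (∀ᶠ x in l, x ∈ I) ∧
      Tendsto G l (𝓝 0) ∧ Tendsto P l (𝓝 0) := by
    rw [AdmissibleWeight.moment_apply] at hR
    rcases hI with rfl | ⟨e, he, rfl⟩
    · refine ⟨atTop, inferInstance, eventually_gt_atTop 0, ?_, ?_⟩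
      · obtain ⟨a, ha⟩ : ∃ a, ∀ x ≥ a, L.a₄.eval x ≠ 0 := by
          have := L.a₄.eventually_atTop_not_isRoot H.order_four.1
          exact eventually_atTop.1 this
        -- Beyond 1 the factor x^(-k) is at most 1, so `G` is dominated by the integrable p a₄ S. An
        -- integrable function with integrable derivative tends to 0 at infinity.
        have hsub' : Ioi (max a 1) ⊆ Ioi 0 :=
          fun x hx => zero_lt_one.trans ((le_max_right a 1).trans_lt hx)
        refine tendsto_zero_of_hasDerivAt_of_integrableOn_Ioi (a := max a 1)
          (f' := fun z => p z * R.eval z) (fun x hx => hG x (hsub' hx)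
            (ha x ((le_max_left a 1).trans hx.out.le))) (hint.mono_set hsub') ?_
        have h1 := (H.admissible (L.a₄ * S)).mono_set hsub'
        refine Integrable.mono h1 ?_ ?_
        · have h2 : G = fun x => p x * (L.a₄ * S).eval x * (x ^ k)⁻¹ := by
            ext x; simp only [hGdef, eval_mul]; ring
          rw [h2]
          exact h1.aestronglyMeasurable.mul
            (by fun_prop : Measurable fun x : ℝ => (x ^ k)⁻¹).aestronglyMeasurable
        · filter_upwards [ae_restrict_mem measurableSet_Ioi] with x hx
          have hx1 : 1 ≤ x := (le_max_right a 1).trans hx.out.le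
          simp only [hGdef, eval_mul, ← mul_div_assoc, norm_div, norm_mul, mul_assoc]
          refine div_le_self (by positivity) ?_
          rw [norm_pow, Real.norm_of_nonneg (by linarith)]
          exact one_le_pow₀ hx1
      · rw [← hR]
        exact intervalIntegral_tendsto_integral_Ioi 0 hint tendsto_id
    · refine ⟨𝓝[<] e, inferInstance, Ioo_mem_nhdsLT he, ?_, ?_⟩
      · refine (H.tendsto_mul_eval he.ne' (hSe e rfl) k).mono_left ?_
        refine le_inf (nhdsWithin_mono _ fun x hx => ne_of_lt hx) ?_
        rw [le_principal_iff]
        exact Ioo_mem_nhdsLT he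
      · have h1 : IntegrableOn (fun z => p z * R.eval z) (uIcc 0 e) := by
          rw [uIcc_of_le he.le, integrableOn_Icc_iff_integrableOn_Ioo]
          exact hint
        have h2 := (intervalIntegral.continuousOn_primitive_interval h1) e right_mem_uIcc
        have h3 : ∫ z in (0 : ℝ)..e, p z * R.eval z = 0 := by
          rw [intervalIntegral.integral_of_le he.le, integral_Ioc_eq_integral_Ioo, hR]
        rw [ContinuousWithinAt, h3] at h2
        refine h2.mono_left ?_
        rw [uIcc_of_le he.le, ← nhdsWithin_Ioo_eq_nhdsLT he]
        exact nhdsWithin_mono _ Ioo_subset_Icc_self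
  -- `G - P` is constant on `I` and tends to 0 at the other end, so `G = P`; and `P` tends to 0 at
  -- its base point 0.
  have hGP : ∀ x ∈ I, G x = P x := by
    intro x hx
    have h1 : Tendsto (fun y => G y - P y) l (𝓝 0) := by simpa using hGl.sub hPl
    have h2 : Tendsto (fun y => G y - P y) l (𝓝 (G x - P x)) := by
      refine tendsto_const_nhds.congr' ?_
      filter_upwards [hlI] with y hy
      exact (hFTC x hx y hy).symm
    linarith [tendsto_nhds_unique h1 h2]
  obtain ⟨c, hc⟩ := H.nonempty
  have hc0 := hpos c hc
  have h1 : IntegrableOn (fun z => p z * R.eval z) (uIcc 0 c) := by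
    rw [uIcc_of_le hc0.le, integrableOn_Icc_iff_integrableOn_Ioc]
    exact hint.mono_set (hsub c hc)
  have h2 := (intervalIntegral.continuousOn_primitive_interval h1) 0 left_mem_uIcc
  rw [ContinuousWithinAt, intervalIntegral.integral_same] at h2
  have h3 : Tendsto P (𝓝[>] 0) (𝓝 0) := by
    refine h2.mono_left ?_
    rw [uIcc_of_le hc0.le, ← nhdsWithin_Ioo_eq_nhdsGT hc0]
    exact nhdsWithin_mono _ Ioo_subset_Icc_self
  refine h3.congr' ?_
  filter_upwards [Ioo_mem_nhdsGT hc0] with x hx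
  exact (hGP x (hsub c hc ⟨hx.1, hx.2.le⟩)).symm

end SelfAdjointWith

end DiffOp4

namespace DiffOp4

variable {L : DiffOp4} {I : Set ℝ} {p : ℝ → ℝ}

namespace SelfAdjointWith

variable (H : L.SelfAdjointWith polyFunctions I p)
include H

theorem eventually_mem_left (hI : I = Ioi 0 ∨ ∃ e > 0, I = Ioo 0 e) :
    ∀ᶠ x in 𝓝[>] (0 : ℝ), 0 < x ∧ x ∈ I ∧ L.a₄.eval x ≠ 0 := by
  have h1 : ∀ᶠ x in 𝓝[>] (0 : ℝ), x ∈ I := by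
    rcases hI with rfl | ⟨e, he, rfl⟩
    · exact self_mem_nhdsWithin
    · exact Ioo_mem_nhdsGT he
  have h2 := (eventually_eval_ne_zero H.order_four.1 0).filter_mono
    (nhdsWithin_mono _ fun x (hx : 0 < x) => hx.ne')
  filter_upwards [self_mem_nhdsWithin, h1, h2] with x h0 h1 h2
  exact ⟨h0, h1, h2⟩

/-- A polynomial not vanishing at `0` that kills the boundary terms at all zeros of `a₄` in the
interval, and at its right end. -/
theorem exists_cutoff (hI : I = Ioi 0 ∨ ∃ e > 0, I = Ioo 0 e) {r : ℝ[X]} {m : ℕ}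
    (hr : L.a₄ = X ^ m * r) (hr0 : r.eval 0 ≠ 0) :
    ∃ ρ : ℝ[X], (r * ρ).eval 0 ≠ 0 ∧ (∀ t ∈ I, L.a₄.eval t = 0 → (r * ρ).eval t = 0) ∧
      ∀ e, I = Ioo 0 e → (r * ρ).eval e = 0 := by
  have hz : ∀ t ∈ I, L.a₄.eval t = 0 → r.eval t = 0 := by
    intro t ht h
    have ht0 : t ≠ 0 := by
      rcases hI with rfl | ⟨e, -, rfl⟩
      · exact ht.out.ne'
      · exact ht.1.ne'
    rw [hr, eval_mul, eval_pow, eval_X] at h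
    exact (mul_eq_zero.1 h).resolve_left (pow_ne_zero _ ht0)
  rcases hI with rfl | ⟨e, he, rfl⟩
  · refine ⟨1, by simpa using hr0, fun t ht h => by simpa using hz t ht h, fun e he => ?_⟩
    have : max e 1 ∈ Ioo 0 e := by
      rw [← he]; exact lt_max_of_lt_right (zero_lt_one' ℝ)
    exact absurd this.2 (le_max_left _ _).not_gt
  · refine ⟨X - C e, ?_, fun t ht h => ?_, fun e' he' => ?_⟩
    · simpa using ⟨hr0, he.ne'⟩
    · rw [eval_mul, hz t ht h, zero_mul]
    · have h1 : e' = e := by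
        have hne : (Ioo 0 e).Nonempty := ⟨e / 2, by constructor <;> linarith⟩
        have hne' : (Ioo 0 e').Nonempty := he' ▸ hne
        rw [← csSup_Ioo (nonempty_Ioo.1 hne), he', csSup_Ioo (nonempty_Ioo.1 hne')]
      simp [h1]

/-- The boundary term of the identity `∫ p (2 a₄ q' + a₃ q) = 0`. -/
theorem tendsto_mul_a₄ (hI : I = Ioi 0 ∨ ∃ e > 0, I = Ioo 0 e) :
    Tendsto (fun x => p x * L.a₄.eval x) (𝓝[>] 0) (𝓝 0) := by
  obtain ⟨r, hr, hr0⟩ := exists_eq_pow_rootMultiplicity_mul_and_not_dvd L.a₄ H.order_four.1 0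
  rw [C_0, sub_zero] at hr
  rw [dvd_iff_isRoot, IsRoot.def] at hr0
  obtain ⟨ρ, h0, hS, hSe⟩ := H.exists_cutoff hI hr hr0
  set T := r * ρ
  have h1 := H.tendsto_left_end hI (R := L.a₄ * derivative T + C (1 / 2) * (L.a₃ * T)) (k := 0)
    hS hSe (fun x hx h4 => by
      refine ((((H.weight.hasDerivAt_mul H.isOpen hx h4).mul (T.hasDerivAt x)).congr_deriv
        ?_).congr_of_eventuallyEq (Eventually.of_forall fun y => ?_))
      · simp only [eval_add, eval_mul, eval_C]; ring
      · simp) (by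
      have e : L.a₄ * derivative T + C (1 / 2) * (L.a₃ * T)
          = C (1 / 2) * (2 * L.a₄ * derivative T + L.a₃ * T) := by
        have : (C (1 / 2) * 2 : ℝ[X]) = 1 := by
          rw [← map_ofNat C 2, ← C_mul]; norm_num
        linear_combination (-L.a₄ * derivative T) * this
      rw [e, AdmissibleWeight.moment_C_mul, H.moment_pearson, mul_zero])
  have h2 : Tendsto (fun x => p x * L.a₄.eval x * (T.eval x / x ^ 0) * (T.eval x)⁻¹) (𝓝[>] 0)
      (𝓝 (0 * (T.eval 0)⁻¹)) :=
    h1.mul ((tendsto_eval nhdsWithin_le_nhds).inv₀ h0)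
  rw [zero_mul] at h2
  refine h2.congr' ?_
  have h3 : ∀ᶠ x in 𝓝[>] (0 : ℝ), T.eval x ≠ 0 :=
    (T.continuous.continuousAt.eventually_ne h0).filter_mono nhdsWithin_le_nhds
  filter_upwards [h3] with x hx
  field_simp

/-- The boundary term of the identity `∫ p (½ a₃ w'' + a₂ w' + a₁ w) = 0`, at the left end `0`. -/
theorem exists_tendsto_second (hI : I = Ioi 0 ∨ ∃ e > 0, I = Ioo 0 e) {r : ℝ[X]} {m : ℕ}
    (hr : L.a₄ = X ^ m * r) (hr0 : r.eval 0 ≠ 0) :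
    ∃ T : ℝ[X], T.eval 0 ≠ 0 ∧ ∀ v : ℝ[X], Tendsto (fun x => p x *
      (L.a₃.eval x * (derivative (T * v)).eval x / 2
        + L.secondNum.eval x * (T * v).eval x / (4 * L.a₄.eval x))) (𝓝[>] 0) (𝓝 0) := by
  obtain ⟨ρ, h0, hS, hSe⟩ := H.exists_cutoff hI hr hr0
  set T := r * ρ with hT
  have hfs := H.formal_symmetry
  -- Writing the boundary term as p a₄ times a fraction puts a₄² = x^(2m) r² in the denominator. Two
  -- of the three factors `T` cancel r², and the third makes the numerator vanish at the inner zeros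
  -- of `a₄` and at the right end.
  refine ⟨T ^ 3, by simpa using h0, fun v => ?_⟩
  set w := T ^ 3 * v with hw
  set z := 3 * derivative T * v + T * derivative v with hz
  have hw' : derivative w = T ^ 2 * z := by
    simp only [hw, hz, derivative_mul, derivative_pow]
    simp only [Nat.cast_ofNat, Nat.add_one_sub_one, show (C 3 : ℝ[X]) = 3 from map_ofNat C 3]
    ring
  set S := T * (ρ * (C (1 / 2) * L.a₃ * X ^ m * z) + C (1 / 4) * L.secondNum * ρ ^ 2 * v) with hSdef
  have hform : ∀ x, L.a₄.eval x ≠ 0 → p x * L.a₄.eval x * (S.eval x / x ^ (2 * m)) =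
      p x * (L.a₃.eval x * (derivative w).eval x / 2
        + L.secondNum.eval x * w.eval x / (4 * L.a₄.eval x)) := by
    intro x hx
    rw [hr, eval_mul, eval_pow, eval_X] at hx ⊢
    obtain ⟨hx1, hx2⟩ := mul_ne_zero_iff.1 hx
    rw [hw', hw, hSdef, hT]
    simp only [eval_mul, eval_add, eval_pow, eval_X, eval_C, pow_mul']
    field_simp
  set R := C (1 / 2) * (L.a₃ * derivative (derivative w) + 2 * L.a₂ * derivative w
      + 2 * L.a₁ * w) with hR
  have h1 := H.tendsto_left_end hI (S := S) (R := R) (k := 2 * m)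
    (fun t ht h4 => by rw [hSdef, eval_mul, hS t ht h4, zero_mul])
    (fun e he => by rw [hSdef, eval_mul, hSe e he, zero_mul]) (fun x hx h4 => by
      have hd := (H.weight.hasDerivAt H.isOpen hx h4).mul
        ((((L.a₃.hasDerivAt x).mul ((derivative w).hasDerivAt x)).div_const 2).add
          (((L.secondNum.hasDerivAt x).mul (w.hasDerivAt x)).div
            ((L.a₄.hasDerivAt x).const_mul 4) (mul_ne_zero four_ne_zero h4)))
      have hne : ∀ᶠ y in 𝓝 x, L.a₄.eval y ≠ 0 := L.a₄.continuous.continuousAt.eventually_ne h4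
      refine (hd.congr_deriv ?_).congr_of_eventuallyEq ?_
      · have e1 := congrArg (eval x) hfs
        have e2 : L.secondNum.eval x = 4 * L.a₄.eval x * L.a₂.eval x
            - 2 * L.a₄.eval x * (derivative L.a₃).eval x
            - L.logDerivNum.eval x * L.a₃.eval x := by
          simp [secondNum]
        simp only [eval_mul, eval_add, eval_sub, eval_pow, eval_ofNat] at e1
        simp only [hR, eval_mul, eval_add, eval_C, eval_ofNat, Pi.mul_apply, Pi.add_apply,
          Pi.div_apply]
        generalize eval x L.secondNum = s at *
        field_simp
        linear_combination (-2 * p x * w.eval x) * e1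
          + (4 * p x * L.a₄.eval x * (derivative w).eval x) * e2
      · filter_upwards [hne] with y hy
        exact hform y hy) (by
    rw [hR, AdmissibleWeight.moment_C_mul, H.moment_symmetry, mul_zero])
  refine h1.congr' ?_
  filter_upwards [H.eventually_mem_left hI] with x hx
  exact hform x hx.2.2

/-- The square of p a₄ has logarithmic derivative a₃/a₄ = u/r. If this were regular at 0, the square
would stay above a positive constant, although p a₄ tends to 0 there. -/
theorem a₃_not_dvd (hI : I = Ioi 0 ∨ ∃ e > 0, I = Ioo 0 e) {u r : ℝ[X]}
    (hr : r.eval 0 ≠ 0) (h : L.a₃ * r = L.a₄ * u) : False := by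
  have hlim := (H.tendsto_mul_a₄ hI).pow 2
  rw [zero_pow two_ne_zero] at hlim
  have hr' : ∀ᶠ x in 𝓝[>] (0 : ℝ), r.eval x ≠ 0 :=
    (r.continuous.continuousAt.eventually_ne hr).filter_mono nhdsWithin_le_nhds
  obtain ⟨c, hc, hcf⟩ := exists_pos_le_of_logDeriv_rational
    (f := fun x => (p x * L.a₄.eval x) ^ 2) (u := u) hr (by
      filter_upwards [H.eventually_mem_left hI, hr'] with x ⟨h0, hx, h4⟩ hrx
      have hp := H.weight.pos hx h4
      refine ⟨by positivity, ?_⟩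
      refine ((H.weight.hasDerivAt_mul H.isOpen hx h4).pow 2).congr_deriv ?_
      have e := congrArg (eval x) h
      simp only [eval_mul] at e
      field_simp
      norm_num
      linear_combination (2 * p x * L.a₄.eval x) * e)
  exact absurd (ge_of_tendsto hlim hcf) hc.not_ge

theorem eval_a₄_left_end (hI : I = Ioi 0 ∨ ∃ e > 0, I = Ioo 0 e) : L.a₄.eval 0 = 0 := by
  by_contra h
  exact H.a₃_not_dvd hI h (mul_comm _ _)

/-- The left end `0` of the interval is a zero of order at least two of `a₄`. -/
theorem eval_derivative_a₄_left_end (hI : I = Ioi 0 ∨ ∃ e > 0, I = Ioo 0 e) :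
    (derivative L.a₄).eval 0 = 0 := by
  have h4 := H.eval_a₄_left_end hI
  obtain ⟨r, hr⟩ : X ∣ L.a₄ := X_dvd_iff.2 (by rwa [coeff_zero_eq_eval_zero])
  have hd : (derivative L.a₄).eval 0 = r.eval 0 := by
    rw [hr]; simp [derivative_mul]
  rw [hd]
  by_contra hr0
  obtain ⟨T, hT, hlim⟩ := H.exists_tendsto_second hI (m := 1) (by rw [pow_one, hr]) hr0
  have hn : L.logDerivNum.eval 0 = L.a₃.eval 0 - 2 * r.eval 0 := by
    simp [logDerivNum, hd]
  have hs : L.secondNum.eval 0 = - (L.logDerivNum.eval 0 * L.a₃.eval 0) := by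
    simp [secondNum, h4]
  have h3 : L.a₃.eval 0 ≠ 0 := by
    intro h3
    obtain ⟨u, hu⟩ : X ∣ L.a₃ := X_dvd_iff.2 (by rwa [coeff_zero_eq_eval_zero])
    exact H.a₃_not_dvd hI hr0 (u := u) (by rw [hu, hr]; ring)
  have hr' : ∀ᶠ x in 𝓝[>] (0 : ℝ), r.eval x ≠ 0 :=
    (r.continuous.continuousAt.eventually_ne hr0).filter_mono nhdsWithin_le_nhds
  have hB : ∀ c : ℝ, c ≠ 0 → (C c * r).eval 0 ≠ 0 := fun c hc => by
    rw [eval_mul, eval_C]; exact mul_ne_zero hc hr0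
  have hfs := congrArg (eval 0) H.formal_symmetry
  simp only [eval_mul, eval_add, eval_sub, eval_pow, eval_ofNat, h4, hd, hs, hn] at hfs
  -- At a simple zero, formal symmetry evaluated at 0 leaves two possibilities: p behaves like x, or
  -- p has a positive limit.
  have hcases : (L.a₃.eval 0 - 4 * r.eval 0) * (L.a₃.eval 0 - 2 * r.eval 0) = 0 := by
    refine mul_right_cancel₀ h3 ?_
    linear_combination hfs
  rcases mul_eq_zero.1 hcases with h | h
  -- Here p/x is bounded below. The boundary term with v = 1 then forces `secondNum` to vanish at 0,
  -- but its value there is a nonzero multiple of a₃(0).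
  · obtain ⟨n', hn'⟩ : X ∣ L.logDerivNum - 2 * r := X_dvd_iff.2 (by
      rw [coeff_zero_eq_eval_zero, eval_sub, hn, eval_mul, eval_ofNat]; linarith)
    obtain ⟨c, hc, hcf⟩ := exists_pos_le_of_logDeriv_rational (f := fun x => p x / x) (u := n')
      (hB 2 two_ne_zero) (by
        filter_upwards [H.eventually_mem_left hI, hr'] with x ⟨h0, hx, h4⟩ hrx
        refine ⟨div_pos (H.weight.pos hx h4) h0, ?_⟩
        refine ((H.weight.hasDerivAt H.isOpen hx h4).div (hasDerivAt_id x) h0.ne').congr_deriv ?_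
        have e := congrArg (eval x) hn'
        simp only [eval_mul, eval_sub, eval_X, eval_ofNat] at e
        simp only [hr, eval_mul, eval_X, eval_C, id]
        field_simp
        linear_combination (p x) * e)
    have h1 := eval_eq_zero_of_tendsto
      (A := 2 * X * r * (L.a₃ * derivative (T * 1)) + L.secondNum * (T * 1)) (hB 4 four_ne_zero)
      hc hcf (hlim 1) (by
        filter_upwards [H.eventually_mem_left hI, hr'] with x ⟨h0, hx, h4⟩ hrx
        simp only [hr, eval_mul, eval_X, eval_C, eval_add, eval_ofNat]
        field_simp
        ring)
    simp only [eval_mul, eval_X, eval_add, eval_ofNat, mul_zero, zero_mul, zero_add, mul_one,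
      hs, hn] at h1
    rcases mul_eq_zero.1 h1 with h2 | h2
    · rcases mul_eq_zero.1 (neg_eq_zero.1 h2) with h5 | h5
      · exact hr0 (by linarith)
      · exact h3 h5
    · exact hT h2
  -- Here p is bounded below. Taking v = x isolates the term with w', whose limit would be a nonzero
  -- multiple of a₃(0).
  · obtain ⟨n', hn'⟩ : X ∣ L.logDerivNum := X_dvd_iff.2 (by
      rw [coeff_zero_eq_eval_zero, hn, h])
    obtain ⟨s, hs'⟩ : X ∣ L.secondNum := X_dvd_iff.2 (by
      rw [coeff_zero_eq_eval_zero, hs, hn, h]; simp)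
    obtain ⟨c, hc, hcf⟩ := exists_pos_le_of_logDeriv_rational (f := p) (u := n')
      (hB 2 two_ne_zero) (by
        filter_upwards [H.eventually_mem_left hI, hr'] with x ⟨h0, hx, h4⟩ hrx
        refine ⟨H.weight.pos hx h4, ?_⟩
        refine (H.weight.hasDerivAt H.isOpen hx h4).congr_deriv ?_
        simp only [hr, hn', eval_mul, eval_X, eval_C]
        field_simp)
    have h1 := eval_eq_zero_of_tendsto
      (A := 2 * r * (L.a₃ * derivative (T * X)) + s * (T * X)) (hB 4 four_ne_zero)
      hc hcf (hlim X) (by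
        filter_upwards [H.eventually_mem_left hI, hr'] with x ⟨h0, hx, h4⟩ hrx
        simp only [hr, hs', eval_mul, eval_X, eval_C, eval_add, eval_ofNat]
        field_simp
        ring)
    simp only [derivative_mul, derivative_X, eval_mul, eval_X, eval_add, eval_ofNat, mul_zero,
      add_zero, zero_add, mul_one] at h1
    exact mul_ne_zero (mul_ne_zero two_ne_zero hr0) (mul_ne_zero h3 hT) h1

/-- When `p` has a positive limit at the left end `0`, the coefficient `g` vanishes there. -/
theorem eval_a₂_left_end (hI : I = Ioi 0 ∨ ∃ e > 0, I = Ioo 0 e) {r n' : ℝ[X]}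
    (hr : L.a₄ = X ^ 2 * r) (hr0 : r.eval 0 ≠ 0) (hn : L.logDerivNum = X ^ 2 * n') :
    2 * L.a₂.eval 0 = (derivative L.a₃).eval 0 := by
  obtain ⟨T, hT, hlim⟩ := H.exists_tendsto_second hI hr hr0
  have hB : ∀ c : ℝ, c ≠ 0 → (C c * r).eval 0 ≠ 0 := fun c hc => by
    rw [eval_mul, eval_C]; exact mul_ne_zero hc hr0
  have hr' : ∀ᶠ x in 𝓝[>] (0 : ℝ), r.eval x ≠ 0 :=
    (r.continuous.continuousAt.eventually_ne hr0).filter_mono nhdsWithin_le_nhds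
  have h3 : L.a₃.eval 0 = 0 := by
    have e : L.a₃ = X ^ 2 * n' + 2 * derivative (X ^ 2 * r) := by
      rw [← hn, ← hr, logDerivNum]; ring
    rw [e]
    simp [derivative_mul]
  obtain ⟨c, hc, hcf⟩ := exists_pos_le_of_logDeriv_rational (f := p) (u := n')
    (hB 2 two_ne_zero) (by
      filter_upwards [H.eventually_mem_left hI, hr'] with x ⟨h0, hx, h4⟩ hrx
      refine ⟨H.weight.pos hx h4, ?_⟩
      refine (H.weight.hasDerivAt H.isOpen hx h4).congr_deriv ?_
      simp only [hr, hn, eval_mul, eval_X, eval_C, eval_pow]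
      field_simp)
  have h1 := eval_eq_zero_of_tendsto
    (A := 2 * r * (L.a₃ * derivative (T * 1))
      + (4 * r * L.a₂ - 2 * r * derivative L.a₃ - n' * L.a₃) * (T * 1)) (hB 4 four_ne_zero)
    hc hcf (hlim 1) (by
      filter_upwards [H.eventually_mem_left hI, hr'] with x ⟨h0, hx, h4⟩ hrx
      simp only [secondNum, hr, hn, eval_mul, eval_X, eval_C, eval_add, eval_ofNat, eval_sub,
        eval_pow]
      field_simp
      ring)
  simp only [eval_mul, eval_add, eval_sub, eval_ofNat, h3, mul_zero, zero_mul, zero_add,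
    mul_one, sub_zero] at h1
  have h2 := (mul_eq_zero.1 h1).resolve_right hT
  refine mul_left_cancel₀ (mul_ne_zero two_ne_zero hr0) ?_
  linear_combination h2

/-! ### Infinite ends -/

/-- On an interval unbounded to the right, `x (log |p a₄|)'` is not bounded below. -/
theorem not_eventually_ge_of_Ioi_subset {X₀ : ℝ} (hI : Ioi X₀ ⊆ I) (j : ℕ)
    (h : ∀ᶠ x in atTop, -(2 * j : ℝ) ≤ x * (L.a₃.eval x / L.a₄.eval x)) : False := by
  obtain ⟨b, hb⟩ := eventually_atTop.1 ((h.and (L.a₄.eventually_atTop_not_isRoot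
    H.order_four.1)).and ((eventually_gt_atTop X₀).and (eventually_gt_atTop 0)))
  -- The logarithmic derivative of G² is a₃/a₄ + 2j/x, nonnegative far out by hypothesis. So |G|
  -- increases there from a positive value, although `G` is p times a polynomial and hence
  -- integrable.
  set G := fun x => p x * L.a₄.eval x * x ^ j with hG
  have hd : ∀ x ∈ Ici b, HasDerivAt (fun x => G x ^ 2)
      (G x ^ 2 * (L.a₃.eval x / L.a₄.eval x + 2 * j / x)) x := by
    intro x hx
    obtain ⟨⟨-, h4⟩, hx0, hx1⟩ := hb x hx
    refine (((H.weight.hasDerivAt_mul H.isOpen (hI hx0) h4).mul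
      (hasDerivAt_pow j x)).pow 2).congr_deriv ?_
    have h4' : L.a₄.eval x ≠ 0 := h4
    have hj : (j : ℝ) * x ^ (j - 1) = j * x ^ j / x := by
      rcases Nat.eq_zero_or_pos j with rfl | hj
      · simp
      · rw [← Nat.sub_add_cancel hj, pow_succ]; field_simp; simp
    simp only [hj, hG, Pi.mul_apply, Nat.add_one_sub_one, pow_one, Nat.cast_ofNat]
    field_simp
  have hmono : MonotoneOn (fun x => G x ^ 2) (Ici b) := by
    refine monotoneOn_of_deriv_nonneg (convex_Ici b)
      (fun x hx => (hd x hx).continuousAt.continuousWithinAt) (fun x hx =>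
        (hd x (interior_subset hx)).differentiableAt.differentiableWithinAt) fun x hx => ?_
    rw [(hd x (interior_subset hx)).deriv]
    obtain ⟨⟨h1, -⟩, -, hx1⟩ := hb x (interior_subset hx)
    refine mul_nonneg (sq_nonneg _) ?_
    have : L.a₃.eval x / L.a₄.eval x + 2 * j / x
        = (x * (L.a₃.eval x / L.a₄.eval x) + 2 * j) / x := by field_simp
    rw [this]
    exact div_nonneg (by linarith) hx1.le
  have hGb : 0 < |G b| := by
    obtain ⟨⟨-, h4⟩, hx0, hx1⟩ := hb b le_rfl
    have hp := H.weight.pos (hI hx0) h4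
    have h4' : L.a₄.eval b ≠ 0 := h4
    positivity
  have hle : ∀ x ∈ Ioi b, |G b| ≤ |G x| := fun x hx =>
    sq_le_sq.1 (hmono self_mem_Ici hx.out.le hx.out.le)
  have hint : IntegrableOn G (Ioi b) := by
    have h1 := (H.admissible (L.a₄ * X ^ j)).mono_set
      ((Ioi_subset_Ioi (hb b le_rfl).2.1.le).trans hI)
    refine h1.congr_fun (fun x _ => ?_) measurableSet_Ioi
    simp only [hG, eval_mul, eval_pow, eval_X, mul_assoc]
  have hconst : IntegrableOn (fun _ : ℝ => |G b|) (Ioi b) := by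
    refine Integrable.mono hint aestronglyMeasurable_const ?_
    filter_upwards [ae_restrict_mem measurableSet_Ioi] with x hx
    simpa using hle x hx
  rw [integrableOn_const_iff] at hconst
  simp only [enorm_eq_zero, Real.volume_Ioi, lt_self_iff_false, or_false] at hconst
  exact hGb.ne' hconst

/-- If deg a₃ < deg a₄, then x a₃/a₄ is bounded near infinity; if the leading coefficients do not
have opposite signs, it is eventually nonnegative. Both are excluded by
`not_eventually_ge_of_Ioi_subset`. -/
theorem degree_of_Ioi_subset {X₀ : ℝ} (hI : Ioi X₀ ⊆ I) :
    L.a₄.natDegree ≤ L.a₃.natDegree ∧ L.a₃.leadingCoeff * L.a₄.leadingCoeff < 0 := by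
  have h4 := H.order_four.1
  have h3 : L.a₃ ≠ 0 := by
    intro h3
    refine H.not_eventually_ge_of_Ioi_subset hI 0 (Eventually.of_forall fun x => ?_)
    simp [h3]
  constructor
  · by_contra! hlt
    have hdeg : (X * L.a₃).degree ≤ L.a₄.degree := by
      rw [degree_eq_natDegree (mul_ne_zero X_ne_zero h3), degree_eq_natDegree h4,
        natDegree_X_mul h3]
      exact_mod_cast hlt
    obtain ⟨c, hc⟩ := (isBigO_atTop_of_degree_le _ _ hdeg).bound
    obtain ⟨j, hj⟩ := exists_nat_ge c
    refine H.not_eventually_ge_of_Ioi_subset hI j ?_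
    filter_upwards [hc, L.a₄.eventually_atTop_not_isRoot h4] with x hx hx4
    have hx4' : 0 < |L.a₄.eval x| := abs_pos.2 hx4
    rw [eval_mul, eval_X, Real.norm_eq_abs, Real.norm_eq_abs, ← div_le_iff₀ hx4', ← abs_div,
      mul_div_assoc] at hx
    have := (abs_le.1 hx).1
    have hj0 : (0 : ℝ) ≤ j := j.cast_nonneg
    linarith
  · by_contra! hnn
    refine H.not_eventually_ge_of_Ioi_subset hI 0 ?_
    have hev : ∀ᶠ x in atTop, 0 ≤ (L.a₃ * L.a₄).eval x := by
      rcases le_or_gt (L.a₃ * L.a₄).degree 0 with hd | hd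
      · rw [eq_C_of_degree_le_zero hd]
        refine Eventually.of_forall fun x => ?_
        rw [eval_C, ← natDegree_eq_zero_iff_degree_le_zero.2 hd, coeff_natDegree,
          leadingCoeff_mul]
        exact hnn
      · exact (tendsto_atTop_of_leadingCoeff_nonneg _ hd
          (by rwa [leadingCoeff_mul])).eventually_ge_atTop 0
    filter_upwards [hev, eventually_ge_atTop 0] with x hx hx0
    rw [eval_mul] at hx
    have h5 : 0 ≤ L.a₃.eval x / L.a₄.eval x := by
      have h6 := mul_nonneg hx (mul_self_nonneg (L.a₄.eval x)⁻¹)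
      rcases eq_or_ne (L.a₄.eval x) 0 with h7 | h7
      · simp [h7]
      · calc 0 ≤ _ := h6
          _ = _ := by field_simp
    simpa using mul_nonneg hx0 h5

end SelfAdjointWith

end DiffOp4

/-! ### Coefficients on the line and on a half-line -/

/-- The range x > 1 is where x and 1 - x² are nonzero, so that their powers can be cancelled from
the formal symmetry equation. -/
theorem cubic_coeffs_eq_zero {c₀ c₁ c₂ c₃ : ℝ}
    (h : ∀ x : ℝ, 1 < x → c₀ + c₁ * x + c₂ * x ^ 2 + c₃ * x ^ 3 = 0) :
    c₀ = 0 ∧ c₁ = 0 ∧ c₂ = 0 ∧ c₃ = 0 := by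
  have h2 := h 2 (by norm_num)
  have h3 := h 3 (by norm_num)
  have h4 := h 4 (by norm_num)
  have h5 := h 5 (by norm_num)
  refine ⟨?_, ?_, ?_, ?_⟩ <;> linarith

theorem Polynomial.exists_eq_linear {q : ℝ[X]} (h : q.natDegree ≤ 1) :
    ∃ l₀ l₁ : ℝ, q = C l₀ + C l₁ * X := by
  refine ⟨q.coeff 0, q.coeff 1, ?_⟩
  conv_lhs => rw [q.as_sum_range_C_mul_X_pow' (n := 2) (by omega)]
  simp [Finset.sum_range_succ]

theorem Polynomial.exists_eq_quadratic {q : ℝ[X]} (h : q.natDegree ≤ 2) :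
    ∃ l₀ l₁ l₂ : ℝ, q = C l₀ + C l₁ * X + C l₂ * X ^ 2 := by
  refine ⟨q.coeff 0, q.coeff 1, q.coeff 2, ?_⟩
  conv_lhs => rw [q.as_sum_range_C_mul_X_pow' (n := 3) (by omega)]
  simp [Finset.sum_range_succ]

theorem Polynomial.exists_eq_cubic {q : ℝ[X]} (h : q.natDegree ≤ 3) :
    ∃ l₀ l₁ l₂ l₃ : ℝ, q = C l₀ + C l₁ * X + C l₂ * X ^ 2 + C l₃ * X ^ 3 := by
  refine ⟨q.coeff 0, q.coeff 1, q.coeff 2, q.coeff 3, ?_⟩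
  conv_lhs => rw [q.as_sum_range_C_mul_X_pow' (n := 4) (by omega)]
  simp [Finset.sum_range_succ]

theorem Polynomial.exists_eq_quartic {q : ℝ[X]} (h : q.natDegree ≤ 4) :
    ∃ l₀ l₁ l₂ l₃ l₄ : ℝ, q = C l₀ + C l₁ * X + C l₂ * X ^ 2 + C l₃ * X ^ 3 + C l₄ * X ^ 4 := by
  refine ⟨q.coeff 0, q.coeff 1, q.coeff 2, q.coeff 3, q.coeff 4, ?_⟩
  conv_lhs => rw [q.as_sum_range_C_mul_X_pow' (n := 5) (by omega)]
  simp [Finset.sum_range_succ]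

theorem exists_eq_add_const_of_hasDerivAt {J : Set ℝ} (hJ : IsOpen J) (hc : J.OrdConnected)
    (hne : J.Nonempty) {f g f' : ℝ → ℝ} (hf : ∀ x ∈ J, HasDerivAt f (f' x) x)
    (hg : ∀ x ∈ J, HasDerivAt g (f' x) x) : ∃ c, ∀ x ∈ J, f x = g x + c := by
  obtain ⟨x₀, hx₀⟩ := hne
  refine ⟨f x₀ - g x₀, fun x hx => ?_⟩
  have hd : ∀ x ∈ J, HasDerivAt (fun x => f x - g x) 0 x := fun x hx =>
    ((hf x hx).sub (hg x hx)).congr_deriv (sub_self _)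
  have := hJ.is_const_of_deriv_eq_zero hc.isPreconnected
    (fun x hx => (hd x hx).differentiableAt.differentiableWithinAt)
    (fun x hx => (hd x hx).deriv) hx hx₀
  linarith

namespace DiffOp4

variable {L : DiffOp4} {I : Set ℝ} {p : ℝ → ℝ}

theorem SelfAdjointWith.scale {κ : ℝ} (hκ : κ ≠ 0) (H : L.SelfAdjointWith polyFunctions I p) :
    (L.scale κ).SelfAdjointWith polyFunctions I p := by
  have h := H.affine_scale polyFunctions_contDiff polyFunctions_affine one_ne_zero hκ one_pos 0
  simpa [affine_one_zero, ofPred_mem_eq] using h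

theorem eval_scale_affine_reflect (L : DiffOp4) :
    ((L.affine (-1) 0).scale 1).a₃.natDegree = L.a₃.natDegree ∧
    ((L.affine (-1) 0).scale 1).a₄.natDegree = L.a₄.natDegree ∧
    ((L.affine (-1) 0).scale 1).a₃.leadingCoeff = - (L.a₃.leadingCoeff * (-1) ^ L.a₃.natDegree) ∧
    ((L.affine (-1) 0).scale 1).a₄.leadingCoeff = L.a₄.leadingCoeff * (-1) ^ L.a₄.natDegree := by
  have e : (C (-1) * X + C 0 : ℝ[X]) = - X := by simp
  have e3 : ((L.affine (-1) 0).scale 1).a₃ = - L.a₃.comp (-X) := by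
    simp only [DiffOp4.scale, affine, e]; norm_num
  have e4 : ((L.affine (-1) 0).scale 1).a₄ = L.a₄.comp (-X) := by
    simp only [DiffOp4.scale, affine, e]; norm_num
  have hX : (-X : ℝ[X]).natDegree = 1 := by simp
  rw [e3, e4, natDegree_neg, natDegree_comp, natDegree_comp, leadingCoeff_neg,
    leadingCoeff_comp (by rw [hX]; exact one_ne_zero),
    leadingCoeff_comp (by rw [hX]; exact one_ne_zero), hX]
  simp

/-- The leading coefficients of `a₃` and `a₄` have opposite signs both before and after x ↦ -x, so
deg a₃ + deg a₄ is odd. With deg a₄ ≤ deg a₃ and the bounds from formal symmetry, only the pair (0,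
1) remains. -/
theorem SelfAdjointWith.natDegree_of_univ (H : L.SelfAdjointWith polyFunctions univ p) :
    L.a₄.natDegree = 0 ∧ L.a₃.natDegree = 1 := by
  obtain ⟨h1, h2⟩ := H.degree_of_Ioi_subset (subset_univ (Ioi 0))
  have H' := H.affine_scale polyFunctions_contDiff polyFunctions_affine
    (neg_ne_zero.2 one_ne_zero) one_ne_zero one_pos 0
  obtain ⟨-, h3⟩ := H'.degree_of_Ioi_subset (X₀ := 0) (fun x _ => mem_univ _)
  obtain ⟨-, -, e3, e4⟩ := eval_scale_affine_reflect L
  rw [e3, e4] at h3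
  have hodd : Odd (L.a₃.natDegree + L.a₄.natDegree) := by
    by_contra hev
    rw [Nat.not_odd_iff_even] at hev
    have := hev.neg_one_pow (α := ℝ)
    rw [pow_add] at this
    nlinarith
  have h30 : L.a₃ ≠ 0 := by
    rintro h; simp [h] at h2
  rcases natDegree_le_of_formal_symmetry H.formal_symmetry H.order_four h30 h1 with h | h <;>
    obtain ⟨j, hj⟩ := hodd <;> omega

theorem SelfAdjointWith.exists_hermite (H : L.SelfAdjointWith polyFunctions univ p) :
    ∃ κ m₀ m₁ m₂ A : ℝ, κ ≠ 0 ∧ m₂ ≠ 0 ∧ L.scale κ = hermiteOp m₁ m₂ A ∧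
      ∀ x, p x = Real.exp (-m₂ ^ 2 * x ^ 2 + m₁ * x + m₀) := by
  obtain ⟨hd4, hd3⟩ := H.natDegree_of_univ
  have h4 := eq_C_of_natDegree_eq_zero hd4
  have hc0 : L.a₄.coeff 0 ≠ 0 := fun h => H.order_four.1 (by rw [h4, h, C_0])
  have HM := H.scale (inv_ne_zero hc0)
  have hM4 : (L.scale (L.a₄.coeff 0)⁻¹).a₄ = 1 := by
    simp only [DiffOp4.scale]
    conv_lhs => rw [h4]
    rw [coeff_C_zero, ← C_mul, inv_mul_cancel₀ hc0, C_1]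
  have hM3 : (L.scale (L.a₄.coeff 0)⁻¹).a₃.natDegree = 1 := by
    simp only [DiffOp4.scale]
    rw [natDegree_C_mul (inv_ne_zero hc0), hd3]
  refine ⟨(L.a₄.coeff 0)⁻¹, ?_⟩
  simp only [ne_eq, inv_ne_zero hc0, not_false_eq_true, true_and]
  generalize L.scale (L.a₄.coeff 0)⁻¹ = M at *
  obtain ⟨α, β, e3⟩ := exists_eq_linear hM3.le
  obtain ⟨l₀, l₁, e1⟩ := exists_eq_linear HM.order_four.2.1
  obtain ⟨q₀, q₁, q₂, e2⟩ := exists_eq_quadratic HM.order_four.2.2.1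
  have hβ : β < 0 := by
    have := (HM.degree_of_Ioi_subset (subset_univ (Ioi 0))).2
    rw [leadingCoeff, hM3, hM4, e3] at this
    simpa using this
  have hfs := HM.formal_symmetry
  rw [secondNum, logDerivNum, hM4, e1, e2, e3] at hfs
  have hev : ∀ x : ℝ, 1 < x →
      ((α * (4 * q₀ - 2 * β - α ^ 2) + 2 * (4 * q₁ - 2 * α * β) - 8 * l₀)
      + (β * (4 * q₀ - 2 * β - α ^ 2) + α * (4 * q₁ - 2 * α * β) + 4 * (4 * q₂ - β ^ 2) - 8 * l₁) * x
      + (β * (4 * q₁ - 2 * α * β) + α * (4 * q₂ - β ^ 2)) * x ^ 2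
      + (β * (4 * q₂ - β ^ 2)) * x ^ 3) = 0 := by
    intro x _
    have := congrArg (eval x) hfs
    simp [derivative_mul] at this
    linear_combination -this
  obtain ⟨c0, c1, c2, c3⟩ := cubic_coeffs_eq_zero hev
  -- As β ≠ 0, the coefficients of x³ and x² make the quadratic and then the linear coefficient of g
  -- vanish: g is constant.
  have hs2 := (mul_eq_zero.1 c3).resolve_left hβ.ne
  rw [hs2, mul_zero, add_zero] at c2
  have hs1 := (mul_eq_zero.1 c2).resolve_left hβ.ne
  obtain ⟨F, hF⟩ := HM.weight
  have hF' : ∀ x ∈ (univ : Set ℝ), HasDerivAt F (α + β * x) x := fun x hx => by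
    have := (hF x hx (by simp [hM4])).1
    rw [hM4, e3] at this
    simpa using this
  obtain ⟨c, hc⟩ := exists_eq_add_const_of_hasDerivAt isOpen_univ ordConnected_univ univ_nonempty
    hF' (g := fun x => α * x + β * x ^ 2 / 2) (fun x _ => by
      have h1 := ((hasDerivAt_id x).const_mul α).add
        (((hasDerivAt_pow 2 x).const_mul β).div_const 2)
      refine h1.congr_deriv ?_
      norm_num
      ring)
  have hm2 : (√(-β) / 2) ^ 2 = -β / 4 := by
    rw [div_pow, Real.sq_sqrt (by linarith)]; norm_num
  have hm4 : (√(-β) / 2) ^ 4 = β ^ 2 / 16 := by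
    rw [show (4 : ℕ) = 2 * 2 from rfl, pow_mul, hm2]; ring
  -- The parameters are read off from a₃ = α + βx = 2(m₁ - 2m₂²x); the sign of β makes the root real
  -- and nonzero.
  refine ⟨c / 2, α / 2, √(-β) / 2, q₀, ?_, ?_, fun x => ?_⟩
  · have : 0 < √(-β) := Real.sqrt_pos.2 (by linarith)
    positivity
  · ext1 <;> refine Polynomial.funext fun x => ?_
    · rw [e1]
      simp [hermiteOp, hm2]
      linear_combination (-1 / 8 : ℝ) * c0 - x / 8 * c1 + hs1 * (1 / 4 + x * α / 8) + hs2 * (x / 2)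
    · rw [e2]
      simp [hermiteOp, hm2, hm4]
      linear_combination x / 4 * hs1 + x ^ 2 / 4 * hs2
    · rw [e3]
      simp [hermiteOp, hm2]
      ring
    · rw [hM4]; simp [hermiteOp]
  · rw [(hF x (mem_univ x) (by simp [hM4])).2, hc x (mem_univ x), hM4, hm2]
    simp
    ring

theorem SelfAdjointWith.exists_laguerre (H : L.SelfAdjointWith polyFunctions (Ioi 0) p) :
    ∃ κ c a b A : ℝ, κ ≠ 0 ∧ 0 < c ∧ 2 < a ∧ b < 0 ∧ L.scale κ = laguerreOp a b A ∧
      ∀ y ∈ Ioi (0 : ℝ), p y = c * (|y| ^ (a / 2 - 2) * Real.exp (b / 2 * y)) := by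
  have h0 := H.eval_a₄_left_end (Or.inl rfl)
  have h0' := H.eval_derivative_a₄_left_end (Or.inl rfl)
  obtain ⟨hdk, hneg⟩ := H.degree_of_Ioi_subset (subset_refl (Ioi 0))
  have h30 : L.a₃ ≠ 0 := by
    rintro h; simp [h] at hneg
  have hdeg := natDegree_le_of_formal_symmetry H.formal_symmetry H.order_four h30 hdk
  have c0 : L.a₄.coeff 0 = 0 := by rwa [coeff_zero_eq_eval_zero]
  have c1 : L.a₄.coeff 1 = 0 := by
    rw [← coeff_zero_eq_eval_zero, coeff_derivative] at h0'
    simpa using h0'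
  -- From deg a₄ ≤ deg a₃ and either bound of `hdeg`; the double zero at 0 then leaves only a
  -- multiple of x².
  have hd2 : L.a₄.natDegree ≤ 2 := by omega
  obtain ⟨k₀, k₁, k₂, e4⟩ := exists_eq_quadratic hd2
  have hk0 : k₀ = 0 := by rw [e4] at c0; simpa using c0
  have hk1 : k₁ = 0 := by rw [e4] at c1; simpa [coeff_X] using c1
  have hk2 : k₂ ≠ 0 := by
    rintro rfl
    apply H.order_four.1
    rw [e4, hk0, hk1]; simp
  have e4' : L.a₄ = C k₂ * X ^ 2 := by rw [e4, hk0, hk1]; simp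
  have hd4 : L.a₄.natDegree = 2 := by
    rw [e4', natDegree_C_mul_X_pow 2 _ hk2]
  have HM := H.scale (inv_ne_zero hk2)
  have hM4 : (L.scale k₂⁻¹).a₄ = X ^ 2 := by
    simp only [DiffOp4.scale]
    rw [e4', ← mul_assoc, ← C_mul, inv_mul_cancel₀ hk2, C_1, one_mul]
  have hM3 : (L.scale k₂⁻¹).a₃.natDegree = 2 := by
    simp only [DiffOp4.scale]
    rw [natDegree_C_mul (inv_ne_zero hk2)]
    omega
  refine ⟨k₂⁻¹, ?_⟩
  simp only [ne_eq, inv_ne_zero hk2, not_false_eq_true, true_and]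
  generalize L.scale k₂⁻¹ = M at *
  obtain ⟨a₀, a, b, e3⟩ := exists_eq_quadratic hM3.le
  obtain ⟨l₀, l₁, e1⟩ := exists_eq_linear HM.order_four.2.1
  obtain ⟨q₀, q₁, q₂, e2⟩ := exists_eq_quadratic HM.order_four.2.2.1
  have hb : b < 0 := by
    have := (HM.degree_of_Ioi_subset (subset_refl (Ioi 0))).2
    rw [leadingCoeff, hM3, hM4, e3] at this
    simpa [coeff_X, coeff_C] using this
  have hfs := HM.formal_symmetry
  rw [secondNum, logDerivNum, hM4, e1, e2, e3] at hfs
  have ha0 : a₀ = 0 := by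
    have := congrArg (eval 0) hfs
    simpa [derivative_mul] using this
  subst ha0
  have hev : ∀ x : ℝ, 1 < x →
      ((a - 4) * (4 * q₀ - 2 * a - (a - 4) * a))
      + ((a - 2) * (4 * q₁ - 2 * a * b) + b * (4 * q₀ - 2 * a - (a - 4) * a) - 8 * l₀) * x
      + (a * (4 * q₂ - b ^ 2) + b * (4 * q₁ - 2 * a * b) - 8 * l₁) * x ^ 2
      + (b * (4 * q₂ - b ^ 2)) * x ^ 3 = 0 := by
    intro x hx
    have hx0 : x ≠ 0 := by linarith
    have := congrArg (eval x) hfs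
    simp [derivative_mul] at this
    refine mul_left_cancel₀ (pow_ne_zero 3 hx0) ?_
    linear_combination -this
  obtain ⟨c0, c1, c2, c3⟩ := cubic_coeffs_eq_zero hev
  have hs2 := (mul_eq_zero.1 c3).resolve_left hb.ne
  -- Formal symmetry gives this only up to the factor a - 4. For a = 4 the weight has a positive
  -- limit at 0, and the boundary term decides.
  have hs0 : 4 * q₀ - 2 * a - (a - 4) * a = 0 := by
    rcases eq_or_ne a 4 with rfl | ha
    · have := HM.eval_a₂_left_end (Or.inl rfl) (r := 1) (n' := C b) (by rw [hM4, mul_one])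
        (by simp) (by
          rw [logDerivNum, hM4, e3]
          refine Polynomial.funext fun x => ?_
          simp
          ring)
      rw [e2, e3] at this
      simp at this
      linarith
    · exact (mul_eq_zero.1 c0).resolve_left (sub_ne_zero.2 ha)
  have h4x : ∀ x : ℝ, 0 < x → M.a₄.eval x ≠ 0 := fun x hx => by
    rw [hM4, eval_pow, eval_X]; positivity
  obtain ⟨F, hF⟩ := HM.weight
  have hF' : ∀ x ∈ Ioi (0 : ℝ), HasDerivAt F (a / x + b) x := fun x hx => by
    have hx0 : 0 < x := hx
    have := (hF x hx (h4x x hx0)).1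
    rw [hM4, e3] at this
    refine this.congr_deriv ?_
    simp
    field_simp
  obtain ⟨c, hc⟩ := exists_eq_add_const_of_hasDerivAt isOpen_Ioi ordConnected_Ioi nonempty_Ioi
    hF' (g := fun x => a * Real.log x + b * x) (fun x hx => by
      have hx0 : 0 < x := hx
      have h1 := ((Real.hasDerivAt_log hx0.ne').const_mul a).add ((hasDerivAt_id x).const_mul b)
      refine h1.congr_deriv ?_
      simp
      ring)
  have hp : ∀ y ∈ Ioi (0 : ℝ),
      p y = Real.exp (c / 2) * (|y| ^ (a / 2 - 2) * Real.exp (b / 2 * y)) := by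
    intro y hy
    have hy0 : 0 < y := hy
    rw [(hF y hy (h4x y hy0)).2, hc y hy, hM4, abs_of_pos hy0, Real.rpow_sub hy0,
      Real.rpow_def_of_pos hy0]
    simp only [eval_pow, eval_X, abs_of_pos (pow_pos hy0 2)]
    rw [show (y : ℝ) ^ (2 : ℝ) = y ^ 2 from Real.rpow_natCast y 2, div_mul_eq_mul_div,
      ← mul_div_assoc, ← Real.exp_add, ← Real.exp_add]
    congr 2
    ring
  refine ⟨Real.exp (c / 2), a, b, q₁, Real.exp_pos _, ?_, hb, ?_, hp⟩
  -- Integrability of p near 0, after removal of the exponential factor, means a/2 - 2 > -1.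
  · have hint : IntegrableOn (fun x => p x * (1 : ℝ[X]).eval x) (Icc 0 1) :=
      (integrableOn_Icc_iff_integrableOn_Ioc (by finiteness)).2
        ((HM.admissible 1).mono_set fun x hx => hx.1)
    have h1 := hint.continuousOn_mul (g := fun x => Real.exp (-(b / 2 * x)) * Real.exp (-(c / 2)))
      (by fun_prop) isCompact_Icc
    have h2 : IntegrableOn (fun x : ℝ => x ^ (a / 2 - 2)) (Ioo 0 1) := by
      refine (h1.mono_set Ioo_subset_Icc_self).congr_fun (fun x hx => ?_) measurableSet_Ioo
      simp only [eval_one, mul_one, hp x hx.1, abs_of_pos hx.1, Real.exp_neg]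
      field_simp
    have := (intervalIntegral.integrableOn_Ioo_rpow_iff one_pos).1 h2
    linarith
  · ext1 <;> refine Polynomial.funext fun x => ?_
    · rw [e1]
      simp [laguerreOp]
      linear_combination (-1 / 8 : ℝ) * c1 - x / 8 * c2 + b / 8 * hs0 + a / 8 * x * hs2
    · rw [e2]
      simp [laguerreOp]
      linear_combination (1 / 4 : ℝ) * hs0 + x ^ 2 / 4 * hs2
    · rw [e3]
      simp [laguerreOp]
      ring
    · rw [hM4]; simp [laguerreOp]

end DiffOp4

/-! ### Coefficients on a bounded interval -/

/-- The common form of the families `gegenbauerOp` and `jacobiOp`. -/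
def jacobiForm (a b g : ℝ) : DiffOp4 where
  a₄ := (1 - X ^ 2) ^ 2
  a₃ := C 2 * (C b + C (a - 2) * X) * (1 - X ^ 2)
  a₂ := C (a - 2 + b ^ 2) + C (2 * (a - 1) * b) * X + C (a ^ 2 - 3 * a + 2) * X ^ 2
    + C g * (1 - X ^ 2)
  a₁ := C g * (C b + C a * X)

/-- Both displayed families belong to one family whose free parameter is g; the split at b = 0 only
reflects that B = g b ceases to be a coordinate there. -/
theorem gegenbauerOp_eq (a A : ℝ) :
    gegenbauerOp a A = jacobiForm a 0 (2 - 3 * a + a ^ 2 - A) := by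
  ext1 <;> refine Polynomial.funext fun x => ?_ <;> simp [gegenbauerOp, jacobiForm] <;> ring

theorem jacobiOp_eq {b : ℝ} (hb : b ≠ 0) (a B : ℝ) : jacobiOp a b B = jacobiForm a b (B / b) := by
  ext1 <;> refine Polynomial.funext fun x => ?_ <;> simp [jacobiOp, jacobiForm] <;>
    field_simp <;> ring

namespace DiffOp4

variable {L : DiffOp4} {I : Set ℝ} {p : ℝ → ℝ}

theorem preimage_Ioo_right : {y : ℝ | 1 * y + (-1) ∈ Ioo (-1 : ℝ) 1} = Ioo 0 2 := by
  ext y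
  simp only [mem_ofPred_eq, mem_Ioo]
  constructor <;> rintro ⟨h1, h2⟩ <;> constructor <;> linarith

theorem preimage_Ioo_left : {y : ℝ | -1 * y + 1 ∈ Ioo (-1 : ℝ) 1} = Ioo 0 2 := by
  ext y
  simp only [mem_ofPred_eq, mem_Ioo]
  constructor <;> rintro ⟨h1, h2⟩ <;> constructor <;> linarith

namespace SelfAdjointWith

variable (H : L.SelfAdjointWith polyFunctions (Ioo (-1) 1) p)
include H

theorem translate_left_end : ((L.affine 1 (-1)).scale 1).SelfAdjointWith polyFunctions (Ioo 0 2)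
    (fun y => 1 * p (1 * y + -1)) := by
  have := H.affine_scale polyFunctions_contDiff polyFunctions_affine one_ne_zero one_ne_zero
    one_pos (-1)
  rwa [preimage_Ioo_right] at this

theorem reflect_right_end : ((L.affine (-1) 1).scale 1).SelfAdjointWith polyFunctions (Ioo 0 2)
    (fun y => 1 * p (-1 * y + 1)) := by
  have := H.affine_scale polyFunctions_contDiff polyFunctions_affine
    (neg_ne_zero.2 one_ne_zero) one_ne_zero one_pos 1
  rwa [preimage_Ioo_left] at this

/-- Each end is moved to 0, where `a₄` has a double zero; the degree is at most 4. -/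
theorem exists_a₄_eq : ∃ k : ℝ, k ≠ 0 ∧ L.a₄ = C k * (1 - X ^ 2) ^ 2 := by
  have hI : Ioo (0 : ℝ) 2 = Ioi 0 ∨ ∃ e > 0, Ioo (0 : ℝ) 2 = Ioo 0 e :=
    Or.inr ⟨2, two_pos, rfl⟩
  have h1 := H.translate_left_end.eval_a₄_left_end hI
  have h2 := H.translate_left_end.eval_derivative_a₄_left_end hI
  have h3 := H.reflect_right_end.eval_a₄_left_end hI
  have h4 := H.reflect_right_end.eval_derivative_a₄_left_end hI
  obtain ⟨l₀, l₁, l₂, l₃, l₄, e⟩ := exists_eq_quartic H.order_four.2.2.2.2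
  simp [DiffOp4.scale, affine, e, derivative_mul, derivative_pow] at h1 h2 h3 h4
  norm_num at h1 h2 h3 h4
  have k0 : l₀ = l₄ := by linarith
  have k1 : l₁ = 0 := by linarith
  have k2 : l₂ = -2 * l₄ := by linarith
  have k3 : l₃ = 0 := by linarith
  have e' : L.a₄ = C l₄ * (1 - X ^ 2) ^ 2 := by
    rw [e, k0, k1, k2, k3]
    refine Polynomial.funext fun x => ?_
    simp
    ring
  refine ⟨l₄, ?_, e'⟩
  rintro rfl
  exact H.order_four.1 (by rw [e']; simp)

theorem exists_jacobiForm : ∃ κ c a b g : ℝ, κ ≠ 0 ∧ 0 < c ∧ 0 < b - a ∧ b + a < 0 ∧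
    L.scale κ = jacobiForm a b g ∧ ∀ y ∈ Ioo (-1 : ℝ) 1,
      p y = c * ((1 - y) ^ ((-2 - a - b) / 2) * (1 + y) ^ ((-2 - a + b) / 2)) := by
  obtain ⟨k, hk, e4⟩ := H.exists_a₄_eq
  have HM := H.scale (inv_ne_zero hk)
  have hM4 : (L.scale k⁻¹).a₄ = (1 - X ^ 2) ^ 2 := by
    simp only [DiffOp4.scale]
    rw [e4, ← mul_assoc, ← C_mul, inv_mul_cancel₀ hk, C_1, one_mul]
  refine ⟨k⁻¹, ?_⟩
  simp only [ne_eq, inv_ne_zero hk, not_false_eq_true, true_and]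
  generalize L.scale k⁻¹ = M at *
  clear H
  obtain ⟨t₀, t₁, t₂, t₃, e3⟩ := exists_eq_cubic HM.order_four.2.2.2.1
  obtain ⟨l₀, l₁, e1⟩ := exists_eq_linear HM.order_four.2.1
  obtain ⟨q₀, q₁, q₂, e2⟩ := exists_eq_quadratic HM.order_four.2.2.1
  have hfs := HM.formal_symmetry
  rw [secondNum, logDerivNum, hM4] at hfs
  have hr : t₀ + t₁ + t₂ + t₃ = 0 := by
    have := congrArg (eval 1) hfs
    simpa [derivative_mul, derivative_pow, e3] using this
  have hl : t₀ - t₁ + t₂ - t₃ = 0 := by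
    have := congrArg (eval (-1)) hfs
    simp [derivative_mul, derivative_pow, e3] at this
    linarith
  obtain ⟨b, hb⟩ : ∃ b, t₀ = 2 * b := ⟨t₀ / 2, by ring⟩
  obtain ⟨a, ha⟩ : ∃ a, t₁ = 2 * (a - 2) := ⟨t₁ / 2 + 2, by ring⟩
  have e3' : M.a₃ = C 2 * (C b + C (a - 2) * X) * (1 - X ^ 2) := by
    rw [e3, hb, ha, show t₂ = -(2 * b) by linarith, show t₃ = -(2 * (a - 2)) by linarith]
    refine Polynomial.funext fun x => ?_
    simp
    ring
  clear e3
  rw [e1, e2, e3'] at hfs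
  -- `s₀`, `s₁`, `s₂` are the coefficients of 4g, the quotient of `secondNum` by (1 - x²)².
  obtain ⟨s₀, hs₀⟩ : ∃ s, s = 4 * q₀ - 4 * (a - 2) - 4 * b ^ 2 := ⟨_, rfl⟩
  obtain ⟨s₁, hs₁⟩ : ∃ s, s = 4 * q₁ + 8 * b - 4 * (2 * a * b) := ⟨_, rfl⟩
  obtain ⟨s₂, hs₂⟩ : ∃ s, s = 4 * q₂ + 12 * (a - 2) - 4 * (a ^ 2 - 4) := ⟨_, rfl⟩
  have hev : ∀ x : ℝ, 1 < x → (b * s₀ + s₁ - 4 * l₀)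
      + (b * s₁ + (a + 2) * s₀ + 2 * s₂ - 4 * l₁) * x
      + (b * s₂ + (a + 2) * s₁ - s₁ + 4 * l₀) * x ^ 2
      + ((a + 2) * s₂ - 2 * s₂ + 4 * l₁) * x ^ 3 = 0 := by
    intro x hx
    have hx0 : 1 - x ^ 2 ≠ 0 := by nlinarith
    have := congrArg (eval x) hfs
    simp [derivative_mul, derivative_pow] at this
    refine mul_left_cancel₀ (pow_ne_zero 3 hx0) ?_
    rw [hs₀, hs₁, hs₂]
    linear_combination (-1 / 2 : ℝ) * this
  obtain ⟨c0, c1, c2, c3⟩ := cubic_coeffs_eq_zero hev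
  have hI : Ioo (0 : ℝ) 2 = Ioi 0 ∨ ∃ e > 0, Ioo (0 : ℝ) 2 = Ioo 0 e :=
    Or.inr ⟨2, two_pos, rfl⟩
  -- This says g(1) = 0. The sum of the coefficient equations gives it up to the factor a + 2 + b,
  -- which vanishes exactly when the exponent of 1 - x in p is 0; then the boundary term at 1 is
  -- used. The end -1 is treated alike, and g becomes a multiple of 1 - x².
  have hσr : s₀ + s₁ + s₂ = 0 := by
    rcases eq_or_ne (a + 2 + b) 0 with hab | hab
    · have := HM.reflect_right_end.eval_a₂_left_end hI (r := (2 - X) ^ 2)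
        (n' := C (-2 * b) * (2 - X))
        (by
          simp only [DiffOp4.scale, affine, hM4]
          refine Polynomial.funext fun x => ?_
          simp
          ring) (by simp) (by
          simp only [logDerivNum, DiffOp4.scale, affine, hM4, e3']
          refine Polynomial.funext fun x => ?_
          simp [derivative_mul, derivative_pow]
          linear_combination (-2 * x * (1 - x) * (2 - x)) * hab)
      simp [DiffOp4.scale, affine, e3', e2, derivative_mul, derivative_pow] at this
      rw [hs₀, hs₁, hs₂]
      linear_combination 2 * this - 4 * (b + a - 2) * hab
    · refine mul_left_cancel₀ hab ?_
      linear_combination c0 + c1 + c2 + c3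
  have hσl : s₀ - s₁ + s₂ = 0 := by
    rcases eq_or_ne (b - a - 2) 0 with hab | hab
    · have := HM.translate_left_end.eval_a₂_left_end hI (r := (2 - X) ^ 2)
        (n' := C (2 * b) * (2 - X))
        (by
          simp only [DiffOp4.scale, affine, hM4]
          refine Polynomial.funext fun x => ?_
          simp
          ring) (by simp) (by
          simp only [logDerivNum, DiffOp4.scale, affine, hM4, e3']
          refine Polynomial.funext fun x => ?_
          simp [derivative_pow]
          linear_combination (2 * x * (1 - x) * (2 - x)) * hab)
      simp [DiffOp4.scale, affine, e3', e2, derivative_mul, derivative_pow] at this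
      rw [hs₀, hs₁, hs₂]
      linear_combination 2 * this - 4 * (b - a + 2) * hab
    · refine mul_left_cancel₀ hab ?_
      linear_combination c0 - c1 + c2 - c3
  have hs1 : s₁ = 0 := by linarith
  have hs2 : s₂ = -s₀ := by linarith
  have hy : ∀ x ∈ Ioo (-1 : ℝ) 1, 0 < 1 - x ∧ 0 < 1 + x := fun x hx =>
    ⟨by linarith [hx.2], by linarith [hx.1]⟩
  have h4x : ∀ x ∈ Ioo (-1 : ℝ) 1, M.a₄.eval x ≠ 0 := fun x hx => by
    obtain ⟨h1, h2⟩ := hy x hx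
    rw [hM4]
    simp only [eval_pow, eval_sub, eval_one, eval_X]
    have : 1 - x ^ 2 = (1 - x) * (1 + x) := by ring
    rw [this]
    positivity
  obtain ⟨F, hF⟩ := HM.weight
  have hF' : ∀ x ∈ Ioo (-1 : ℝ) 1,
      HasDerivAt F ((b + a - 2) / (1 - x) + (b - a + 2) / (1 + x)) x := fun x hx => by
    obtain ⟨h1, h2⟩ := hy x hx
    have := (hF x hx (h4x x hx)).1
    rw [hM4, e3'] at this
    refine this.congr_deriv ?_
    have h3 : 1 - x ^ 2 = (1 - x) * (1 + x) := by ring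
    simp only [eval_pow, eval_sub, eval_one, eval_X, eval_mul, eval_C, eval_add, h3]
    field_simp
    ring
  obtain ⟨c, hc⟩ := exists_eq_add_const_of_hasDerivAt isOpen_Ioo ordConnected_Ioo
    (nonempty_Ioo.2 (by norm_num)) hF'
    (g := fun x => -(b + a - 2) * Real.log (1 - x) + (b - a + 2) * Real.log (1 + x))
    (fun x hx => by
      obtain ⟨h1, h2⟩ := hy x hx
      have d1 := (((hasDerivAt_id x).const_sub 1).log h1.ne').const_mul (-(b + a - 2))
      have d2 := (((hasDerivAt_id x).const_add 1).log h2.ne').const_mul (b - a + 2)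
      refine (d1.add d2).congr_deriv ?_
      simp only [id]
      ring)
  have hp : ∀ y ∈ Ioo (-1 : ℝ) 1, p y = Real.exp (c / 2) *
      ((1 - y) ^ ((-2 - a - b) / 2) * (1 + y) ^ ((-2 - a + b) / 2)) := by
    intro y hyI
    obtain ⟨h1, h2⟩ := hy y hyI
    have h3 : (1 - y ^ 2) ^ 2 = (1 - y) ^ (2 : ℝ) * (1 + y) ^ (2 : ℝ) := by
      rw [Real.rpow_two, Real.rpow_two]; ring
    have h5 : |(1 - y ^ 2) ^ 2| = (1 - y ^ 2) ^ 2 := abs_of_nonneg (sq_nonneg _)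
    rw [(hF y hyI (h4x y hyI)).2, hc y hyI, hM4]
    simp only [eval_pow, eval_sub, eval_one, eval_X]
    rw [h5, h3, Real.rpow_def_of_pos h1, Real.rpow_def_of_pos h2, Real.rpow_def_of_pos h1,
      Real.rpow_def_of_pos h2, ← Real.exp_add, ← Real.exp_add, ← Real.exp_add, ← Real.exp_sub]
    congr 1
    ring
  have hone := HM.admissible 1
  have hunit : (Ioo (0 : ℝ) 2) ∩ Ioc 0 1 = Ioc 0 1 :=
    inter_eq_right.2 fun x hx => ⟨hx.1, by linarith [hx.2]⟩
  refine ⟨Real.exp (c / 2), a, b, s₀ / 4, Real.exp_pos _, ?_, ?_, ?_, hp⟩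
  -- With the end -1 moved to 0, the other factor of p is continuous and positive on [0, 1] and can
  -- be divided out, so a pure power is integrable on (0, 1) and its exponent exceeds -1.
  · have h1 := (integrableOn_affine isOpen_Ioo one_ne_zero (-1) hone)
    rw [preimage_Ioo_right] at h1
    have h2 : IntegrableOn _ (Icc (0 : ℝ) 1) := (integrableOn_Icc_iff_integrableOn_Ioc
      (by finiteness)).2 (h1.mono_set (hunit ▸ inter_subset_left))
    have h3 := h2.continuousOn_mul
      (g := fun x : ℝ => (2 - x) ^ (-((-2 - a - b) / 2)) * Real.exp (-(c / 2)))
      (ContinuousOn.mul (ContinuousOn.rpow_const (by fun_prop) fun x hx =>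
        Or.inl (by linarith [hx.2])) (by fun_prop)) isCompact_Icc
    have h4 : IntegrableOn (fun x : ℝ => x ^ ((-2 - a + b) / 2)) (Ioo 0 1) := by
      refine (h3.mono_set Ioo_subset_Icc_self).congr_fun (fun x hx => ?_) measurableSet_Ioo
      have hx2 : 0 < 2 - x := by linarith [hx.2]
      have := Real.rpow_pos_of_pos hx2 ((-2 - a - b) / 2)
      beta_reduce
      rw [hp (1 * x + -1) ⟨by linarith [hx.1], by linarith [hx.2]⟩, Real.exp_neg,
        Real.rpow_neg hx2.le, show 1 - (1 * x + -1) = 2 - x by ring,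
        show 1 + (1 * x + -1) = x by ring, eval_one]
      field_simp
    have := (intervalIntegral.integrableOn_Ioo_rpow_iff one_pos).1 h4
    linarith
  · have h1 := (integrableOn_affine isOpen_Ioo (neg_ne_zero.2 one_ne_zero) 1 hone)
    rw [preimage_Ioo_left] at h1
    have h2 : IntegrableOn _ (Icc (0 : ℝ) 1) := (integrableOn_Icc_iff_integrableOn_Ioc
      (by finiteness)).2 (h1.mono_set (hunit ▸ inter_subset_left))
    have h3 := h2.continuousOn_mul
      (g := fun x : ℝ => (2 - x) ^ (-((-2 - a + b) / 2)) * Real.exp (-(c / 2)))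
      (ContinuousOn.mul (ContinuousOn.rpow_const (by fun_prop) fun x hx =>
        Or.inl (by linarith [hx.2])) (by fun_prop)) isCompact_Icc
    have h4 : IntegrableOn (fun x : ℝ => x ^ ((-2 - a - b) / 2)) (Ioo 0 1) := by
      refine (h3.mono_set Ioo_subset_Icc_self).congr_fun (fun x hx => ?_) measurableSet_Ioo
      have hx2 : 0 < 2 - x := by linarith [hx.2]
      have := Real.rpow_pos_of_pos hx2 ((-2 - a + b) / 2)
      beta_reduce
      rw [hp (-1 * x + 1) ⟨by linarith [hx.2], by linarith [hx.1]⟩, Real.exp_neg,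
        Real.rpow_neg hx2.le, show 1 - (-1 * x + 1) = x by ring,
        show 1 + (-1 * x + 1) = 2 - x by ring, eval_one]
      field_simp
    have := (intervalIntegral.integrableOn_Ioo_rpow_iff one_pos).1 h4
    linarith
  · ext1 <;> refine Polynomial.funext fun x => ?_
    · rw [e1]
      simp [jacobiForm]
      linear_combination (-1 / 4 : ℝ) * c0 - x / 4 * c1 + (1 / 4 + x * b / 4) * hs1 + x / 2 * hs2
    · rw [e2]
      simp [jacobiForm]
      linear_combination (-1 / 4 : ℝ) * hs₀ + x / 4 * (hs1 - hs₁) + x ^ 2 / 4 * (hs2 - hs₂)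
    · rw [e3']; simp [jacobiForm]
    · rw [hM4]; simp [jacobiForm]

end SelfAdjointWith

end DiffOp4

/-! ### Sufficiency: Green's formula for functions of temperate growth -/

theorem Function.HasTemperateGrowth.iteratedDeriv {f : ℝ → ℝ} (hf : f.HasTemperateGrowth) (k : ℕ) :
    (iteratedDeriv k f).HasTemperateGrowth := by
  induction k with
  | zero => simpa using hf
  | succ k ih =>
    rw [iteratedDeriv_succ]
    refine ⟨(contDiff_infty_iff_deriv.1 ih.1).2, fun n => ?_⟩
    obtain ⟨m, C, h⟩ := ih.2 (n + 1)
    refine ⟨m, C, fun x => ?_⟩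
    rw [norm_iteratedFDeriv_eq_norm_iteratedDeriv, ← iteratedDeriv_succ',
      ← norm_iteratedFDeriv_eq_norm_iteratedDeriv]
    exact h x

theorem Polynomial.hasTemperateGrowth (q : ℝ[X]) :
    Function.HasTemperateGrowth fun x : ℝ => q.eval x := by
  induction q using Polynomial.induction_on' with
  | add p q hp hq =>
    simp only [eval_add]
    exact hp.add hq
  | monomial n a =>
    simp only [eval_monomial]
    exact (Function.HasTemperateGrowth.const a).mul (Function.HasTemperateGrowth.id'.pow n)

/-- A function of temperate growth is dominated by a constant multiple of some (1 + x²)^k, which is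
a polynomial. -/
theorem AdmissibleWeight.integrableOn_mul {I : Set ℝ} {p : ℝ → ℝ} (h : AdmissibleWeight I p)
    {f : ℝ → ℝ} (hf : f.HasTemperateGrowth) : IntegrableOn (fun x => p x * f x) I := by
  obtain ⟨k, C, hC⟩ := hf.2 0
  have hle : ∀ x, |f x| ≤ |C| * 2 ^ k * (1 + x ^ 2) ^ k := fun x => by
    have h1 := hC x
    rw [norm_iteratedFDeriv_zero, Real.norm_eq_abs, Real.norm_eq_abs] at h1
    have h2 : 1 + |x| ≤ 2 * (1 + x ^ 2) := by
      rw [← sq_abs x]; nlinarith [sq_nonneg (|x| - 1), abs_nonneg x]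
    calc |f x| ≤ C * (1 + |x|) ^ k := h1
      _ ≤ |C| * (2 * (1 + x ^ 2)) ^ k := by gcongr; exact le_abs_self C
      _ = _ := by rw [mul_pow]; ring
  refine Integrable.mono (h (Polynomial.C (|C| * 2 ^ k) * (1 + X ^ 2) ^ k)) ?_ ?_
  · have h1 : AEStronglyMeasurable p (volume.restrict I) := by
      simpa using (h 1).aestronglyMeasurable
    exact h1.mul hf.1.continuous.aestronglyMeasurable
  · refine ae_of_all _ fun x => ?_
    rw [norm_mul, norm_mul]
    refine mul_le_mul_of_nonneg_left ?_ (norm_nonneg _)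
    simp only [eval_mul, eval_C, eval_pow, eval_add, eval_one, eval_X, Real.norm_eq_abs]
    exact (hle x).trans (le_abs_self _)

namespace DiffOp4

variable {L : DiffOp4} {I : Set ℝ} {p : ℝ → ℝ}

/-- The factor `B` of the bilinear concomitant `p B` of two functions, for the operator
`p⁻¹ ((p a₄ u'')'' + (p g u')')`. -/
def concomitant (L : DiffOp4) (g : ℝ[X]) (u v : ℝ → ℝ) (x : ℝ) : ℝ :=
  L.a₄.eval x * (iteratedDeriv 3 u x * v x - u x * iteratedDeriv 3 v x
      - (iteratedDeriv 2 u x * iteratedDeriv 1 v x - iteratedDeriv 1 u x * iteratedDeriv 2 v x))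
    + (L.a₃.eval x / 2) * (iteratedDeriv 2 u x * v x - u x * iteratedDeriv 2 v x)
    + g.eval x * (iteratedDeriv 1 u x * v x - u x * iteratedDeriv 1 v x)

/-- The hypotheses `h2` and `h1` say that g is a polynomial and that p a₁ = (p g)', so p L u = (p a₄
u'')'' + (p g u')'; this is Lagrange's identity for that symmetric form. -/
theorem IsWeight.hasDerivAt_concomitant (hw : L.IsWeight I p) (hI : IsOpen I) {g : ℝ[X]}
    (h2 : L.secondNum = 4 * L.a₄ * g)
    (h1 : L.logDerivNum * g + 2 * L.a₄ * derivative g = 2 * L.a₄ * L.a₁) {u v : ℝ → ℝ}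
    (hu : ContDiff ℝ 4 u) (hv : ContDiff ℝ 4 v) {x : ℝ} (hx : x ∈ I) (h4 : L.a₄.eval x ≠ 0) :
    HasDerivAt (fun x => p x * L.concomitant g u v x)
      (p x * L.act u x * v x - p x * u x * L.act v x) x := by
  have hd : ∀ w : ℝ → ℝ, ContDiff ℝ 4 w → ∀ k < 4,
      HasDerivAt (iteratedDeriv k w) (iteratedDeriv (k + 1) w x) x := by
    intro w hw k hk
    rw [iteratedDeriv_succ]
    exact ((hw.differentiable_iteratedDeriv k (by exact_mod_cast hk)) x).hasDerivAt
  have u0 : HasDerivAt u (iteratedDeriv 1 u x) x := by simpa using hd u hu 0 (by norm_num)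
  have v0 : HasDerivAt v (iteratedDeriv 1 v x) x := by simpa using hd v hv 0 (by norm_num)
  have u1 := hd u hu 1 (by norm_num)
  have v1 := hd v hv 1 (by norm_num)
  have u2 := hd u hu 2 (by norm_num)
  have v2 := hd v hv 2 (by norm_num)
  have u3 := hd u hu 3 (by norm_num)
  have v3 := hd v hv 3 (by norm_num)
  have key := (hw.hasDerivAt hI hx h4).mul
    ((((L.a₄.hasDerivAt x).mul (((u3.mul v0).sub (u0.mul v3)).sub ((u2.mul v1).sub (u1.mul v2)))).add
      (((L.a₃.hasDerivAt x).div_const 2).mul ((u2.mul v0).sub (u0.mul v2)))).add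
      ((g.hasDerivAt x).mul ((u1.mul v0).sub (u0.mul v1))))
  refine key.congr_deriv ?_
  have e2 := congrArg (eval x) h2
  have e1 := congrArg (eval x) h1
  have e0 : L.logDerivNum.eval x = L.a₃.eval x - 2 * (derivative L.a₄).eval x := by
    simp [logDerivNum]
  simp only [secondNum, eval_mul, eval_sub, eval_add, eval_ofNat] at e1 e2
  simp only [act, ← iteratedDeriv_one, Pi.mul_apply, Pi.sub_apply, Pi.add_apply]
  obtain ⟨h, hh⟩ : ∃ h, h = L.logDerivNum.eval x / (2 * L.a₄.eval x) := ⟨_, rfl⟩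
  rw [← hh]
  have hh' : h * (2 * L.a₄.eval x) = L.logDerivNum.eval x := by
    rw [hh]; field_simp
  refine mul_left_cancel₀ (mul_ne_zero two_ne_zero h4) ?_
  generalize iteratedDeriv 1 u x = U1, iteratedDeriv 2 u x = U2, iteratedDeriv 3 u x = U3,
    iteratedDeriv 4 u x = U4, u x = U0, iteratedDeriv 1 v x = V1, iteratedDeriv 2 v x = V2,
    iteratedDeriv 3 v x = V3, iteratedDeriv 4 v x = V4, v x = V0
  linear_combination (p x * (L.a₄.eval x * (U3 * V0 - U0 * V3 - (U2 * V1 - U1 * V2))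
    + L.a₃.eval x / 2 * (U2 * V0 - U0 * V2) + g.eval x * (U1 * V0 - U0 * V1))) * hh'
    + (p x * L.a₄.eval x * (U3 * V0 - U0 * V3 - (U2 * V1 - U1 * V2))) * e0
    - (p x * (U2 * V0 - U0 * V2) / 2) * e2 + (p x * (U1 * V0 - U0 * V1)) * e1

theorem hasTemperateGrowth_act (L : DiffOp4) {u : ℝ → ℝ} (hu : u.HasTemperateGrowth) :
    (L.act u).HasTemperateGrowth := by
  have h : L.act u = fun x => L.a₄.eval x * iteratedDeriv 4 u x + L.a₃.eval x * iteratedDeriv 3 u x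
      + L.a₂.eval x * iteratedDeriv 2 u x + L.a₁.eval x * iteratedDeriv 1 u x := by
    ext x; simp only [act, iteratedDeriv_one]
  rw [h]
  exact (((L.a₄.hasTemperateGrowth.mul (hu.iteratedDeriv 4)).add
    (L.a₃.hasTemperateGrowth.mul (hu.iteratedDeriv 3))).add
    (L.a₂.hasTemperateGrowth.mul (hu.iteratedDeriv 2))).add
    (L.a₁.hasTemperateGrowth.mul (hu.iteratedDeriv 1))

theorem hasTemperateGrowth_concomitant (L : DiffOp4) (g : ℝ[X]) {u v : ℝ → ℝ}
    (hu : u.HasTemperateGrowth) (hv : v.HasTemperateGrowth) :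
    (L.concomitant g u v).HasTemperateGrowth := by
  have d : ∀ k, _ := fun k => hu.iteratedDeriv k
  have e : ∀ k, _ := fun k => hv.iteratedDeriv k
  have h3 : Function.HasTemperateGrowth fun x : ℝ => L.a₃.eval x / 2 := by
    have := (C (1 / 2) * L.a₃).hasTemperateGrowth
    simp only [eval_mul, eval_C] at this
    convert this using 2
    ring
  exact ((L.a₄.hasTemperateGrowth.mul ((((d 3).mul hv).sub (hu.mul (e 3))).sub
    (((d 2).mul (e 1)).sub ((d 1).mul (e 2))))).add
    (h3.mul (((d 2).mul hv).sub (hu.mul (e 2))))).add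
    (g.hasTemperateGrowth.mul (((d 1).mul hv).sub (hu.mul (e 1))))

/-- The functions on which self-adjointness is tested: smooth functions of temperate growth. -/
def temperateFunctions : Set (ℝ → ℝ) := {f | Function.HasTemperateGrowth f}

theorem symmetricOn_of_integral_eq_zero (hadm : AdmissibleWeight I p)
    (h : ∀ u v : ℝ → ℝ, u.HasTemperateGrowth → v.HasTemperateGrowth →
      ∫ x in I, (p x * L.act u x * v x - p x * u x * L.act v x) = 0) :
    L.SymmetricOn temperateFunctions I p := by
  intro u hu v hv
  have i1 := hadm.integrableOn_mul ((L.hasTemperateGrowth_act hu).mul hv)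
  have i2 := hadm.integrableOn_mul (Function.HasTemperateGrowth.mul hu (L.hasTemperateGrowth_act hv))
  simp only [Pi.mul_apply, ← mul_assoc] at i1 i2
  rw [← sub_eq_zero, ← integral_sub i1 i2]
  exact h u v hu hv

section Symmetric

variable {g : ℝ[X]} (hw : L.IsWeight I p) (hI : IsOpen I) (h4 : ∀ x ∈ I, L.a₄.eval x ≠ 0)
  (hadm : AdmissibleWeight I p) (h2 : L.secondNum = 4 * L.a₄ * g)
  (h1 : L.logDerivNum * g + 2 * L.a₄ * derivative g = 2 * L.a₄ * L.a₁)
include hw hI h4 hadm h2 h1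

theorem concomitant_properties {u v : ℝ → ℝ} (hu : u.HasTemperateGrowth)
    (hv : v.HasTemperateGrowth) :
    (∀ x ∈ I, HasDerivAt (fun x => p x * L.concomitant g u v x)
      (p x * L.act u x * v x - p x * u x * L.act v x) x) ∧
    IntegrableOn (fun x => p x * L.act u x * v x - p x * u x * L.act v x) I ∧
    IntegrableOn (fun x => p x * L.concomitant g u v x) I := by
  refine ⟨fun x hx => hw.hasDerivAt_concomitant hI h2 h1 (temperate_contDiff u hu)
    (temperate_contDiff v hv) hx (h4 x hx), ?_,
    hadm.integrableOn_mul (L.hasTemperateGrowth_concomitant g hu hv)⟩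
  have i1 := hadm.integrableOn_mul ((L.hasTemperateGrowth_act hu).mul hv)
  have i2 := hadm.integrableOn_mul (Function.HasTemperateGrowth.mul hu (L.hasTemperateGrowth_act hv))
  simp only [Pi.mul_apply, ← mul_assoc] at i1 i2
  exact i1.sub i2

end Symmetric

theorem symmetricOn_univ {g : ℝ[X]} (hw : L.IsWeight univ p) (h4 : ∀ x, L.a₄.eval x ≠ 0)
    (hadm : AdmissibleWeight univ p) (h2 : L.secondNum = 4 * L.a₄ * g)
    (h1 : L.logDerivNum * g + 2 * L.a₄ * derivative g = 2 * L.a₄ * L.a₁) :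
    L.SymmetricOn temperateFunctions univ p := by
  refine symmetricOn_of_integral_eq_zero hadm fun u v hu hv => ?_
  obtain ⟨hd, i1, i2⟩ := concomitant_properties hw isOpen_univ (fun x _ => h4 x) hadm h2 h1 hu hv
  rw [setIntegral_univ]
  rw [integrableOn_univ] at i1 i2
  exact integral_eq_zero_of_hasDerivAt_of_integrable (fun x => hd x (mem_univ x)) i1 i2

/-- Near an end `e` where `p D → 0`, the concomitant tends to zero when `D` divides `a₄`, `a₃`
and `g`. -/
theorem tendsto_concomitant {g D b₄ b₃ b : ℝ[X]} (hb4 : L.a₄ = D * b₄) (hb3 : L.a₃ = D * b₃)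
    (hb : g = D * b) {u v : ℝ → ℝ} (hu : u.HasTemperateGrowth) (hv : v.HasTemperateGrowth)
    {e : ℝ} {l : Filter ℝ} (hl : l ≤ 𝓝 e) (hD : Tendsto (fun x => p x * D.eval x) l (𝓝 0)) :
    Tendsto (fun x => p x * L.concomitant g u v x) l (𝓝 0) := by
  set M : DiffOp4 := ⟨0, 0, b₃, b₄⟩
  have hM : ∀ x, p x * L.concomitant g u v x = p x * D.eval x * M.concomitant b u v x := fun x => by
    simp only [concomitant, hb4, hb3, hb, eval_mul, M]
    ring
  simp only [hM]
  have hc := (M.hasTemperateGrowth_concomitant b hu hv).1.continuous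
  simpa using hD.mul ((hc.tendsto e).mono_left hl)

theorem symmetricOn_Ioi {g D b₄ b₃ b : ℝ[X]} (hw : L.IsWeight (Ioi 0) p)
    (h4 : ∀ x ∈ Ioi (0 : ℝ), L.a₄.eval x ≠ 0)
    (hadm : AdmissibleWeight (Ioi 0) p) (h2 : L.secondNum = 4 * L.a₄ * g)
    (h1 : L.logDerivNum * g + 2 * L.a₄ * derivative g = 2 * L.a₄ * L.a₁)
    (hb4 : L.a₄ = D * b₄) (hb3 : L.a₃ = D * b₃) (hb : g = D * b)
    (hD : Tendsto (fun x => p x * D.eval x) (𝓝[>] 0) (𝓝 0)) :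
    L.SymmetricOn temperateFunctions (Ioi 0) p := by
  refine symmetricOn_of_integral_eq_zero hadm fun u v hu hv => ?_
  obtain ⟨hd, i1, i2⟩ := concomitant_properties hw isOpen_Ioi h4 hadm h2 h1 hu hv
  have ht := tendsto_concomitant hb4 hb3 hb hu hv nhdsWithin_le_nhds hD
  have hinf := tendsto_zero_of_hasDerivAt_of_integrableOn_Ioi hd i1 i2
  set W := fun x => p x * L.concomitant g u v x with hW
  -- The value of p at 0 is arbitrary, so the concomitant is redefined as 0 there to be continuous
  -- from the right.
  have hupd : ∀ x ∈ Ioi (0 : ℝ), Function.update W 0 0 =ᶠ[𝓝 x] W := fun x hx => by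
    filter_upwards [isOpen_Ioi.mem_nhds hx] with y hy
    exact Function.update_of_ne hy.out.ne' _ _
  rw [integral_Ioi_of_hasDerivAt_of_tendsto (f := Function.update W 0 0) (a := 0) (m := 0)
    (by rw [continuousWithinAt_update_same, Ici_sdiff_left]; exact ht)
    (fun x hx => (hd x hx).congr_of_eventuallyEq (hupd x hx)) i1 ?_]
  · simp
  · refine hinf.congr' ?_
    filter_upwards [eventually_gt_atTop 0] with y hy
    exact (Function.update_of_ne hy.ne' _ _).symm

theorem symmetricOn_Ioo {g D b₄ b₃ b : ℝ[X]} (hw : L.IsWeight (Ioo (-1) 1) p)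
    (h4 : ∀ x ∈ Ioo (-1 : ℝ) 1, L.a₄.eval x ≠ 0)
    (hadm : AdmissibleWeight (Ioo (-1) 1) p) (h2 : L.secondNum = 4 * L.a₄ * g)
    (h1 : L.logDerivNum * g + 2 * L.a₄ * derivative g = 2 * L.a₄ * L.a₁)
    (hb4 : L.a₄ = D * b₄) (hb3 : L.a₃ = D * b₃) (hb : g = D * b)
    (hDl : Tendsto (fun x => p x * D.eval x) (𝓝[>] (-1)) (𝓝 0))
    (hDr : Tendsto (fun x => p x * D.eval x) (𝓝[<] 1) (𝓝 0)) :
    L.SymmetricOn temperateFunctions (Ioo (-1) 1) p := by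
  refine symmetricOn_of_integral_eq_zero hadm fun u v hu hv => ?_
  obtain ⟨hd, i1, i2⟩ := concomitant_properties hw isOpen_Ioo h4 hadm h2 h1 hu hv
  have hl := tendsto_concomitant hb4 hb3 hb hu hv nhdsWithin_le_nhds hDl
  have hr := tendsto_concomitant hb4 hb3 hb hu hv nhdsWithin_le_nhds hDr
  have hlt : (-1 : ℝ) < 1 := by norm_num
  rw [← integral_Ioc_eq_integral_Ioo, ← intervalIntegral.integral_of_le hlt.le,
    intervalIntegral.integral_eq_sub_of_hasDerivAt_of_tendsto hlt hd
    ((intervalIntegrable_iff_integrableOn_Ioo_of_le hlt.le).2 i1) hl hr, sub_zero]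

end DiffOp4

open DiffOp4

theorem AdmissibleWeight.of_monomial {I : Set ℝ} {p : ℝ → ℝ}
    (h : ∀ n : ℕ, IntegrableOn (fun x => p x * x ^ n) I) : AdmissibleWeight I p := by
  intro q
  induction q using Polynomial.induction_on' with
  | add q r hq hr =>
    refine (hq.add hr).congr (ae_of_all _ fun x => ?_)
    simp [mul_add]
  | monomial n a =>
    refine ((h n).const_mul a).congr (ae_of_all _ fun x => ?_)
    simp only [eval_monomial]
    ring

/-! ### The Hermite family -/

theorem admissible_hermite {m₁ m₂ : ℝ} (hm : m₂ ≠ 0) :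
    AdmissibleWeight univ fun x => Real.exp (-m₂ ^ 2 * x ^ 2 + m₁ * x) := by
  refine AdmissibleWeight.of_monomial fun n => ?_
  rw [integrableOn_univ]
  -- Half of the Gaussian absorbs the linear term: m₁x ≤ m₂²x²/2 + m₁²/(2m₂²), by completing the
  -- square.
  have hb : 0 < m₂ ^ 2 / 2 := by positivity
  have h1 := (integrable_rpow_mul_exp_neg_mul_sq hb (s := n)
    (by linarith [(n.cast_nonneg : (0 : ℝ) ≤ n)])).const_mul (Real.exp (m₁ ^ 2 / (2 * m₂ ^ 2)))
  refine h1.mono (by fun_prop) (ae_of_all _ fun x => ?_)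
  rw [Real.rpow_natCast, mul_left_comm, norm_mul, norm_mul, mul_comm]
  refine mul_le_mul_of_nonneg_left ?_ (norm_nonneg _)
  rw [← Real.exp_add, Real.norm_eq_abs, Real.norm_eq_abs, Real.abs_exp, Real.abs_exp,
    Real.exp_le_exp]
  have h2 : m₁ ^ 2 / (2 * m₂ ^ 2) + -(m₂ ^ 2 / 2) * x ^ 2 - (-m₂ ^ 2 * x ^ 2 + m₁ * x)
      = (m₂ ^ 2 * x - m₁) ^ 2 / (2 * m₂ ^ 2) := by
    field_simp
    ring
  have h3 : 0 ≤ (m₂ ^ 2 * x - m₁) ^ 2 / (2 * m₂ ^ 2) := by positivity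
  linarith

theorem selfAdjointWith_hermite {m₁ m₂ : ℝ} (A : ℝ) (hm : m₂ ≠ 0) :
    (hermiteOp m₁ m₂ A).SelfAdjointWith temperateFunctions univ
      fun x => Real.exp (-m₂ ^ 2 * x ^ 2 + m₁ * x) where
  order_four := by
    refine ⟨by simp [hermiteOp], ?_, ?_, ?_, ?_⟩ <;> simp only [hermiteOp] <;>
      compute_degree!
  isOpen := isOpen_univ
  ordConnected := ordConnected_univ
  nonempty := univ_nonempty
  weight := weight_hermite
  admissible := admissible_hermite hm
  symmetric := by
    refine symmetricOn_univ (g := C (A - m₁ ^ 2 + 2 * m₂ ^ 2)) weight_hermite (by simp [hermiteOp])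
      (admissible_hermite hm) ?_ ?_ <;> refine Polynomial.funext fun x => ?_
    · simp [hermiteOp, secondNum, logDerivNum, derivative_pow]
      ring
    · simp [hermiteOp, logDerivNum, derivative_pow]
      ring
where
  weight_hermite : (hermiteOp m₁ m₂ A).IsWeight univ
      fun x => Real.exp (-m₂ ^ 2 * x ^ 2 + m₁ * x) := by
    refine ⟨fun x => 2 * (m₁ * x) - 2 * m₂ ^ 2 * x ^ 2, fun x _ _ => ⟨?_, ?_⟩⟩
    · have h1 := (((hasDerivAt_id x).const_mul m₁).const_mul 2).sub
        ((hasDerivAt_pow 2 x).const_mul (2 * m₂ ^ 2))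
      refine h1.congr_deriv ?_
      simp [hermiteOp]
      ring
    · simp [hermiteOp]
      ring

/-! ### The Laguerre family -/

theorem weight_laguerre (a b A : ℝ) : (laguerreOp a b A).IsWeight (Ioi 0)
    fun y => |y| ^ (a / 2 - 2) * Real.exp (b / 2 * y) := by
  refine ⟨fun x => a * Real.log x + b * x, fun y hy _ => ?_⟩
  have hy0 : 0 < y := hy
  constructor
  · have h1 := ((Real.hasDerivAt_log hy0.ne').const_mul a).add ((hasDerivAt_id y).const_mul b)
    refine h1.congr_deriv ?_
    simp [laguerreOp]
    field_simp
  · simp only [laguerreOp, eval_pow, eval_X]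
    rw [abs_of_pos hy0, abs_of_pos (pow_pos hy0 2), Real.rpow_sub hy0,
      Real.rpow_def_of_pos hy0, show (y : ℝ) ^ (2 : ℝ) = y ^ 2 from Real.rpow_natCast y 2,
      div_mul_eq_mul_div, ← Real.exp_add]
    congr 2
    ring

theorem admissible_laguerre {a b : ℝ} (ha : 2 < a) (hb : b < 0) : AdmissibleWeight (Ioi 0)
    fun y => |y| ^ (a / 2 - 2) * Real.exp (b / 2 * y) := by
  refine AdmissibleWeight.of_monomial fun n => ?_
  have h1 := integrableOn_rpow_mul_exp_neg_mul_rpow (p := 1) (s := a / 2 - 2 + n) (b := -b / 2)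
    (by linarith [(n.cast_nonneg : (0 : ℝ) ≤ n)]) one_pos (by linarith)
  refine h1.congr_fun (fun x hx => ?_) measurableSet_Ioi
  have hx0 : 0 < x := hx
  beta_reduce
  rw [abs_of_pos hx0, Real.rpow_one, Real.rpow_add hx0, Real.rpow_natCast,
    show -(-b / 2) * x = b / 2 * x by ring]
  ring

theorem selfAdjointWith_laguerre {a b : ℝ} (A : ℝ) (ha : 2 < a) (hb : b < 0) :
    (laguerreOp a b A).SelfAdjointWith temperateFunctions (Ioi 0)
      fun y => |y| ^ (a / 2 - 2) * Real.exp (b / 2 * y) where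
  order_four := by
    refine ⟨by simp [laguerreOp], ?_, ?_, ?_, ?_⟩ <;> simp only [laguerreOp] <;>
      compute_degree!
  isOpen := isOpen_Ioi
  ordConnected := ordConnected_Ioi
  nonempty := nonempty_Ioi
  weight := weight_laguerre a b A
  admissible := admissible_laguerre ha hb
  symmetric := by
    refine symmetricOn_Ioi (g := X * C (A - a * b / 2)) (D := X) (b₄ := X) (b₃ := C a + C b * X)
      (b := C (A - a * b / 2)) (weight_laguerre a b A)
      (fun x hx => by simpa [laguerreOp] using hx.out.ne') (admissible_laguerre ha hb) ?_ ?_ ?_ ?_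
      rfl ?_
    · refine Polynomial.funext fun x => ?_
      simp [laguerreOp, secondNum, logDerivNum]
      ring
    · refine Polynomial.funext fun x => ?_
      simp [laguerreOp, logDerivNum]
      ring
    · simp [laguerreOp, pow_two]
    · simp [laguerreOp]
    -- This is where a > 2 enters: p x behaves like x^(a/2 - 1) and tends to 0.
    · have hs : 0 < a / 2 - 1 := by linarith
      have h1 : ContinuousAt (fun x : ℝ => x ^ (a / 2 - 1) * Real.exp (b / 2 * x)) 0 :=
        (Real.continuousAt_rpow_const 0 _ (Or.inr hs.le)).mul (by fun_prop)
      have h2 := h1.tendsto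
      rw [Real.zero_rpow hs.ne', zero_mul] at h2
      refine (h2.mono_left nhdsWithin_le_nhds).congr' ?_
      filter_upwards [self_mem_nhdsWithin] with x hx
      have hx0 : 0 < x := hx
      rw [abs_of_pos hx0, eval_X, show a / 2 - 1 = a / 2 - 2 + 1 by ring, Real.rpow_add hx0,
        Real.rpow_one]
      ring

/-! ### The Jacobi family -/

/-- The Jacobi weight. -/
def jacobiWeight (a b : ℝ) (y : ℝ) : ℝ :=
  (1 - y) ^ ((-2 - a - b) / 2) * (1 + y) ^ ((-2 - a + b) / 2)

theorem weight_jacobi (a b g : ℝ) :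
    (jacobiForm a b g).IsWeight (Ioo (-1) 1) (jacobiWeight a b) := by
  refine ⟨fun x => -(b + a - 2) * Real.log (1 - x) + (b - a + 2) * Real.log (1 + x),
    fun y hy _ => ?_⟩
  have h1 : 0 < 1 - y := by linarith [hy.2]
  have h2 : 0 < 1 + y := by linarith [hy.1]
  constructor
  · have d1 := (((hasDerivAt_id y).const_sub 1).log h1.ne').const_mul (-(b + a - 2))
    have d2 := (((hasDerivAt_id y).const_add 1).log h2.ne').const_mul (b - a + 2)
    refine (d1.add d2).congr_deriv ?_
    have h3 : 1 - y ^ 2 = (1 - y) * (1 + y) := by ring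
    simp only [jacobiForm, eval_pow, eval_sub, eval_one, eval_X, eval_mul, eval_C, eval_add, h3, id]
    field_simp
    ring
  · have h3 : (1 - y ^ 2) ^ 2 = (1 - y) ^ (2 : ℝ) * (1 + y) ^ (2 : ℝ) := by
      rw [Real.rpow_two, Real.rpow_two]; ring
    have h5 : |(1 - y ^ 2) ^ 2| = (1 - y ^ 2) ^ 2 := abs_of_nonneg (sq_nonneg _)
    simp only [jacobiForm, jacobiWeight, eval_pow, eval_sub, eval_one, eval_X]
    rw [h5, h3, Real.rpow_def_of_pos h1, Real.rpow_def_of_pos h2, Real.rpow_def_of_pos h1,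
      Real.rpow_def_of_pos h2, ← Real.exp_add, ← Real.exp_add, ← Real.exp_sub]
    congr 1
    ring

/-- Model of the Jacobi weight near one end; a translation or a reflection brings either half of
(-1, 1) to this form. -/
theorem integrableOn_rpow_mul_rpow {P Q : ℝ} (hQ : -1 < Q) :
    IntegrableOn (fun x : ℝ => (2 - x) ^ P * x ^ Q) (Icc 0 1) := by
  have h1 : IntegrableOn (fun x : ℝ => x ^ Q) (Icc 0 1) :=
    (integrableOn_Icc_iff_integrableOn_Ioo (by finiteness) (by finiteness)).2
      ((intervalIntegral.integrableOn_Ioo_rpow_iff one_pos).2 hQ)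
  exact h1.continuousOn_mul (ContinuousOn.rpow_const (by fun_prop) fun x hx =>
    Or.inl (by linarith [hx.2])) isCompact_Icc

theorem admissible_jacobi {a b : ℝ} (h1 : 0 < b - a) (h2 : b + a < 0) :
    AdmissibleWeight (Ioo (-1) 1) (jacobiWeight a b) := by
  have hl : IntegrableOn (jacobiWeight a b) (Ioo (-1) 0) := by
    have h := integrableOn_affine isOpen_Ioo one_ne_zero 1 ((integrableOn_rpow_mul_rpow
      (P := (-2 - a - b) / 2) (Q := (-2 - a + b) / 2) (by linarith)).mono_set
        (Ioo_subset_Icc_self))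
    have hI : {y : ℝ | 1 * y + 1 ∈ Ioo (0 : ℝ) 1} = Ioo (-1) 0 := by
      ext y; simp only [mem_ofPred_eq, mem_Ioo]
      constructor <;> rintro ⟨h1, h2⟩ <;> constructor <;> linarith
    rw [hI] at h
    refine h.congr_fun (fun x _ => ?_) measurableSet_Ioo
    simp only [jacobiWeight]
    ring_nf
  have hr : IntegrableOn (jacobiWeight a b) (Ioo 0 1) := by
    have h := integrableOn_affine isOpen_Ioo (neg_ne_zero.2 one_ne_zero) 1
      ((integrableOn_rpow_mul_rpow (P := (-2 - a + b) / 2) (Q := (-2 - a - b) / 2)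
        (by linarith)).mono_set (Ioo_subset_Icc_self))
    have hI : {y : ℝ | -1 * y + 1 ∈ Ioo (0 : ℝ) 1} = Ioo 0 1 := by
      ext y; simp only [mem_ofPred_eq, mem_Ioo]
      constructor <;> rintro ⟨h1, h2⟩ <;> constructor <;> linarith
    rw [hI] at h
    refine h.congr_fun (fun x _ => ?_) measurableSet_Ioo
    simp only [jacobiWeight]
    ring_nf
  have hint : IntegrableOn (jacobiWeight a b) (Icc (-1) 1) := by
    rw [← Icc_union_Icc_eq_Icc (b := (0 : ℝ)) (by norm_num) (by norm_num)]
    exact ((integrableOn_Icc_iff_integrableOn_Ioo (by finiteness) (by finiteness)).2 hl).union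
      ((integrableOn_Icc_iff_integrableOn_Ioo (by finiteness) (by finiteness)).2 hr)
  exact fun q => (hint.mul_continuousOn q.continuous.continuousOn isCompact_Icc).mono_set
    Ioo_subset_Icc_self

theorem selfAdjointWith_jacobi {a b : ℝ} (g : ℝ) (h1 : 0 < b - a) (h2 : b + a < 0) :
    (jacobiForm a b g).SelfAdjointWith temperateFunctions (Ioo (-1) 1) (jacobiWeight a b) where
  order_four := by
    refine ⟨?_, ?_, ?_, ?_, ?_⟩
    · intro h
      have := congrArg (eval 0) h
      simp [jacobiForm] at this
    all_goals
      simp only [jacobiForm]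
      compute_degree
  isOpen := isOpen_Ioo
  ordConnected := ordConnected_Ioo
  nonempty := nonempty_Ioo.2 (by norm_num)
  weight := weight_jacobi a b g
  admissible := admissible_jacobi h1 h2
  symmetric := by
    -- This is p(1 - x²); the conditions on a and b make both exponents positive, so it extends
    -- continuously by 0 to both ends.
    have hc : Continuous fun y : ℝ => (1 - y) ^ ((-a - b) / 2) * (1 + y) ^ ((-a + b) / 2) := by
      refine Continuous.mul ?_ ?_
      · exact (continuous_const.sub continuous_id).rpow_const fun x => Or.inr (by linarith)
      · exact (continuous_const.add continuous_id).rpow_const fun x => Or.inr (by linarith)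
    have he : ∀ y ∈ Ioo (-1 : ℝ) 1, (1 - y) ^ ((-a - b) / 2) * (1 + y) ^ ((-a + b) / 2) =
        jacobiWeight a b y * (1 - X ^ 2 : ℝ[X]).eval y := fun y hy => by
      have h3 : 0 < 1 - y := by linarith [hy.2]
      have h4 : 0 < 1 + y := by linarith [hy.1]
      rw [jacobiWeight, show (-a - b) / 2 = (-2 - a - b) / 2 + 1 by ring,
        show (-a + b) / 2 = (-2 - a + b) / 2 + 1 by ring, Real.rpow_add_one h3.ne',
        Real.rpow_add_one h4.ne']
      simp only [eval_sub, eval_one, eval_pow, eval_X]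
      ring
    refine symmetricOn_Ioo (g := (1 - X ^ 2) * C g) (D := 1 - X ^ 2) (b₄ := 1 - X ^ 2)
      (b₃ := C 2 * (C b + C (a - 2) * X)) (b := C g) (weight_jacobi a b g)
      (fun x hx => ?_) (admissible_jacobi h1 h2) ?_ ?_ ?_ ?_ rfl ?_ ?_
    · have h3 : 1 - x ^ 2 = (1 - x) * (1 + x) := by ring
      have h4 : 0 < 1 - x := by linarith [hx.2]
      have h5 : 0 < 1 + x := by linarith [hx.1]
      simp only [jacobiForm, eval_pow, eval_sub, eval_one, eval_X, h3]
      positivity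
    · refine Polynomial.funext fun x => ?_
      simp [jacobiForm, secondNum, logDerivNum, derivative_pow]
      ring
    · refine Polynomial.funext fun x => ?_
      simp [jacobiForm, logDerivNum, derivative_pow]
      ring
    · simp only [jacobiForm]; ring
    · simp only [jacobiForm]; ring
    · have := hc.tendsto (-1)
      simp only [add_neg_cancel, Real.zero_rpow (show (-a + b) / 2 ≠ 0 by linarith), mul_zero]
        at this
      refine (this.mono_left nhdsWithin_le_nhds).congr' ?_
      filter_upwards [Ioo_mem_nhdsGT (show (-1 : ℝ) < 1 by norm_num)] with y hy
      exact he y hy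
    · have := hc.tendsto 1
      simp only [sub_self, Real.zero_rpow (show (-a - b) / 2 ≠ 0 by linarith), zero_mul]
        at this
      refine (this.mono_left nhdsWithin_le_nhds).congr' ?_
      filter_upwards [Ioo_mem_nhdsLT (show (-1 : ℝ) < 1 by norm_num)] with y hy
      exact he y hy

/-! ### Types of interval, eigenvalues and normal forms -/

namespace DiffOp4

variable {L : DiffOp4} {I : Set ℝ} {p : ℝ → ℝ}

theorem polyFunctions_subset_temperateFunctions : polyFunctions ⊆ temperateFunctions := by
  rintro _ ⟨q, rfl⟩
  exact q.hasTemperateGrowth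

theorem SelfAdjointWith.interval_cases {𝒟 : Set (ℝ → ℝ)} (H : L.SelfAdjointWith 𝒟 I p) :
    I = univ ∨ (∃ e, I = Ioi e) ∨ (∃ e, I = Iio e) ∨ ∃ d e, d < e ∧ I = Ioo d e := by
  have hs : IsConnected I := ⟨H.nonempty, H.ordConnected.isPreconnected⟩
  have low : BddBelow I → I ⊆ Ioi (sInf I) := fun hb => by
    rw [← interior_Ici]
    exact interior_maximal (fun x hx => csInf_le hb hx) H.isOpen
  have up : BddAbove I → I ⊆ Iio (sSup I) := fun ha => by
    rw [← interior_Iic]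
    exact interior_maximal (fun x hx => le_csSup ha hx) H.isOpen
  by_cases hb : BddBelow I <;> by_cases ha : BddAbove I
  · obtain ⟨x, hx⟩ := H.nonempty
    exact Or.inr (Or.inr (Or.inr ⟨sInf I, sSup I, (low hb hx).trans (up ha hx),
      subset_antisymm (fun y hy => ⟨low hb hy, up ha hy⟩) (hs.Ioo_csInf_csSup_subset hb ha)⟩))
  · exact Or.inr (Or.inl ⟨_, subset_antisymm (low hb) (hs.2.Ioi_csInf_subset hb ha)⟩)
  · exact Or.inr (Or.inr (Or.inl ⟨_, subset_antisymm (up ha) (hs.2.Iio_csSup_subset hb ha)⟩))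
  · exact Or.inl (hs.2.eq_univ_of_unbounded hb ha)

end DiffOp4

theorem coeff_two_quadratic (c₀ c₁ c₂ : ℝ) :
    (C c₀ + C c₁ * X + C c₂ * X ^ 2 : ℝ[X]).coeff 2 = c₂ := by
  simp

theorem coeff_one_linear (c₀ c₁ : ℝ) : (C c₀ + C c₁ * X : ℝ[X]).coeff 1 = c₁ := by
  simp [coeff_C]

theorem coeff_three_cubic (c₀ c₁ c₂ c₃ : ℝ) :
    (C c₀ + C c₁ * X + C c₂ * X ^ 2 + C c₃ * X ^ 3 : ℝ[X]).coeff 3 = c₃ := by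
  simp [coeff_X_pow]

theorem hasEigenvalues_hermite (m₁ m₂ A : ℝ) (hm : m₂ ≠ 0) :
    (hermiteOp m₁ m₂ A).HasEigenvalues
      (fun n => 2 * m₂ ^ 2 * (m₁ ^ 2 - A + 2 * m₂ ^ 2 * ((n : ℝ) - 2)) * n) := by
  have h := ((selfAdjointWith_hermite (m₁ := m₁) A hm).mono
    polyFunctions_subset_temperateFunctions).hasEigenvalues
  convert h using 1
  ext n
  have e4 : (hermiteOp m₁ m₂ A).a₄.coeff 4 = 0 := by simp [hermiteOp, coeff_one]
  have e3 : (hermiteOp m₁ m₂ A).a₃.coeff 3 = 0 := by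
    have h : (hermiteOp m₁ m₂ A).a₃ = C (2 * m₁) + C (-(4 * m₂ ^ 2)) * X + C (0) * X ^ 2 + C (0) * X ^ 3 :=
      Polynomial.funext fun x => by simp [hermiteOp]; ring
    rw [h, coeff_three_cubic]
  have e2 : (hermiteOp m₁ m₂ A).a₂.coeff 2 = 4 * m₂ ^ 4 := by
    have h : (hermiteOp m₁ m₂ A).a₂ = C (A) + C (-(4 * m₁ * m₂ ^ 2)) * X + C (4 * m₂ ^ 4) * X ^ 2 :=
      Polynomial.funext fun x => by simp [hermiteOp]; ring
    rw [h, coeff_two_quadratic]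
  have e1 : (hermiteOp m₁ m₂ A).a₁.coeff 1 = (-m₁ ^ 2 + 2 * m₂ ^ 2 + A) * (-(2 * m₂ ^ 2)) := by
    have h : (hermiteOp m₁ m₂ A).a₁ = C ((-m₁ ^ 2 + 2 * m₂ ^ 2 + A) * m₁) + C ((-m₁ ^ 2 + 2 * m₂ ^ 2 + A) * (-(2 * m₂ ^ 2))) * X :=
      Polynomial.funext fun x => by simp [hermiteOp]; ring
    rw [h, coeff_one_linear]
  rw [diagonal_eq, e1, e2, e3, e4]
  ring

theorem hasEigenvalues_laguerre (a b A : ℝ) (ha : 2 < a) (hb : b < 0) :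
    (laguerreOp a b A).HasEigenvalues
      (fun n => b / 4 * n * (2 * A - a * b - b + b * n)) := by
  have h := ((selfAdjointWith_laguerre A ha hb).mono
    polyFunctions_subset_temperateFunctions).hasEigenvalues
  convert h using 1
  ext n
  have e4 : (laguerreOp a b A).a₄.coeff 4 = 0 := by simp [laguerreOp, coeff_X_pow]
  have e3 : (laguerreOp a b A).a₃.coeff 3 = 0 := by
    have h : (laguerreOp a b A).a₃ = C (0) + C (a) * X + C (b) * X ^ 2 + C (0) * X ^ 3 :=
      Polynomial.funext fun x => by simp [laguerreOp]; ring
    rw [h, coeff_three_cubic]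
  have e2 : (laguerreOp a b A).a₂.coeff 2 = b ^ 2 / 4 := by
    have h : (laguerreOp a b A).a₂ = C ((-2 * a + a ^ 2) / 4) + C (A) * X + C (b ^ 2 / 4) * X ^ 2 :=
      Polynomial.funext fun x => by simp [laguerreOp]; ring
    rw [h, coeff_two_quadratic]
  have e1 : (laguerreOp a b A).a₁.coeff 1 = (2 * A - a * b) / 4 * b := by
    have h : (laguerreOp a b A).a₁ = C ((2 * A - a * b) / 4 * (-2 + a)) + C ((2 * A - a * b) / 4 * b) * X :=
      Polynomial.funext fun x => by simp [laguerreOp]; ring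
    rw [h, coeff_one_linear]
  rw [diagonal_eq, e1, e2, e3, e4]
  ring

theorem hasEigenvalues_jacobiForm (a b g : ℝ) (h1 : 0 < b - a) (h2 : b + a < 0) :
    (jacobiForm a b g).HasEigenvalues
      (fun n => (a - n + 1) * n * (-(n : ℝ) ^ 2 + a * n + n - a + g)) := by
  have h := ((selfAdjointWith_jacobi g h1 h2).mono
    polyFunctions_subset_temperateFunctions).hasEigenvalues
  convert h using 1
  ext n
  have e4 : (jacobiForm a b g).a₄.coeff 4 = 1 := by
    have : (jacobiForm a b g).a₄ = 1 - C 2 * X ^ 2 + X ^ 4 := by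
      simp only [jacobiForm, map_ofNat]; ring
    rw [this]; simp [coeff_X_pow, coeff_one]
  have e3 : (jacobiForm a b g).a₃.coeff 3 = -(2 * (a - 2)) := by
    have h : (jacobiForm a b g).a₃ = C (2 * b) + C (2 * (a - 2)) * X + C (-(2 * b)) * X ^ 2 + C (-(2 * (a - 2))) * X ^ 3 :=
      Polynomial.funext fun x => by simp [jacobiForm]; ring
    rw [h, coeff_three_cubic]
  have e2 : (jacobiForm a b g).a₂.coeff 2 = a ^ 2 - 3 * a + 2 - g := by
    have h : (jacobiForm a b g).a₂ = C (a - 2 + b ^ 2 + g) + C (2 * (a - 1) * b) * X + C (a ^ 2 - 3 * a + 2 - g) * X ^ 2 :=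
      Polynomial.funext fun x => by simp [jacobiForm]; ring
    rw [h, coeff_two_quadratic]
  have e1 : (jacobiForm a b g).a₁.coeff 1 = g * a := by
    simp [jacobiForm, coeff_C]
  rw [diagonal_eq, e1, e2, e3, e4]
  ring

namespace DiffOp4

/-- The three normal forms of a self-adjoint operator. -/
theorem SelfAdjointWith.normal_form {L : DiffOp4} {I : Set ℝ} {p : ℝ → ℝ}
    (H : L.SelfAdjointWith polyFunctions I p) :
    (∃ κ m₀ m₁ m₂ A : ℝ, κ ≠ 0 ∧ m₂ ≠ 0 ∧ L.scale κ = hermiteOp m₁ m₂ A ∧ I = univ ∧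
      ∀ x, p x = Real.exp (-m₂ ^ 2 * x ^ 2 + m₁ * x + m₀)) ∨
    (∃ κ r s c a b A : ℝ, κ ≠ 0 ∧ r ≠ 0 ∧ 0 < c ∧ 2 < a ∧ b < 0 ∧
      (L.affine r s).scale κ = laguerreOp a b A ∧ {y : ℝ | r * y + s ∈ I} = Ioi 0 ∧
      ∀ y ∈ Ioi (0 : ℝ), p (r * y + s) = c * (|y| ^ (a / 2 - 2) * Real.exp (b / 2 * y))) ∨
    (∃ κ r s c a b g : ℝ, κ ≠ 0 ∧ r ≠ 0 ∧ 0 < c ∧ 0 < b - a ∧ b + a < 0 ∧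
      (L.affine r s).scale κ = jacobiForm a b g ∧ {y : ℝ | r * y + s ∈ I} = Ioo (-1) 1 ∧
      ∀ y ∈ Ioo (-1 : ℝ) 1, p (r * y + s) = c * jacobiWeight a b y) := by
  have aff : ∀ r s : ℝ, r ≠ 0 → ((L.affine r s).scale 1).SelfAdjointWith polyFunctions
      {y | r * y + s ∈ I} (fun y => 1 * p (r * y + s)) := fun r s hr =>
    H.affine_scale polyFunctions_contDiff polyFunctions_affine hr one_ne_zero one_pos s
  have half : ∀ r s : ℝ, r ≠ 0 → {y : ℝ | r * y + s ∈ I} = Ioi 0 → ∃ κ r s c a b A : ℝ,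
      κ ≠ 0 ∧ r ≠ 0 ∧ 0 < c ∧ 2 < a ∧ b < 0 ∧
      (L.affine r s).scale κ = laguerreOp a b A ∧ {y : ℝ | r * y + s ∈ I} = Ioi 0 ∧
      ∀ y ∈ Ioi (0 : ℝ), p (r * y + s) = c * (|y| ^ (a / 2 - 2) * Real.exp (b / 2 * y)) := by
    intro r s hr hI
    have h := aff r s hr
    rw [hI, scale_one] at h
    obtain ⟨κ, c, a, b, A, hκ, hc, ha, hb, e, hp⟩ := h.exists_laguerre
    exact ⟨κ, r, s, c, a, b, A, hκ, hr, hc, ha, hb, e, hI, fun y hy => by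
      simpa only [one_mul] using hp y hy⟩
  rcases H.interval_cases with rfl | ⟨e, rfl⟩ | ⟨e, rfl⟩ | ⟨d, e, hde, rfl⟩
  · obtain ⟨κ, m₀, m₁, m₂, A, hκ, hm, e, hp⟩ := H.exists_hermite
    exact Or.inl ⟨κ, m₀, m₁, m₂, A, hκ, hm, e, rfl, hp⟩
  · refine Or.inr (Or.inl (half 1 e one_ne_zero ?_))
    ext y; simp
  · refine Or.inr (Or.inl (half (-1) e (neg_ne_zero.2 one_ne_zero) ?_))
    ext y; simp
  · have hr : (e - d) / 2 ≠ 0 := by linarith [sub_pos.2 hde]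
    have hI : {y : ℝ | (e - d) / 2 * y + (e + d) / 2 ∈ Ioo d e} = Ioo (-1) 1 := by
      ext y
      simp only [mem_ofPred_eq, mem_Ioo]
      constructor <;> rintro ⟨h1, h2⟩ <;> constructor <;> nlinarith
    have h := aff _ ((e + d) / 2) hr
    rw [hI, scale_one] at h
    obtain ⟨κ, c, a, b, g, hκ, hc, h1, h2, e, hp⟩ := h.exists_jacobiForm
    exact Or.inr (Or.inr ⟨κ, _, _, c, a, b, g, hκ, hr, hc, h1, h2, e, hI, fun y hy => by
      simpa only [one_mul, jacobiWeight] using hp y hy⟩)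

/-- The zeros of `a₄` in the new variable. -/
theorem eval_a₄_eq_zero_iff {L M : DiffOp4} {κ r s : ℝ} (hκ : κ ≠ 0) (hr : r ≠ 0)
    (h : (L.affine r s).scale κ = M) (x : ℝ) :
    L.a₄.eval x = 0 ↔ M.a₄.eval ((x - s) / r) = 0 := by
  have hx : r * ((x - s) / r) + s = x := by field_simp; ring
  rw [← h]
  simp [scale, affine, eval_comp, hx, hκ, hr]

end DiffOp4

end

/-! ### The classification -/

theorem mainTheorem8 :
    -- the classification, for any space `𝒟` of smooth functions of temperate growth that contains
    -- the polynomials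
    (∀ (𝒟 : Set (ℝ → ℝ)), (∀ q : ℝ[X], (fun x => q.eval x) ∈ 𝒟) →
      (∀ f ∈ 𝒟, Function.HasTemperateGrowth f) →
      ∀ (L : DiffOp4) (I : Set ℝ) (p : ℝ → ℝ),
      -- no real root
      ((∀ x, L.a₄.eval x ≠ 0) →
        (L.SelfAdjointWith 𝒟 I p ↔
          ∃ κ m₀ m₁ m₂ A : ℝ, κ ≠ 0 ∧ m₂ ≠ 0 ∧
            L.scale κ = hermiteOp m₁ m₂ A ∧ I = univ ∧
            ∀ x, p x = Real.exp (-m₂ ^ 2 * x ^ 2 + m₁ * x + m₀))) ∧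
      -- exactly one real root
      ((∃! x, L.a₄.eval x = 0) →
        (L.SelfAdjointWith 𝒟 I p ↔
          ∃ κ r s c a b A : ℝ, κ ≠ 0 ∧ r ≠ 0 ∧ 0 < c ∧ 2 < a ∧ b < 0 ∧
            (L.affine r s).scale κ = laguerreOp a b A ∧
            {y : ℝ | r * y + s ∈ I} = Ioi 0 ∧
            ∀ y ∈ Ioi (0 : ℝ),
              p (r * y + s) = c * (|y| ^ (a / 2 - 2) * Real.exp (b / 2 * y)))) ∧
      -- more than one real root
      ((∃ x x', x ≠ x' ∧ L.a₄.eval x = 0 ∧ L.a₄.eval x' = 0) →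
        (L.SelfAdjointWith 𝒟 I p ↔
          ∃ κ r s c : ℝ, κ ≠ 0 ∧ r ≠ 0 ∧ 0 < c ∧
            {y : ℝ | r * y + s ∈ I} = Ioo (-1) 1 ∧
            ((∃ a A : ℝ, a < 0 ∧ (L.affine r s).scale κ = gegenbauerOp a A ∧
                ∀ y ∈ Ioo (-1 : ℝ) 1, p (r * y + s) = c * (1 - y ^ 2) ^ (-1 - a / 2)) ∨
              (∃ a b B : ℝ, b ≠ 0 ∧ 0 < b - a ∧ b + a < 0 ∧
                (L.affine r s).scale κ = jacobiOp a b B ∧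
                ∀ y ∈ Ioo (-1 : ℝ) 1, p (r * y + s) =
                  c * ((1 - y) ^ ((-2 - a - b) / 2) * (1 + y) ^ ((-2 - a + b) / 2))))))) ∧
    -- the eigenvalues
    (∀ m₁ m₂ A : ℝ, m₂ ≠ 0 → (hermiteOp m₁ m₂ A).HasEigenvalues
      (fun n => 2 * m₂ ^ 2 * (m₁ ^ 2 - A + 2 * m₂ ^ 2 * ((n : ℝ) - 2)) * n)) ∧
    (∀ a b A : ℝ, 2 < a → b < 0 → (laguerreOp a b A).HasEigenvalues
      (fun n => b / 4 * n * (2 * A - a * b - b + b * n))) ∧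
    (∀ a A : ℝ, a < 0 → (gegenbauerOp a A).HasEigenvalues
      (fun n => n * (-a + n - 1) * (-a ^ 2 - n * a + 4 * a + (n : ℝ) ^ 2 + A - n - 2))) ∧
    (∀ a b B : ℝ, b ≠ 0 → 0 < b - a → b + a < 0 → (jacobiOp a b B).HasEigenvalues
      (fun n => (a - n + 1) * n * (-b * (n : ℝ) ^ 2 + a * b * n + b * n - a * b + B) / b)) := by
  refine ⟨fun 𝒟 hpoly htemp L I p => ?_, hasEigenvalues_hermite, hasEigenvalues_laguerre,
    fun a A ha => ?_, fun a b B hb h1 h2 => ?_⟩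
  -- `𝒟` lies between the polynomials and the functions of temperate growth; necessity needs only
  -- the former, and sufficiency holds for the latter.
  · have down : L.SelfAdjointWith 𝒟 I p → L.SelfAdjointWith DiffOp4.polyFunctions I p := fun H =>
      H.mono (by rintro _ ⟨q, rfl⟩; exact hpoly q)
    have up : L.SelfAdjointWith DiffOp4.temperateFunctions I p → L.SelfAdjointWith 𝒟 I p := fun H =>
      H.mono htemp
    have hwt : ∀ y ∈ Ioo (-1 : ℝ) 1, ∀ a : ℝ, (1 - y ^ 2) ^ (-1 - a / 2) = jacobiWeight a 0 y := by
      intro y hy a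
      rw [jacobiWeight, show (-2 - a - 0) / 2 = -1 - a / 2 by ring,
        show (-2 - a + 0) / 2 = -1 - a / 2 by ring,
        ← Real.mul_rpow (by linarith [hy.2]) (by linarith [hy.1])]
      congr 1
      ring
    -- The number of real roots of `a₄` is invariant under affine changes and scaling: two or more
    -- in the Jacobi form, one in the Laguerre form, none in the Hermite form. So it selects the
    -- normal form.
    have hjz : ∀ a b g κ r s : ℝ, κ ≠ 0 → r ≠ 0 → (L.affine r s).scale κ = jacobiForm a b g →
        L.a₄.eval (r + s) = 0 ∧ L.a₄.eval (-r + s) = 0 ∧ r + s ≠ -r + s := by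
      intro a b g κ r s hκ hr e
      rw [DiffOp4.eval_a₄_eq_zero_iff hκ hr e, DiffOp4.eval_a₄_eq_zero_iff hκ hr e, add_sub_cancel_right,
        add_sub_cancel_right, neg_div, div_self hr]
      refine ⟨by simp [jacobiForm], by simp [jacobiForm], fun h => hr (by linarith)⟩
    have hlz : ∀ a b A κ r s : ℝ, κ ≠ 0 → r ≠ 0 → (L.affine r s).scale κ = laguerreOp a b A →
        ∀ x, L.a₄.eval x = 0 ↔ x = s := by
      intro a b A κ r s hκ hr e x
      rw [DiffOp4.eval_a₄_eq_zero_iff hκ hr e]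
      simp [laguerreOp, hr, sub_eq_zero]
    have hhz : ∀ m₁ m₂ A κ : ℝ, L.scale κ = hermiteOp m₁ m₂ A → ∀ x, L.a₄.eval x ≠ 0 := by
      intro m₁ m₂ A κ e x hx
      have := congrArg (fun M : DiffOp4 => M.a₄.eval x) e
      simp [DiffOp4.scale, hermiteOp, hx] at this
    refine ⟨fun hz => ⟨fun H => ?_, ?_⟩, fun hz => ⟨fun H => ?_, ?_⟩, fun hz => ⟨fun H => ?_, ?_⟩⟩
    · rcases (down H).normal_form with h | ⟨κ, r, s, c, a, b, A, hκ, hr, -, -, -, e, -⟩ |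
        ⟨κ, r, s, c, a, b, g, hκ, hr, -, -, -, e, -⟩
      · exact h
      · exact absurd ((hlz a b A κ r s hκ hr e s).2 rfl) (hz s)
      · exact absurd (hjz a b g κ r s hκ hr e).1 (hz _)
    · rintro ⟨κ, m₀, m₁, m₂, A, hκ, hm, e, rfl, hp⟩
      refine up ((selfAdjointWith_hermite A hm).of_affine_scale DiffOp4.temperate_contDiff
        DiffOp4.temperate_affine one_ne_zero hκ (Real.exp_pos m₀) (s := 0) (by rw [DiffOp4.affine_one_zero, e])
        (by simp) fun y _ => ?_)
      rw [one_mul, add_zero, hp, ← Real.exp_add]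
      congr 1
      ring
    · obtain ⟨x, hx, huniq⟩ := hz
      rcases (down H).normal_form with ⟨κ, m₀, m₁, m₂, A, hκ, hm, e, -⟩ | h |
        ⟨κ, r, s, c, a, b, g, hκ, hr, -, -, -, e, -⟩
      · exact absurd hx (hhz m₁ m₂ A κ e x)
      · exact h
      · obtain ⟨h1, h2, h3⟩ := hjz a b g κ r s hκ hr e
        exact absurd ((huniq _ h1).trans (huniq _ h2).symm) h3
    · rintro ⟨κ, r, s, c, a, b, A, hκ, hr, hc, ha, hb, e, hI, hp⟩
      exact up ((selfAdjointWith_laguerre A ha hb).of_affine_scale DiffOp4.temperate_contDiff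
        DiffOp4.temperate_affine hr hκ hc e hI hp)
    · obtain ⟨x, x', hne, hx, hx'⟩ := hz
      rcases (down H).normal_form with ⟨κ, m₀, m₁, m₂, A, hκ, hm, e, -⟩ |
        ⟨κ, r, s, c, a, b, A, hκ, hr, -, -, -, e, -⟩ |
        ⟨κ, r, s, c, a, b, g, hκ, hr, hc, h1, h2, e, hI, hp⟩
      · exact absurd hx (hhz m₁ m₂ A κ e x)
      · have h := hlz a b A κ r s hκ hr e
        exact absurd (((h x).1 hx).trans ((h x').1 hx').symm) hne
      · refine ⟨κ, r, s, c, hκ, hr, hc, hI, ?_⟩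
        -- The case b = 0 is the symmetric family, with A recovered from g; otherwise B = g b.
        rcases eq_or_ne b 0 with rfl | hb
        · refine Or.inl ⟨a, 2 - 3 * a + a ^ 2 - g, by linarith, ?_, fun y hy => ?_⟩
          · rw [gegenbauerOp_eq, sub_sub_cancel, e]
          · rw [hp y hy, hwt y hy]
        · refine Or.inr ⟨a, b, g * b, hb, h1, h2, ?_, hp⟩
          rw [jacobiOp_eq hb, mul_div_cancel_right₀ _ hb, e]
    · rintro ⟨κ, r, s, c, hκ, hr, hc, hI, ⟨a, A, ha, e, hp⟩ | ⟨a, b, B, hb, h1, h2, e, hp⟩⟩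
      · rw [gegenbauerOp_eq] at e
        refine up ((selfAdjointWith_jacobi _ (by linarith) (by linarith)).of_affine_scale
          DiffOp4.temperate_contDiff DiffOp4.temperate_affine hr hκ hc e hI fun y hy => ?_)
        rw [hp y hy, hwt y hy]
      · rw [jacobiOp_eq hb] at e
        exact up ((selfAdjointWith_jacobi _ h1 h2).of_affine_scale
          DiffOp4.temperate_contDiff DiffOp4.temperate_affine hr hκ hc e hI hp)
  · rw [gegenbauerOp_eq]
    convert hasEigenvalues_jacobiForm a 0 (2 - 3 * a + a ^ 2 - A) (by linarith) (by linarith)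
      using 2
    ring
  · rw [jacobiOp_eq hb]
    convert hasEigenvalues_jacobiForm a b (B / b) h1 h2 using 2
    field_simp
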